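/- Fix an arbitrary function $m:\,]0,1]\to\mathbb{R}_{\ge 0}\cup\{\infty\}$. **Graphs.** A graph $G$ consists of a finite set of vertices $V^G$, a finite or countable set of edges $E^G$, source and target maps $s,t:E^G\to V^G$ and weights $\omega:E^G\to\,]0,1]$. An alternating path between $F$ and $G$ is a nonempty finite sequence of composable edges taken alternately from $E^F$ and $E^G$ (disjoint union); its weight is the product of the weights. The execution $F::G$ is the graph with vertices $V^F\Delta V^G$ whose edges are the alternating paths with source and target in $V^F\Delta V^G$. An alternating cycle is an alternating path whose last edge may be followed by its first one (composable, and of different origin); it is a 1-cycle if it is not of the form $\rho^k$ with $k\ge 2$; a 1-circuit is an alternating 1-cycle up to cyclic permutation. Put $[F,G]_m=\sum_\pi m(\omega(\pi))$, over all 1-circuits $\pi$. **Projects.** A sliced graph $F=\sum_{i\in I}\alpha_iF_i$ is a family, indexed by a finite nonempty set $I$, of real coefficients $\alpha_i$ and graphs $F_i$ on one and the same vertex set; $1_F=\sum_i\alpha_i$. Execution and $[\cdot,\cdot]_m$ are extended bilinearly, slices of $F::G$ being indexed by pairs; in $\mathbb{R}\cup\{\infty\}$ every sum or product containing $\infty$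 is $\infty$ (including $0\cdot\infty$). A project $\mathfrak a=(a,A)$ is a pair of a wager $a\in\mathbb{R}\cup\{\infty\}$ and a sliced graph $A$, whose vertex set is the carrier of $\mathfrak a$. Projects are considered up to renaming of slices and of edges. Put $$\langle\mathfrak a,\mathfrak b\rangle=a1_B+1_Ab+[A,B]_m,\qquad \mathfrak f::\mathfrak g=(\langle\mathfrak f,\mathfrak g\rangle,F::G),$$ and write $\mathfrak a\otimes\mathfrak b=\mathfrak a::\mathfrak b$ when the carriers are disjoint. Projects on the same carrier are orthogonal if $\langle\mathfrak a,\mathfrak b\rangle\ne 0,\infty$; $S^\perp$ is the set of projects (of the given carrier) orthogonal to all elements of $S$. A conduct of carrier $V$, a finite set, is a set $\mathbf A=\mathbf A^{\perp\perp}$ of projects of carrier $V$. For conducts of disjoint carriers, $\mathbf A\otimes\mathbf B=\{\mathfrak a\otimes\mathfrak b\mid\mathfrak a\in\mathbf A,\mathfrak b\in\mathbf B\}^{\perp\perp}$, and $\mathbf A\multimap\mathbf B$ is the set of projects $\mathfrak f$ of carrier $V^A\cup V^B$ with $\mathfrak f::\mathfrak a\in\mathbf B$ for all $\mathfrak a\in\mathbf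 A$. Injective maps of locations act on projects and conducts by renaming vertices. Let $\mathbf 1_\emptyset=\{(0,\emptyset)\}^{\perp\perp}$, where $\emptyset$ is the empty graph with no vertices taken as one slice of coefficient $1$, and $\bot_\emptyset=\mathbf 1_\emptyset^\perp$. **The category.** Let $\psi_i(x)=(x,i)$, $\phi(x,i)=2x+i$ for $i\in\{0,1\}$, $\mu(x,i)=(x,i+1)$, $\nu(x,i)=(x,i/2)$ for $i\in\{0,2\}$, and let $\tau$ be the permutation of $\mathbb{N}\times\{0,1\}$ that exchanges $(2x+1,0)$ and $(2x,1)$ for all $x$ and fixes the other elements. Objects are the conducts whose carrier is a finite subset of $\mathbb{N}$; the morphisms $\mathbf A\to\mathbf B$ are the projects in $\psi_0(\mathbf A)\multimap\psi_1(\mathbf B)$; the composite is $\mathfrak g\circ\mathfrak f=\nu(\mathfrak f::\mu(\mathfrak g))$; the identity of $\mathbf A$ is the project of wager $0$ with one slice of coefficient $1$ on $\psi_0(V^A)\cup\psi_1(V^A)$, with edges $(v,0)\to(v,1)$ and $(v,1)\to(v,0)$ of weight $1$ for every $v\in V^A$. Put $$\mathbf A\,\bar\otimes\,\mathbf B=\phi(\psi_0(\mathbf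 A)\otimes\psi_1(\mathbf B)),\qquad \mathfrak f\,\bar\otimes\,\mathfrak g=\tau\big(\psi_0(\phi(\mathfrak f))\otimes\psi_1(\phi(\mathfrak g))\big).$$ **Theorem.** For every $m$, these data form a category, and this category is $*$-autonomous: there are associativity, unit and symmetry isomorphisms that make it, with the bifunctor $\bar\otimes$ and the unit object $\mathbf 1_\emptyset$, a symmetric monoidal closed category, and $\bot_\emptyset$ is a dualizing object, i.e. for every $\mathbf A$ the canonical morphism from $\mathbf A$ to its double internal dual with respect to $\bot_\emptyset$ is an isomorphism. -/

import Mathlib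

open CategoryTheory MonoidalCategory
open scoped ENNReal symmDiff

noncomputable section

namespace IG

/-! ## Graphs, alternating paths, circuits -/

/-- Directed weighted graphs with vertices among the locations `L`: a finite set of vertices,
a finite or countably infinite set of edges, weights in `]0,1]`. -/
structure Graph (L : Type) where
  V : Finset L
  E : Type
  countable_E : Countable E
  s : E → L
  t : E → L
  ω : E → Set.Ioc (0 : ℝ) 1
  s_mem : ∀ e, s e ∈ V
  t_mem : ∀ e, t e ∈ V

namespace Graph

variable {L L' : Type}

/-- Two graphs are the same up to a renaming of the edges (the vertices are fixed). -/
def Same (F G : Graph L) : Prop :=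
  F.V = G.V ∧ ∃ e : F.E ≃ G.E,
    ∀ x, G.s (e x) = F.s x ∧ G.t (e x) = F.t x ∧ G.ω (e x) = F.ω x

/-- Source, target and weight in the plugging of `F` and `G`, whose edges are `F.E ⊕ G.E`;
the colour of an edge is given by `Sum.isLeft`. -/
def src (F G : Graph L) : F.E ⊕ G.E → L := Sum.elim F.s G.s

def tgt (F G : Graph L) : F.E ⊕ G.E → L := Sum.elim F.t G.t

def wt (F G : Graph L) : F.E ⊕ G.E → Set.Ioc (0 : ℝ) 1 := Sum.elim F.ω G.ω

/-- The edge `y` can follow the edge `x` in an alternating path. -/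
def Step (F G : Graph L) (x y : F.E ⊕ G.E) : Prop :=
  F.src G y = F.tgt G x ∧ x.isLeft ≠ y.isLeft

/-- Alternating paths between `F` and `G`: nonempty sequences of composable edges of
alternating colours. -/
structure AltPath (F G : Graph L) where
  edges : List (F.E ⊕ G.E)
  ne : edges ≠ []
  chain : edges.IsChain (F.Step G)

namespace AltPath

variable {F G : Graph L}

def source (π : AltPath F G) : L := F.src G (π.edges.head π.ne)

def target (π : AltPath F G) : L := F.tgt G (π.edges.getLast π.ne)

def weight (π : AltPath F G) : Set.Ioc (0 : ℝ) 1 := (π.edges.map (F.wt G)).prod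

theorem edges_injective : Function.Injective (edges : AltPath F G → _) := by
  rintro ⟨l, _, _⟩ ⟨l', _, _⟩ h
  cases h
  rfl

instance : Countable (AltPath F G) := by
  have := F.countable_E
  have := G.countable_E
  exact edges_injective.countable

end AltPath

/-- Execution `F ∷ G`: the edges are the alternating paths with source and target in the
symmetric difference of the sets of vertices. -/
def exec [DecidableEq L] (F G : Graph L) : Graph L where
  V := F.V ∆ G.V
  E := {π : AltPath F G // π.source ∈ F.V ∆ G.V ∧ π.target ∈ F.V ∆ G.V}
  countable_E := inferInstance
  s π := π.1.source
  t π := π.1.target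
  ω π := π.1.weight
  s_mem π := π.2.1
  t_mem π := π.2.2

/-- Alternating cycles in the plugging of `F` and `G`, as sequences of edges. -/
def IsAltCycle (F G : Graph L) (l : List (F.E ⊕ G.E)) : Prop :=
  ∃ h : l ≠ [], l.IsChain (F.Step G) ∧ F.Step G (l.getLast h) (l.head h)

/-- Alternating `1`-cycles: alternating cycles `l` such that `1` is the greatest `k` for which
`l` is the concatenation `ρ ^ k` of `k` copies of some `ρ` (such a `ρ` is always a cycle). -/
def IsAltOneCycle (F G : Graph L) (l : List (F.E ⊕ G.E)) : Prop :=
  F.IsAltCycle G l ∧ ∀ (k : ℕ) (ρ : List (F.E ⊕ G.E)), l = (List.replicate k ρ).flatten → k ≤ 1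

/-- Alternating `1`-cycles modulo cyclic permutations. -/
def circuitSetoid (F G : Graph L) : Setoid {l // F.IsAltOneCycle G l} :=
  Setoid.comap Subtype.val (List.IsRotated.setoid (F.E ⊕ G.E))

/-- The set of alternating `1`-circuits. -/
def Circuit (F G : Graph L) : Type := Quotient (F.circuitSetoid G)

def Circuit.weight {F G : Graph L} : Circuit F G → Set.Ioc (0 : ℝ) 1 :=
  Quotient.lift (fun l => (l.1.map (F.wt G)).prod) fun _ _ h =>
    ((List.IsRotated.perm h).map _).prod_eq

/-- The measurement of two graphs. -/
def meas (m : Set.Ioc (0 : ℝ) 1 → ℝ≥0∞) (F G : Graph L) : ℝ≥0∞ :=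
  ∑' c : Circuit F G, m c.weight

/-- The delocation of a graph along a map `φ` (meaningful when `φ` is injective on `G.V`). -/
def deloc [DecidableEq L'] (φ : L → L') (G : Graph L) : Graph L' where
  V := G.V.image φ
  E := G.E
  countable_E := G.countable_E
  s e := φ (G.s e)
  t e := φ (G.t e)
  ω := G.ω
  s_mem e := Finset.mem_image_of_mem φ (G.s_mem e)
  t_mem e := Finset.mem_image_of_mem φ (G.t_mem e)

/-- The graph on `V` without edges. -/
def empty (V : Finset L) : Graph L where
  V := V
  E := Empty
  countable_E := inferInstance
  s e := e.elim
  t e := e.elim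
  ω e := e.elim
  s_mem e := e.elim
  t_mem e := e.elim

/-! ### Invariance under renaming of edges -/

theorem Same.refl (F : Graph L) : Same F F := ⟨rfl, Equiv.refl _, fun _ => ⟨rfl, rfl, rfl⟩⟩

theorem Same.symm {F G : Graph L} : Same F G → Same G F := by
  rintro ⟨hV, e, he⟩
  refine ⟨hV.symm, e.symm, fun x => ?_⟩
  obtain ⟨h1, h2, h3⟩ := he (e.symm x)
  simp only [Equiv.apply_symm_apply] at h1 h2 h3
  exact ⟨h1.symm, h2.symm, h3.symm⟩

theorem Same.trans {F G H : Graph L} : Same F G → Same G H → Same F H := by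
  rintro ⟨hV, e, he⟩ ⟨hV', e', he'⟩
  refine ⟨hV.trans hV', e.trans e', fun x => ?_⟩
  obtain ⟨h1, h2, h3⟩ := he x
  obtain ⟨h1', h2', h3'⟩ := he' (e x)
  exact ⟨h1'.trans h1, h2'.trans h2, h3'.trans h3⟩

theorem isAltOneCycle_map {F G : Graph L} {F' G' : Graph L'} (σ : F.E ⊕ G.E ≃ F'.E ⊕ G'.E)
    (hs : ∀ x y, F'.Step G' (σ x) (σ y) ↔ F.Step G x y) (l : List (F.E ⊕ G.E)) :
    F.IsAltOneCycle G l ↔ F'.IsAltOneCycle G' (l.map σ) := by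
  have key : ∀ k ρ, (List.replicate k (List.map σ ρ)).flatten
      = List.map σ ((List.replicate k ρ).flatten) := by
    intro k ρ
    simp [List.map_flatten]
  constructor
  · rintro ⟨⟨h, hc, hl⟩, hp⟩
    refine ⟨⟨by simpa using h, ?_, ?_⟩, ?_⟩
    · rw [List.isChain_map]
      simpa [hs] using hc
    · rw [List.getLast_map, List.head_map, hs]
      exact hl
    · intro k ρ hρ
      refine hp k (ρ.map σ.symm) ?_
      have h2 : ρ = List.map σ (ρ.map σ.symm) := by simp
      rw [h2, key] at hρ
      exact σ.injective.list_map hρ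
  · rintro ⟨⟨h, hc, hl⟩, hp⟩
    have h0 : l ≠ [] := by simpa using h
    refine ⟨⟨h0, ?_, ?_⟩, ?_⟩
    · rw [List.isChain_map] at hc
      simpa [hs] using hc
    · rw [List.getLast_map, List.head_map, hs] at hl
      exact hl
    · intro k ρ hρ
      exact hp k (ρ.map σ) (by rw [key, ← hρ])

theorem meas_congr (m : Set.Ioc (0 : ℝ) 1 → ℝ≥0∞) {F G : Graph L} {F' G' : Graph L'}
    (σ : F.E ⊕ G.E ≃ F'.E ⊕ G'.E)
    (hs : ∀ x y, F'.Step G' (σ x) (σ y) ↔ F.Step G x y)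
    (hw : ∀ x, F'.wt G' (σ x) = F.wt G x) : meas m F G = meas m F' G' := by
  let e : {l // F.IsAltOneCycle G l} ≃ {l // F'.IsAltOneCycle G' l} :=
    (Equiv.listEquivOfEquiv σ).subtypeEquiv (isAltOneCycle_map σ hs)
  have he : ∀ l, (e l).1 = l.1.map σ := fun _ => rfl
  let q : Circuit F G ≃ Circuit F' G' := Quotient.congr e (by
    intro a b
    change a.1 ~r b.1 ↔ (e a).1 ~r (e b).1
    rw [he, he]
    constructor
    · exact fun h => h.map σ
    · intro h
      simpa using h.map σ.symm)
  unfold meas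
  rw [← q.tsum_eq]
  refine tsum_congr fun c => ?_
  induction c using Quotient.inductionOn with
  | h l =>
    congr 1
    change (l.1.map (F.wt G)).prod = ((e l).1.map (F'.wt G')).prod
    rw [he, List.map_map]
    congr 1
    exact List.map_congr_left fun x _ => (hw x).symm

theorem step_sumCongr {F F' G G' : Graph L} (e : F.E ≃ F'.E) (e' : G.E ≃ G'.E)
    (he : ∀ x, F'.s (e x) = F.s x ∧ F'.t (e x) = F.t x ∧ F'.ω (e x) = F.ω x)
    (he' : ∀ x, G'.s (e' x) = G.s x ∧ G'.t (e' x) = G.t x ∧ G'.ω (e' x) = G.ω x)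
    (x y : F.E ⊕ G.E) :
    F'.Step G' (Equiv.sumCongr e e' x) (Equiv.sumCongr e e' y) ↔ F.Step G x y := by
  rcases x with x | x <;> rcases y with y | y <;> simp [Step, src, tgt, he, he']

theorem Same.meas_eq (m : Set.Ioc (0 : ℝ) 1 → ℝ≥0∞) {F F' G G' : Graph L} :
    Same F F' → Same G G' → meas m F G = meas m F' G' := by
  rintro ⟨_, e, he⟩ ⟨_, e', he'⟩
  refine meas_congr m (Equiv.sumCongr e e') (step_sumCongr e e' he he') ?_
  rintro (x | x) <;> simp [wt, he, he']

theorem meas_comm (m : Set.Ioc (0 : ℝ) 1 → ℝ≥0∞) (F G : Graph L) :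
    meas m F G = meas m G F := by
  refine meas_congr m (Equiv.sumComm _ _) ?_ ?_
  · rintro (x | x) (y | y) <;> simp [Step, src, tgt]
  · rintro (x | x) <;> simp [wt]

/-- Renaming the edges in an alternating path. -/
def AltPath.map {F G F' G' : Graph L} (σ : F.E ⊕ G.E ≃ F'.E ⊕ G'.E)
    (hs : ∀ x y, F'.Step G' (σ x) (σ y) ↔ F.Step G x y) (π : AltPath F G) : AltPath F' G' where
  edges := π.edges.map σ
  ne := by simpa using π.ne
  chain := by
    rw [List.isChain_map]
    simpa [hs] using π.chain

theorem Same.exec [DecidableEq L] {F F' G G' : Graph L} :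
    Same F F' → Same G G' → Same (F.exec G) (F'.exec G') := by
  rintro ⟨hV, e, he⟩ ⟨hV', e', he'⟩
  let σ := Equiv.sumCongr e e'
  have hs : ∀ x y, F'.Step G' (σ x) (σ y) ↔ F.Step G x y := step_sumCongr e e' he he'
  have hs' : ∀ x y, F.Step G (σ.symm x) (σ.symm y) ↔ F'.Step G' x y := by
    intro x y
    rw [← hs, σ.apply_symm_apply, σ.apply_symm_apply]
  have h1 : ∀ x, F'.src G' (σ x) = F.src G x := by
    rintro (x | x) <;> simp [σ, src, he, he']
  have h2 : ∀ x, F'.tgt G' (σ x) = F.tgt G x := by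
    rintro (x | x) <;> simp [σ, tgt, he, he']
  have h3 : ∀ x, F'.wt G' (σ x) = F.wt G x := by
    rintro (x | x) <;> simp [σ, wt, he, he']
  let p : AltPath F G ≃ AltPath F' G' :=
    { toFun := AltPath.map σ hs
      invFun := AltPath.map σ.symm hs'
      left_inv := fun π => AltPath.edges_injective (by simp [AltPath.map])
      right_inv := fun π => AltPath.edges_injective (by simp [AltPath.map]) }
  have p1 : ∀ π, (p π).source = π.source := by
    intro π
    simp only [p, AltPath.source, AltPath.map, Equiv.coe_fn_mk, List.head_map, h1]
  have p2 : ∀ π, (p π).target = π.target := by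
    intro π
    simp only [p, AltPath.target, AltPath.map, Equiv.coe_fn_mk, List.getLast_map, h2]
  have p3 : ∀ π, (p π).weight = π.weight := by
    intro π
    simp only [p, AltPath.weight, AltPath.map, Equiv.coe_fn_mk, List.map_map]
    congr 1
    exact List.map_congr_left fun x _ => h3 x
  refine ⟨by simp only [Graph.exec, hV, hV'], p.subtypeEquiv ?_, ?_⟩
  · intro π
    rw [p1, p2, hV, hV']
  · rintro ⟨π, hπ⟩
    exact ⟨p1 π, p2 π, p3 π⟩

theorem Same.deloc [DecidableEq L'] (φ : L → L') {F G : Graph L} :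
    Same F G → Same (F.deloc φ) (G.deloc φ) := by
  rintro ⟨hV, e, he⟩
  refine ⟨by simp only [Graph.deloc, hV], e, fun x => ?_⟩
  obtain ⟨h1, h2, h3⟩ := he x
  exact ⟨congrArg φ h1, congrArg φ h2, h3⟩

end Graph

/-! ## Sliced graphs and projects -/

/-- Finite nonempty families `∑ i, α i • slice i` of graphs on the same set of vertices. -/
structure SlicedGraph (L : Type) where
  V : Finset L
  I : Type
  fintype_I : Fintype I
  nonempty_I : Nonempty I
  α : I → ℝ
  slice : I → Graph L
  slice_V : ∀ i, (slice i).V = V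

attribute [instance] SlicedGraph.fintype_I SlicedGraph.nonempty_I

/-- A real multiple of an element of `ℝ ∪ {∞}`, with the convention that every product
containing `∞` equals `∞` (even `0 * ∞`). Sums are those of `WithTop ℝ`. -/
def scale (r : ℝ) (x : WithTop ℝ) : WithTop ℝ := x.map (r * ·)

/-- The inclusion of `[0, ∞]` in `ℝ ∪ {∞}`. -/
def ext (x : ℝ≥0∞) : WithTop ℝ := if x = ⊤ then ⊤ else (x.toReal : WithTop ℝ)

namespace SlicedGraph

variable {L L' : Type}

/-- `F` and `G` are the same up to a renaming of the slices and of the edges. -/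
def Same (F G : SlicedGraph L) : Prop :=
  F.V = G.V ∧ ∃ e : F.I ≃ G.I,
    ∀ i, G.α (e i) = F.α i ∧ (F.slice i).Same (G.slice (e i))

/-- The sum of the coefficients. -/
def unit (F : SlicedGraph L) : ℝ := ∑ i, F.α i

def exec [DecidableEq L] (F G : SlicedGraph L) : SlicedGraph L where
  V := F.V ∆ G.V
  I := F.I × G.I
  fintype_I := inferInstance
  nonempty_I := inferInstance
  α p := F.α p.1 * G.α p.2
  slice p := (F.slice p.1).exec (G.slice p.2)
  slice_V p := by simp only [Graph.exec, F.slice_V, G.slice_V]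

def meas (m : Set.Ioc (0 : ℝ) 1 → ℝ≥0∞) (F G : SlicedGraph L) : WithTop ℝ :=
  ∑ p : F.I × G.I, scale (F.α p.1 * G.α p.2) (ext ((F.slice p.1).meas m (G.slice p.2)))

def deloc [DecidableEq L'] (φ : L → L') (F : SlicedGraph L) : SlicedGraph L' where
  V := F.V.image φ
  I := F.I
  fintype_I := inferInstance
  nonempty_I := inferInstance
  α := F.α
  slice i := (F.slice i).deloc φ
  slice_V i := by simp only [Graph.deloc, F.slice_V]

/-- A graph, as a sliced graph with one slice of coefficient `1`. -/
def single (G : Graph L) : SlicedGraph L where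
  V := G.V
  I := Unit
  fintype_I := inferInstance
  nonempty_I := inferInstance
  α _ := 1
  slice _ := G
  slice_V _ := rfl

theorem Same.refl (F : SlicedGraph L) : Same F F :=
  ⟨rfl, Equiv.refl _, fun _ => ⟨rfl, Graph.Same.refl _⟩⟩

theorem Same.symm {F G : SlicedGraph L} : Same F G → Same G F := by
  rintro ⟨hV, e, he⟩
  refine ⟨hV.symm, e.symm, fun x => ?_⟩
  obtain ⟨h1, h2⟩ := he (e.symm x)
  rw [e.apply_symm_apply] at h1 h2
  exact ⟨h1.symm, h2.symm⟩

theorem Same.trans {F G H : SlicedGraph L} : Same F G → Same G H → Same F H := by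
  rintro ⟨hV, e, he⟩ ⟨hV', e', he'⟩
  exact ⟨hV.trans hV', e.trans e', fun x =>
    ⟨(he' (e x)).1.trans (he x).1, (he x).2.trans (he' (e x)).2⟩⟩

theorem Same.unit_eq {F G : SlicedGraph L} : Same F G → F.unit = G.unit := by
  rintro ⟨_, e, he⟩
  unfold unit
  rw [← e.sum_comp]
  exact Finset.sum_congr rfl fun i _ => (he i).1.symm

theorem Same.exec [DecidableEq L] {F F' G G' : SlicedGraph L} :
    Same F F' → Same G G' → Same (F.exec G) (F'.exec G') := by
  rintro ⟨hV, e, he⟩ ⟨hV', e', he'⟩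
  refine ⟨by simp only [SlicedGraph.exec, hV, hV'], Equiv.prodCongr e e', ?_⟩
  rintro ⟨i, j⟩
  refine ⟨?_, (he i).2.exec (he' j).2⟩
  change F'.α (e i) * G'.α (e' j) = F.α i * G.α j
  rw [(he i).1, (he' j).1]

theorem Same.meas_eq (m : Set.Ioc (0 : ℝ) 1 → ℝ≥0∞) {F F' G G' : SlicedGraph L} :
    Same F F' → Same G G' → meas m F G = meas m F' G' := by
  rintro ⟨_, e, he⟩ ⟨_, e', he'⟩
  unfold meas
  rw [← (Equiv.prodCongr e e').sum_comp]
  refine Finset.sum_congr rfl ?_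
  rintro ⟨i, j⟩ _
  simp [(he i).1, (he' j).1, Graph.Same.meas_eq m (he i).2 (he' j).2]

theorem meas_comm (m : Set.Ioc (0 : ℝ) 1 → ℝ≥0∞) (F G : SlicedGraph L) :
    meas m F G = meas m G F := by
  unfold meas
  rw [← (Equiv.prodComm G.I F.I).sum_comp]
  refine Finset.sum_congr rfl ?_
  rintro ⟨i, j⟩ _
  simp [mul_comm, Graph.meas_comm m (F.slice j) (G.slice i)]

theorem Same.deloc [DecidableEq L'] (φ : L → L') {F G : SlicedGraph L} :
    Same F G → Same (F.deloc φ) (G.deloc φ) := by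
  rintro ⟨hV, e, he⟩
  exact ⟨by simp only [SlicedGraph.deloc, hV], e, fun i => ⟨(he i).1, (he i).2.deloc φ⟩⟩

end SlicedGraph

/-- A wager in `ℝ ∪ {∞}` together with a sliced graph. -/
structure PreProject (L : Type) where
  wager : WithTop ℝ
  graph : SlicedGraph L

/-- Projects are considered up to a renaming of slices and edges. -/
def PreProject.setoid (L : Type) : Setoid (PreProject L) where
  r a b := a.wager = b.wager ∧ a.graph.Same b.graph
  iseqv :=
    { refl := fun _ => ⟨rfl, SlicedGraph.Same.refl _⟩
      symm := fun h => ⟨h.1.symm, h.2.symm⟩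
      trans := fun h h' => ⟨h.1.trans h'.1, h.2.trans h'.2⟩ }

/-- Projects with carrier in `L`. -/
def Project (L : Type) : Type 1 := Quotient (PreProject.setoid L)

namespace PreProject

variable {L L' : Type}

/-- The measurement `a 1_B + 1_A b + ⟪A, B⟫`. -/
def sca (m : Set.Ioc (0 : ℝ) 1 → ℝ≥0∞) (a b : PreProject L) : WithTop ℝ :=
  scale b.graph.unit a.wager + scale a.graph.unit b.wager + a.graph.meas m b.graph

def cut [DecidableEq L] (m : Set.Ioc (0 : ℝ) 1 → ℝ≥0∞) (f g : PreProject L) : PreProject L where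
  wager := sca m f g
  graph := f.graph.exec g.graph

def deloc [DecidableEq L'] (φ : L → L') (a : PreProject L) : PreProject L' where
  wager := a.wager
  graph := a.graph.deloc φ

theorem sca_congr (m : Set.Ioc (0 : ℝ) 1 → ℝ≥0∞) {a a' b b' : PreProject L}
    (h : (setoid L).r a a') (h' : (setoid L).r b b') : sca m a b = sca m a' b' := by
  unfold sca
  rw [h.1, h'.1, h.2.unit_eq, h'.2.unit_eq, SlicedGraph.Same.meas_eq m h.2 h'.2]

theorem sca_comm (m : Set.Ioc (0 : ℝ) 1 → ℝ≥0∞) (a b : PreProject L) :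
    sca m a b = sca m b a := by
  unfold sca
  rw [SlicedGraph.meas_comm, add_comm (scale b.graph.unit a.wager)]

end PreProject

namespace Project

variable {L L' : Type}

def carrier : Project L → Finset L :=
  Quotient.lift (fun a => a.graph.V) fun _ _ h => h.2.1

/-- The measurement `⟪a, b⟫` of two projects. -/
def sca (m : Set.Ioc (0 : ℝ) 1 → ℝ≥0∞) : Project L → Project L → WithTop ℝ :=
  Quotient.lift₂ (PreProject.sca m) fun _ _ _ _ h h' => PreProject.sca_congr m h h'

/-- The cut `f ∷ g = (⟪f, g⟫, F ∷ G)` of two projects. -/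
def cut [DecidableEq L] (m : Set.Ioc (0 : ℝ) 1 → ℝ≥0∞) : Project L → Project L → Project L :=
  Quotient.map₂ (PreProject.cut m) fun _ _ h _ _ h' =>
    ⟨PreProject.sca_congr m h h', h.2.exec h'.2⟩

/-- The tensor product `(⟪a, b⟫, A ∪ B)` of projects of disjoint carriers, where `A ∪ B` stands
for the execution of `A` and `B`. -/
def tensor [DecidableEq L] (m : Set.Ioc (0 : ℝ) 1 → ℝ≥0∞) (a b : Project L) : Project L :=
  cut m a b

/-- Delocation along `φ`; it is only used when `φ` is injective on the carrier. -/
def deloc [DecidableEq L'] (φ : L → L') : Project L → Project L' :=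
  Quotient.map (PreProject.deloc φ) fun _ _ h => ⟨h.1, h.2.deloc φ⟩

/-- The project `(0, (V, ∅))`. -/
def zero (V : Finset L) : Project L :=
  Quotient.mk (PreProject.setoid L) ⟨0, SlicedGraph.single (Graph.empty V)⟩

theorem sca_comm (m : Set.Ioc (0 : ℝ) 1 → ℝ≥0∞) (a b : Project L) : sca m a b = sca m b a := by
  induction a, b using Quotient.inductionOn₂ with
  | h a b => exact PreProject.sca_comm m a b

/-- Orthogonality of projects on the same carrier. -/
def Orth (m : Set.Ioc (0 : ℝ) 1 → ℝ≥0∞) (a b : Project L) : Prop :=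
  a.carrier = b.carrier ∧ sca m a b ≠ 0 ∧ sca m a b ≠ ⊤

theorem Orth.symm {m : Set.Ioc (0 : ℝ) 1 → ℝ≥0∞} {a b : Project L} (h : Orth m a b) :
    Orth m b a := by
  unfold Orth at *
  rw [sca_comm m b a]
  exact ⟨h.1.symm, h.2⟩

end Project

/-- The orthogonal of a set of projects of carrier `V`. -/
def polar {L : Type} (m : Set.Ioc (0 : ℝ) 1 → ℝ≥0∞) (V : Finset L) (S : Set (Project L)) :
    Set (Project L) :=
  {b | b.carrier = V ∧ ∀ a ∈ S, Project.Orth m a b}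

theorem polar_polar_polar {L : Type} (m : Set.Ioc (0 : ℝ) 1 → ℝ≥0∞) (V : Finset L)
    {S : Set (Project L)} (hS : ∀ a ∈ S, a.carrier = V) :
    polar m V (polar m V (polar m V S)) = polar m V S := by
  apply Set.Subset.antisymm
  · intro b hb
    exact ⟨hb.1, fun a ha => hb.2 a ⟨hS a ha, fun c hc => (hc.2 a ha).symm⟩⟩
  · intro b hb
    exact ⟨hb.1, fun c hc => (hc.2 b hb).symm⟩

/-! ## Conducts with carrier in `ℕ` -/

/-- Conducts with (finite) carrier in `ℕ`: sets of projects of carrier `carrier` that are equal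
to their bi-orthogonal. -/
@[ext]
structure Conduct (m : Set.Ioc (0 : ℝ) 1 → ℝ≥0∞) where
  carrier : Finset ℕ
  projects : Set (Project ℕ)
  carrier_eq : ∀ a ∈ projects, a.carrier = carrier
  biorth : polar m carrier (polar m carrier projects) = projects

namespace Conduct

variable {m : Set.Ioc (0 : ℝ) 1 → ℝ≥0∞}

/-- The orthogonal of a conduct. -/
def orth (A : Conduct m) : Conduct m where
  carrier := A.carrier
  projects := polar m A.carrier A.projects
  carrier_eq _ ha := ha.1
  biorth := polar_polar_polar m _ A.carrier_eq

/-- The conduct `1_∅ = {0_∅}^⊥⊥`. -/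
def one (m : Set.Ioc (0 : ℝ) 1 → ℝ≥0∞) : Conduct m where
  carrier := ∅
  projects := polar m ∅ (polar m ∅ {Project.zero ∅})
  carrier_eq _ ha := ha.1
  biorth := polar_polar_polar m ∅ fun _ ha => ha.1

/-- The conduct `⊥_∅ = 1_∅^⊥`. -/
def bot (m : Set.Ioc (0 : ℝ) 1 → ℝ≥0∞) : Conduct m := (one m).orth

end Conduct

/-! ## Relocations

The sets `ℕ × {0,1}`, `ℕ × {1,2}`, `ℕ × {0,2}` are viewed as subsets of `ℕ × ℕ`. -/

/-- `ψ i : ℕ → ℕ × {i}`. -/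
def ψ (i : ℕ) (x : ℕ) : ℕ × ℕ := (x, i)

/-- The bijection `ℕ × {0,1} → ℕ × {1,2}`. -/
def μ (p : ℕ × ℕ) : ℕ × ℕ := (p.1, p.2 + 1)

/-- The bijection `ℕ × {0,2} → ℕ × {0,1}` (division of natural numbers). -/
def ν (p : ℕ × ℕ) : ℕ × ℕ := (p.1, p.2 / 2)

/-- The bijection `ℕ × {0,1} → ℕ`. -/
def φ (p : ℕ × ℕ) : ℕ := 2 * p.1 + p.2

/-- The permutation of `ℕ × {0,1}` exchanging `(2x+1, 0)` and `(2x, 1)`. -/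
def τ (p : ℕ × ℕ) : ℕ × ℕ :=
  if p.1 % 2 = 1 ∧ p.2 = 0 then (p.1 - 1, 1)
  else if p.1 % 2 = 0 ∧ p.2 = 1 then (p.1 + 1, 0)
  else p

/-! ## The category of conducts -/

/-- The linear implication of sets of projects of (disjoint) carriers `V` and `W`. -/
def lolli {L : Type} [DecidableEq L] (m : Set.Ioc (0 : ℝ) 1 → ℝ≥0∞) (V : Finset L)
    (S : Set (Project L)) (W : Finset L) (T : Set (Project L)) : Set (Project L) :=
  {f | f.carrier = V ∪ W ∧ ∀ a ∈ S, Project.cut m f a ∈ T}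

variable {m : Set.Ioc (0 : ℝ) 1 → ℝ≥0∞}

/-- The morphisms from `A` to `B`: the projects in `ψ₀(A) ⊸ ψ₁(B)`. -/
def Mor (A B : Conduct m) : Set (Project (ℕ × ℕ)) :=
  lolli m (A.carrier.image (ψ 0)) (Project.deloc (ψ 0) '' A.projects)
    (B.carrier.image (ψ 1)) (Project.deloc (ψ 1) '' B.projects)

/-- The composite `g ∘ f = ν(f ∷ μ(g))`. -/
def comp (m : Set.Ioc (0 : ℝ) 1 → ℝ≥0∞) (f g : Project (ℕ × ℕ)) : Project (ℕ × ℕ) :=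
  Project.deloc ν (Project.cut m f (Project.deloc μ g))

/-- The graph with an edge from `(v, 0)` to `(v, 1)` and an edge from `(v, 1)` to `(v, 0)`, both
of weight `1`, for every `v ∈ V`. -/
def faxGraph (V : Finset ℕ) : Graph (ℕ × ℕ) where
  V := V.image (ψ 0) ∪ V.image (ψ 1)
  E := V ⊕ V
  countable_E := inferInstance
  s := Sum.elim (fun v => ψ 0 v) (fun v => ψ 1 v)
  t := Sum.elim (fun v => ψ 1 v) (fun v => ψ 0 v)
  ω _ := 1
  s_mem := by rintro (⟨v, hv⟩ | ⟨v, hv⟩) <;> simp [ψ, hv]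
  t_mem := by rintro (⟨v, hv⟩ | ⟨v, hv⟩) <;> simp [ψ, hv]

/-- The fax on `V`, the identity of the conducts of carrier `V`. -/
def fax (V : Finset ℕ) : Project (ℕ × ℕ) :=
  Quotient.mk (PreProject.setoid _) ⟨0, SlicedGraph.single (faxGraph V)⟩

/-- Conducts, morphisms, composition and identities form a category. -/
structure CategoryLaws (m : Set.Ioc (0 : ℝ) 1 → ℝ≥0∞) : Prop where
  fax_mem : ∀ A : Conduct m, fax A.carrier ∈ Mor A A
  comp_mem : ∀ {A B C : Conduct m} {f g : Project (ℕ × ℕ)},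
    f ∈ Mor A B → g ∈ Mor B C → comp m f g ∈ Mor A C
  fax_comp : ∀ {A B : Conduct m} {f : Project (ℕ × ℕ)}, f ∈ Mor A B → comp m (fax A.carrier) f = f
  comp_fax : ∀ {A B : Conduct m} {f : Project (ℕ × ℕ)}, f ∈ Mor A B → comp m f (fax B.carrier) = f
  assoc : ∀ {A B C D : Conduct m} {f g h : Project (ℕ × ℕ)},
    f ∈ Mor A B → g ∈ Mor B C → h ∈ Mor C D →
      comp m (comp m f g) h = comp m f (comp m g h)

/-- The category of conducts. -/
@[reducible]
def CategoryLaws.category (h : CategoryLaws m) : Category.{1} (Conduct m) where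
  Hom A B := {f : Project (ℕ × ℕ) // f ∈ Mor A B}
  id A := ⟨fax A.carrier, h.fax_mem A⟩
  comp f g := ⟨comp m f.1 g.1, h.comp_mem f.2 g.2⟩
  id_comp f := Subtype.ext (h.fax_comp f.2)
  comp_id f := Subtype.ext (h.comp_fax f.2)
  assoc f g k := Subtype.ext (h.assoc f.2 g.2 k.2)

/-- The underlying project of a morphism. -/
def CategoryLaws.proj (h : CategoryLaws m) {A B : Conduct m} (f : h.category.Hom A B) :
    Project (ℕ × ℕ) := f.1

/-- The carrier of `φ(ψ₀(A) ⊗ ψ₁(B))`. -/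
def tensorCarrier (A B : Conduct m) : Finset ℕ :=
  (A.carrier.image (ψ 0) ∪ B.carrier.image (ψ 1)).image φ

/-- The projects of `φ(ψ₀(A) ⊗ ψ₁(B))`, where the tensor product of two conducts of disjoint
carriers is the bi-orthogonal of the set of all `a ⊗ b`. -/
def tensorProjects (A B : Conduct m) : Set (Project ℕ) :=
  Project.deloc φ ''
    polar m (A.carrier.image (ψ 0) ∪ B.carrier.image (ψ 1))
      (polar m (A.carrier.image (ψ 0) ∪ B.carrier.image (ψ 1))
        (Set.image2 (fun a b => Project.tensor m (Project.deloc (ψ 0) a) (Project.deloc (ψ 1) b))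
          A.projects B.projects))

/-- The tensor product `τ(ψ₀(φ(f)) ⊗ ψ₁(φ(g)))` of two morphisms. -/
def tensorMor (m : Set.Ioc (0 : ℝ) 1 → ℝ≥0∞) (f g : Project (ℕ × ℕ)) : Project (ℕ × ℕ) :=
  Project.deloc τ (Project.tensor m
    (Project.deloc (ψ 0) (Project.deloc φ f)) (Project.deloc (ψ 1) (Project.deloc φ g)))

end IG

/-- In a symmetric monoidal closed category, the object `D` is dualizing: for every `A`, the
canonical morphism `A ⟶ (A ⊸ D) ⊸ D`, the transpose of the evaluation, is an isomorphism. -/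
def IsDualizing {C : Type*} [Category C] [MonoidalCategory C] [SymmetricCategory C]
    [MonoidalClosed C] (D : C) : Prop :=
  ∀ A : C, IsIso (MonoidalClosed.curry ((β_ ((ihom A).obj D) A).hom ≫ (ihom.ev A).app D) :
    A ⟶ (ihom ((ihom A).obj D)).obj D)

end

/-!
The proof separates a combinatorial part, which concerns alternating paths and circuits, from a
formal part, in which graphs no longer appear.

**Combinatorial part.** When no vertex belongs to all three of `F`, `G`, `H`, the paths of
`(F ∷ G) ∷ H` are the paths, in the plugging of the three graphs, whose consecutive edges come from
different graphs (`Graph.exec_exec_same`): unfolding a path of paths is a bijection, since a maximal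
run of edges of `F` and `G` is one edge of `F ∷ G`. This description is invariant under cyclic
permutation of `F`, `G`, `H`, hence execution is associative. Likewise, the `1`-circuits of the
plugging of three graphs are those that use `H`, which are the `1`-circuits between `F ∷ G` and `H`,
and those that do not, which are the `1`-circuits between `F` and `G`. This is the trefoil property
`⟦F ∷ G, H⟧ + ⟦F, G⟧ = ⟦F, G, H⟧` (`Graph.meas_exec_add`), whose right-hand side is again
cyclically invariant. A circuit is an aperiodic cyclic word; the lemmas on `IsCode` say that
substituting a code into words respects cycles, aperiodicity and rotation. For projects this
gives associativity (`Project.cut_assoc`) and the adjunction `⟪f ∷ g, h⟫ = ⟪f, g ∷ h⟫`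
(`Project.sca_cut`). The last combinatorial fact is that executing a graph against edges of weight
`1` going back and forth between `b v` and `c v` moves the vertices `b v` to `c v`
(`Graph.exec_link_same`, `Project.cut_link`).

**Formal part.** The adjunction yields `S ⊸ T^⊥ = (S ⊗ T)^⊥` (`lolli_polar`), so that `A ⊸ B` is
a conduct, linear maps may be tested on generators (`lolli_polar_polar`), and projects in
`(S ⊗ T) ⊸ R` and in `T ⊸ (S ⊸ R)` are the same (`lolli_curry`). Associativity gives the category:
composites of two and of three morphisms are executions of projects placed on consecutive levels of
`ℕ × ℕ`. Every structural morphism of the monoidal structure is a relocation, that is, a project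
that links `(x, 0)` with `(θ x, 1)` for every location `x` of its source (`IsRelocation`).
Composition and tensor product of relocations are computed on these maps, and composing with a
relocation renames the vertices; thus naturality and coherence reduce to identities between maps of
locations. Transposition is a renaming of vertices too (`curryEquiv`), which gives the closed
structure. Finally `A ⊸ ⊥` is `A^⊥` up to renaming, and the canonical morphism from `A` to its
double dual is the relocation along `x ↦ 4 x`; it is an isomorphism because `A` is equal to its
bi-orthogonal.
-/

noncomputable section

namespace IG

/-! ### Cyclic words -/

section Words

variable {X T : Type*}

/-- Words `l` that are cycles for the relation `r` and are not proper powers. -/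
def IsOneCycle (r : X → X → Prop) (l : List X) : Prop :=
  (∃ h : l ≠ [], l.IsChain r ∧ r (l.getLast h) (l.head h)) ∧
    ∀ (k : ℕ) (ρ : List X), l = (List.replicate k ρ).flatten → k ≤ 1

/-- Rotation of the words satisfying `IsOneCycle r`. -/
def cycleSetoid (r : X → X → Prop) : Setoid {l // IsOneCycle r l} :=
  Setoid.comap Subtype.val (List.IsRotated.setoid X)

/-- The `1`-circuits of an abstract relation `r`; for `r = F.Step G` this is, definitionally, the
type `F.Circuit G`. -/
def OneCircuit (r : X → X → Prop) : Type _ := Quotient (cycleSetoid r)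

/-- The product of the weights of the letters of a circuit. -/
def OneCircuit.weight {r : X → X → Prop} (w : X → Set.Ioc (0 : ℝ) 1) :
    OneCircuit r → Set.Ioc (0 : ℝ) 1 :=
  Quotient.lift (fun l => (l.1.map w).prod) fun _ _ h =>
    ((List.IsRotated.perm h).map _).prod_eq

/-- The circuit goes through a letter satisfying `P`. -/
def OneCircuit.Meets {r : X → X → Prop} (P : X → Prop) : OneCircuit r → Prop :=
  Quotient.lift (fun l => ∃ x ∈ l.1, P x) fun _ _ h => by
    refine propext ⟨?_, ?_⟩ <;> rintro ⟨x, hx, hP⟩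
    · exact ⟨x, (List.IsRotated.mem_iff h).1 hx, hP⟩
    · exact ⟨x, (List.IsRotated.mem_iff h).2 hx, hP⟩

/-- A word `l` is a cycle as soon as `l ++ l` is a chain, a form that behaves well under rotation
and substitution. -/
theorem isCycle_iff (r : X → X → Prop) (l : List X) :
    (∃ h : l ≠ [], l.IsChain r ∧ r (l.getLast h) (l.head h)) ↔ l ≠ [] ∧ (l ++ l).IsChain r := by
  rw [List.isChain_append]
  constructor
  · rintro ⟨h, hc, hl⟩
    refine ⟨h, hc, hc, ?_⟩
    intro x hx y hy
    rw [List.getLast?_eq_getLast_of_ne_nil h] at hx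
    rw [List.head?_eq_some_head h] at hy
    cases hx; cases hy
    exact hl
  · rintro ⟨h, hc, -, hl⟩
    exact ⟨h, hc, hl _ (List.getLast?_eq_getLast_of_ne_nil h) _ (List.head?_eq_some_head h)⟩

theorem append_flatten_replicate (u v : List X) (k : ℕ) :
    v ++ (List.replicate k (u ++ v)).flatten = (List.replicate k (v ++ u)).flatten ++ v := by
  induction k with
  | zero => simp
  | succ k ih =>
    rw [List.replicate_succ, List.flatten_cons, List.replicate_succ, List.flatten_cons,
      List.append_assoc, ih]
    simp only [List.append_assoc]

theorem IsOneCycle.append_comm {r : X → X → Prop} {u v : List X} (h : IsOneCycle r (u ++ v)) :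
    IsOneCycle r (v ++ u) := by
  obtain ⟨hc, hp⟩ := h
  rw [isCycle_iff] at hc
  refine ⟨?_, ?_⟩
  · rw [isCycle_iff]
    refine ⟨by simpa [and_comm] using hc.1, ?_⟩
    by_cases hu : u = []
    · subst hu; simpa using hc.2
    by_cases hv : v = []
    · subst hv; simpa using hc.2
    have h2 := hc.2
    have e1 : u ++ v ++ (u ++ v) = u ++ ((v ++ u) ++ v) := by simp
    have e2 : v ++ u ++ (v ++ u) = (v ++ u ++ v) ++ u := by simp
    rw [e2, List.isChain_append]
    rw [e1, List.isChain_append] at h2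
    refine ⟨h2.2.1, ?_, ?_⟩
    · exact h2.1
    · have h3 := h2.2.2
      have h4 : (u ++ v).IsChain r := by
        have := hc.2
        rw [List.isChain_append] at this
        exact this.1
      rw [List.isChain_append] at h4
      have h5 := hc.2
      rw [List.isChain_append] at h5
      intro x hx y hy
      refine h5.2.2 x ?_ y ?_
      · simpa [List.getLast?_append, List.getLast?_eq_getLast_of_ne_nil hv] using hx
      · simpa [List.head?_append, List.head?_eq_some_head hu] using hy
  · intro k ρ hρ
    rcases k with _ | k
    · exact Nat.zero_le _
    -- a power whose root is cut at the place where `v` ends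
    have key : ∀ (k : ℕ) (ρ v u : List X), v ++ u = (List.replicate k ρ).flatten →
        ∃ ρ', u ++ v = (List.replicate k ρ').flatten := by
      intro k ρ v u h
      obtain ⟨n, hn⟩ : (v ++ u) ~r (u ++ v) := List.isRotated_append
      rw [← hn, h]
      clear hn h
      induction n generalizing ρ with
      | zero => exact ⟨ρ, by simp⟩
      | succ n ih =>
        obtain ⟨ρ', h'⟩ : ∃ ρ', ((List.replicate k ρ).flatten).rotate 1
            = (List.replicate k ρ').flatten := by
          rcases ρ with _ | ⟨a, ρ⟩
          · exact ⟨[], by simp⟩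
          · refine ⟨ρ ++ [a], ?_⟩
            rcases k with _ | k
            · simp
            · rw [List.replicate_succ, List.flatten_cons, List.cons_append, List.rotate_cons_succ,
                List.rotate_zero, List.append_assoc]
              have := append_flatten_replicate [a] ρ k
              simp only [List.singleton_append] at this
              rw [← List.append_assoc, this]
              rw [List.replicate_succ', List.flatten_append]
              simp
        rw [show n + 1 = 1 + n by omega, ← List.rotate_rotate, h']
        exact ih ρ'
    obtain ⟨ρ', h'⟩ := key _ _ _ _ hρ
    exact hp _ _ h'

theorem IsOneCycle.rotated {r : X → X → Prop} {l l' : List X} (h : IsOneCycle r l)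
    (hl : l ~r l') : IsOneCycle r l' := by
  obtain ⟨n, hn, rfl⟩ := List.isRotated_iff_mod.1 hl
  rw [List.rotate_eq_drop_append_take hn]
  apply IsOneCycle.append_comm
  simpa using h

/-- Every letter of a cycle has a successor and a predecessor in the cycle. -/
theorem IsOneCycle.exists_next_prev {r : X → X → Prop} {l : List X} (h : IsOneCycle r l)
    {x : X} (hx : x ∈ l) : (∃ y ∈ l, r x y) ∧ ∃ y ∈ l, r y x := by
  obtain ⟨u, v, rfl⟩ := List.append_of_mem hx
  have h1 : IsOneCycle r (x :: (v ++ u)) := h.append_comm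
  obtain ⟨⟨_, hc, hl⟩, -⟩ := h1
  have hm : ∀ y, y ∈ x :: (v ++ u) → y ∈ u ++ x :: v := by
    intro y hy
    simp at hy ⊢
    tauto
  constructor
  · rcases hvu : v ++ u with _ | ⟨y, w⟩
    · simp [hvu] at hl
      exact ⟨x, by simp, hl⟩
    · rw [hvu] at hc
      refine ⟨y, hm y (by simp [hvu]), ?_⟩
      exact (List.isChain_cons_cons.1 hc).1
  · exact ⟨_, hm _ (List.getLast_mem _), by simpa using hl⟩

variable {r : X → X → Prop} {rT : T → T → Prop} {enc : T → List X} {P : X → Prop}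

/-- Injective families of code words whose last letter is the only one that satisfies `P`. -/
structure IsCode (enc : T → List X) (P : X → Prop) : Prop where
  exists_eq : ∀ t, ∃ w x, enc t = w ++ [x] ∧ P x ∧ ∀ y ∈ w, ¬ P y
  inj : Function.Injective enc

/-- The first letter satisfying `P` splits a word in a unique way. -/
theorem eq_of_append_marked {P : X → Prop} {w w' l l' : List X} {x x' : X} (hw : ∀ y ∈ w, ¬ P y)
    (hw' : ∀ y ∈ w', ¬ P y) (hx : P x) (hx' : P x') (h : w ++ x :: l = w' ++ x' :: l') :
    w = w' ∧ x = x' ∧ l = l' := by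
  induction w generalizing w' with
  | nil =>
    rcases w' with _ | ⟨a, w'⟩
    · simpa using h
    · simp only [List.nil_append, List.cons_append, List.cons.injEq] at h
      exact absurd (h.1 ▸ hx) (hw' a (by simp))
  | cons b w ih =>
    rcases w' with _ | ⟨a, w'⟩
    · simp only [List.nil_append, List.cons_append, List.cons.injEq] at h
      exact absurd (h.1 ▸ hx') (hw b (by simp))
    · simp only [List.cons_append, List.cons.injEq] at h
      obtain ⟨h1, h2, h3⟩ := ih (w' := w') (fun y hy => hw y (by simp [hy]))
        (fun y hy => hw' y (by simp [hy])) h.2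
      exact ⟨by rw [h.1, h1], h2, h3⟩

/-- A chain that ends with a letter satisfying `P` is a product of code words; `w` is the part of
the code word that has already been read. -/
theorem exists_flatMap_eq_append
    (hsurj : ∀ x₀ w x, P x₀ → P x → (∀ y ∈ w, ¬ P y) → (x₀ :: (w ++ [x])).IsChain r →
      ∃ t, enc t = w ++ [x])
    (l w : List X) (x₀ : X) (hx₀ : P x₀) (hw : ∀ y ∈ w, ¬ P y)
    (hl : ∀ y ∈ (w ++ l).getLast?, P y) (hc : (x₀ :: (w ++ l)).IsChain r) :
    ∃ L : List T, L.flatMap enc = w ++ l := by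
  induction l generalizing w x₀ with
  | nil =>
    rcases List.eq_nil_or_concat' w with rfl | ⟨w', y, rfl⟩
    · exact ⟨[], rfl⟩
    · exact absurd (hl y (by simp)) (hw y (by simp))
  | cons y l ih =>
    by_cases hy : P y
    · have hc' : ((x₀ :: w) ++ y :: l).IsChain r := hc
      rw [List.isChain_split] at hc'
      obtain ⟨t, ht⟩ := hsurj x₀ w y hx₀ hy hw hc'.1
      obtain ⟨L, hL⟩ := ih [] y hy (by simp) (by
        intro z hz
        refine hl z ?_
        simp only [List.nil_append, Option.mem_def] at hz
        rw [← List.singleton_append, ← List.append_assoc, List.getLast?_append, Option.mem_def, hz]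
        simp) hc'.2
      exact ⟨t :: L, by simp [ht, hL]⟩
    · obtain ⟨L, hL⟩ := ih (w ++ [y]) x₀ hx₀ (by simpa [or_imp, forall_and] using ⟨hw, hy⟩)
        (by simpa using hl) (by simpa using hc)
      exact ⟨L, by simpa using hL⟩

namespace IsCode

variable (hE : IsCode enc P)
include hE

theorem ne_nil (t : T) : enc t ≠ [] := by
  obtain ⟨w, x, h, -⟩ := hE.exists_eq t
  simp [h]

theorem flatMap_injective : Function.Injective (List.flatMap enc) := by
  intro l
  induction l with
  | nil =>
    rintro (_ | ⟨t, l⟩) h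
    · rfl
    · simp [hE.ne_nil] at h
  | cons t l ih =>
    rintro (_ | ⟨t', l'⟩) h
    · simp [hE.ne_nil] at h
    · obtain ⟨w, x, h1, h2, h3⟩ := hE.exists_eq t
      obtain ⟨w', x', h1', h2', h3'⟩ := hE.exists_eq t'
      simp only [List.flatMap_cons, h1, h1', List.append_assoc, List.singleton_append] at h
      obtain ⟨e1, e2, e3⟩ := eq_of_append_marked h3 h3' h2 h2' h
      have : t = t' := hE.inj (by rw [h1, h1', e1, e2])
      rw [this, ih e3]

theorem getLast?_flatMap (l : List T) : ∀ x ∈ (l.flatMap enc).getLast?, P x := by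
  induction l using List.reverseRecOn with
  | nil => simp
  | append_singleton l t ih =>
    obtain ⟨w, x, h1, h2, h3⟩ := hE.exists_eq t
    intro y hy
    simp [h1] at hy
    exact hy ▸ h2

theorem exists_of_flatMap_eq_append (l : List T) (u v : List X) (h : l.flatMap enc = u ++ v)
    (hu : ∀ x ∈ u.getLast?, P x) :
    ∃ l₁ l₂, l = l₁ ++ l₂ ∧ l₁.flatMap enc = u ∧ l₂.flatMap enc = v := by
  induction l generalizing u with
  | nil =>
    have : u = [] ∧ v = [] := by simpa using h
    exact ⟨[], [], by simp [this]⟩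
  | cons t l ih =>
    by_cases hu0 : u = []
    · subst hu0
      exact ⟨[], t :: l, rfl, rfl, by simpa using h⟩
    obtain ⟨w, x, h1, h2, h3⟩ := hE.exists_eq t
    rw [List.flatMap_cons, List.append_eq_append_iff] at h
    rcases h with ⟨a, rfl, h⟩ | ⟨a, h, rfl⟩
    · obtain ⟨l₁, l₂, rfl, rfl, rfl⟩ := ih a h (by
        intro y hy
        refine hu y ?_
        simp only [List.getLast?_append, Option.mem_def] at hy ⊢
        simp [hy])
      exact ⟨t :: l₁, l₂, by simp⟩
    · by_cases ha : a = []
      · subst ha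
        exact ⟨[t], l, by simp [h]⟩
      · exfalso
        obtain ⟨u', y, rfl⟩ := List.eq_nil_or_concat' u |>.resolve_left hu0
        obtain ⟨a', z, rfl⟩ := List.eq_nil_or_concat' a |>.resolve_left ha
        rw [h1, ← List.append_assoc] at h
        have := List.append_inj_left' h rfl
        refine h3 y (by simp [this]) (hu y (by simp))

theorem isRotated_of_flatMap {l l' : List T} (h : l.flatMap enc ~r l'.flatMap enc) : l ~r l' := by
  obtain ⟨n, hn, hr⟩ := List.isRotated_iff_mod.1 h
  rw [List.rotate_eq_drop_append_take hn] at hr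
  set L := l.flatMap enc with hL
  by_cases hu : L.take n = []
  · have : L.drop n = L := by simpa [hu] using List.take_append_drop n L
    rw [hu, this, List.append_nil] at hr
    rw [hE.flatMap_injective hr]
  · obtain ⟨l₁, l₂, rfl, h1, h2⟩ := hE.exists_of_flatMap_eq_append l (L.take n) (L.drop n)
      (by rw [List.take_append_drop]) (by
        intro x hx
        refine hE.getLast?_flatMap l' x ?_
        rw [← hr, List.getLast?_append]
        simp only [Option.mem_def] at hx ⊢
        simp [hx])
    have : l' = l₂ ++ l₁ := hE.flatMap_injective (by rw [← hr, List.flatMap_append, h1, h2])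
    rw [this]
    exact List.isRotated_append

/-- Substitution of code words respects aperiodicity: a root of the product ends with a letter
satisfying `P`, hence is itself a product of code words. -/
theorem prim_flatMap_iff (l : List T) :
    (∀ (k : ℕ) (ρ : List X), l.flatMap enc = (List.replicate k ρ).flatten → k ≤ 1) ↔
      ∀ (k : ℕ) (ρ : List T), l = (List.replicate k ρ).flatten → k ≤ 1 := by
  have key : ∀ k ρ, ((List.replicate k ρ).flatten).flatMap enc
      = (List.replicate k (ρ.flatMap enc)).flatten := by
    intro k ρ
    induction k with
    | zero => simp
    | succ k ih => rw [List.replicate_succ, List.flatten_cons, List.flatMap_append, ih,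
        List.replicate_succ, List.flatten_cons]
  constructor
  · rintro h k ρ rfl
    exact h k _ (key k ρ)
  · intro h k ρ hρ
    rcases k with _ | k
    · exact Nat.zero_le _
    have hlast : ∀ x ∈ ρ.getLast?, P x := by
      intro x hx
      refine hE.getLast?_flatMap l x ?_
      rw [hρ, List.replicate_succ', List.flatten_append, List.getLast?_append]
      simp only [Option.mem_def] at hx
      simp [hx]
    obtain ⟨l₁, l₂, -, h1, -⟩ := hE.exists_of_flatMap_eq_append l ρ
      (List.replicate k ρ).flatten (by rw [hρ, List.replicate_succ, List.flatten_cons]) hlast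
    refine h _ l₁ (hE.flatMap_injective ?_)
    rw [key, h1, hρ]

theorem isChain_flatMap_iff (hchain : ∀ t, (enc t).IsChain r)
    (hrel : ∀ t t', rT t t' ↔ ∀ x ∈ (enc t).getLast?, ∀ y ∈ (enc t').head?, r x y) (l : List T) :
    (l.flatMap enc).IsChain r ↔ l.IsChain rT := by
  rw [List.flatMap_def, List.isChain_flatten (by simp [hE.ne_nil]), List.isChain_map]
  simp only [← hrel]
  exact ⟨fun h => h.2, fun h => ⟨by simpa using fun t _ => hchain t, h⟩⟩

theorem isOneCycle_flatMap_iff (hchain : ∀ t, (enc t).IsChain r)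
    (hrel : ∀ t t', rT t t' ↔ ∀ x ∈ (enc t).getLast?, ∀ y ∈ (enc t').head?, r x y) (l : List T) :
    IsOneCycle r (l.flatMap enc) ↔ IsOneCycle rT l := by
  unfold IsOneCycle
  rw [isCycle_iff, isCycle_iff, hE.prim_flatMap_iff, ← List.flatMap_append,
    hE.isChain_flatMap_iff hchain hrel]
  have : l.flatMap enc ≠ [] ↔ l ≠ [] := by
    rcases l with _ | ⟨t, l⟩ <;> simp [hE.ne_nil]
  rw [this]

/-- Circuits over the code words are the circuits that meet `P`: such a circuit has a
representative that ends with a letter satisfying `P`, which decomposes into code words. -/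
theorem tsum_circuit_eq (hchain : ∀ t, (enc t).IsChain r)
    (hrel : ∀ t t', rT t t' ↔ ∀ x ∈ (enc t).getLast?, ∀ y ∈ (enc t').head?, r x y)
    (hsurj : ∀ x₀ w x, P x₀ → P x → (∀ y ∈ w, ¬ P y) → (x₀ :: (w ++ [x])).IsChain r →
      ∃ t, enc t = w ++ [x])
    (m : Set.Ioc (0 : ℝ) 1 → ℝ≥0∞) (w : X → Set.Ioc (0 : ℝ) 1) :
    ∑' c : OneCircuit rT, m (c.weight fun t => ((enc t).map w).prod) =
      ∑' c : {c : OneCircuit r // c.Meets P}, m (c.1.weight w) := by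
  have hone := hE.isOneCycle_flatMap_iff hchain hrel
  let g : OneCircuit rT → OneCircuit r :=
    Quotient.map' (fun l => ⟨l.1.flatMap enc, (hone l.1).2 l.2⟩) (by
      rintro ⟨l, hl⟩ ⟨l', hl'⟩ ⟨n, hn⟩
      change l.flatMap enc ~r l'.flatMap enc
      change l.rotate n = l' at hn
      subst hn
      clear hl hl'
      induction n generalizing l with
      | zero => rw [List.rotate_zero]
      | succ n ih =>
        rw [show n + 1 = 1 + n by omega, ← List.rotate_rotate]
        refine List.IsRotated.trans ?_ (ih (l.rotate 1))
        rcases l with _ | ⟨t, l⟩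
        · simp
        · simpa using List.isRotated_append)
  have hg : ∀ c, (g c).Meets P := by
    intro c
    induction c using Quotient.inductionOn with
    | h l =>
      obtain ⟨l, hl⟩ := l
      rcases l with _ | ⟨t, l⟩
      · exact absurd rfl hl.1.1
      · obtain ⟨w, x, h1, h2, h3⟩ := hE.exists_eq t
        exact ⟨x, by simp [h1], h2⟩
  have hbij : Function.Bijective (fun c => (⟨g c, hg c⟩ : {c : OneCircuit r // c.Meets P})) := by
    constructor
    · intro c c' h
      have h' : g c = g c' := congrArg Subtype.val h
      induction c, c' using Quotient.inductionOn₂ with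
      | h l l' =>
        exact Quotient.sound (hE.isRotated_of_flatMap (Quotient.exact h'))
    · rintro ⟨c, hc⟩
      induction c using Quotient.inductionOn with
      | h l =>
        obtain ⟨l, hl⟩ := l
        obtain ⟨x, hx, hP⟩ : ∃ x ∈ l, P x := hc
        obtain ⟨u, v, rfl⟩ := List.append_of_mem hx
        have hrot : (u ++ x :: v) ~r (v ++ (u ++ [x])) := by
          have : (u ++ [x]) ++ v ~r v ++ (u ++ [x]) := List.isRotated_append
          simpa using this
        have hl' := hl.rotated hrot
        obtain ⟨hne, hcc⟩ := (isCycle_iff r _).1 hl'.1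
        have hcc' : (x :: (v ++ (u ++ [x]))).IsChain r := by
          have e : (v ++ (u ++ [x])) ++ (v ++ (u ++ [x])) =
            (v ++ u) ++ (x :: (v ++ (u ++ [x]))) := by simp
          rw [e, List.isChain_append] at hcc
          exact hcc.2.1
        obtain ⟨L, hL⟩ := exists_flatMap_eq_append hsurj (v ++ (u ++ [x])) [] x hP (by simp)
          (by simpa using hP) (by simpa using hcc')
        rw [List.nil_append] at hL
        refine ⟨Quotient.mk _ ⟨L, (hone L).1 (hL ▸ hl')⟩, Subtype.ext ?_⟩
        refine Quotient.sound ?_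
        change L.flatMap enc ~r u ++ x :: v
        rw [hL]
        exact hrot.symm
  rw [← (Equiv.ofBijective _ hbij).tsum_eq]
  refine tsum_congr fun c => ?_
  induction c using Quotient.inductionOn with
  | h l =>
    congr 1
    change (l.1.map fun t => ((enc t).map w).prod).prod = ((l.1.flatMap enc).map w).prod
    rw [List.map_flatMap]
    induction l.1 with
    | nil => rfl
    | cons t l ih => simp [ih]

end IsCode

/-- Circuits that avoid the letters outside the range of an injective map `f` are the circuits of
the relation induced by `f`. -/
theorem tsum_circuit_comp {Y : Type*} (f : Y → X) (hf : Function.Injective f)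
    (hP : ∀ x, ¬ P x ↔ x ∈ Set.range f) (m : Set.Ioc (0 : ℝ) 1 → ℝ≥0∞)
    (w : X → Set.Ioc (0 : ℝ) 1) :
    ∑' c : OneCircuit (fun y y' => r (f y) (f y')), m (c.weight fun y => w (f y)) =
      ∑' c : {c : OneCircuit r // ¬ c.Meets P}, m (c.1.weight w) := by
  have hone : ∀ l : List Y, IsOneCycle r (l.map f) ↔ IsOneCycle (fun y y' => r (f y) (f y')) l := by
    have hE : IsCode (fun y : Y => [f y]) (fun _ => True) :=
      ⟨fun t => ⟨[], f t, by simp⟩, fun a b h => hf (by simpa using h)⟩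
    intro l
    rw [← hE.isOneCycle_flatMap_iff (r := r) (by simp) (by simp), ← List.map_eq_flatMap]
  let g : OneCircuit (fun y y' => r (f y) (f y')) → OneCircuit r :=
    Quotient.map' (fun l => ⟨l.1.map f, (hone l.1).2 l.2⟩) (fun l l' h => List.IsRotated.map h f)
  have hg : ∀ c, ¬ (g c).Meets P := by
    intro c
    induction c using Quotient.inductionOn with
    | h l =>
      rintro ⟨x, hx, hx'⟩
      obtain ⟨y, -, rfl⟩ := List.mem_map.1 hx
      exact (hP _).2 ⟨y, rfl⟩ hx'
  have hbij : Function.Bijective (fun c => (⟨g c, hg c⟩ : {c : OneCircuit r // ¬ c.Meets P})) := by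
    constructor
    · intro c c' h
      have h' : g c = g c' := congrArg Subtype.val h
      induction c, c' using Quotient.inductionOn₂ with
      | h l l' =>
        obtain ⟨n, hn⟩ := Quotient.exact h'
        refine Quotient.sound ⟨n, hf.list_map ?_⟩
        rw [List.map_rotate]
        exact hn
    · rintro ⟨c, hc⟩
      induction c using Quotient.inductionOn with
      | h l =>
        have hr : ∀ x ∈ l.1, x ∈ Set.range f := fun x hx => (hP x).1 fun h => hc ⟨x, hx, h⟩
        obtain ⟨l, hl⟩ := l
        obtain ⟨L, rfl⟩ : l ∈ Set.range (List.map f) := by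
          rw [Set.range_list_map]
          exact hr
        exact ⟨Quotient.mk _ ⟨L, (hone L).1 hl⟩, rfl⟩
  rw [← (Equiv.ofBijective _ hbij).tsum_eq]
  refine tsum_congr fun c => ?_
  induction c using Quotient.inductionOn with
  | h l =>
    congr 1
    change _ = ((l.1.map f).map w).prod
    rw [List.map_map]
    rfl

end Words


/-! ### Plugging three graphs -/

namespace Graph

variable {L L' : Type}

/-- The graph on `W` whose edges are the nonempty `r`-chains of letters with source and target
in `W`. -/
def pathGraph {X : Type} (hX : Countable X) (W : Finset L) (r : X → X → Prop) (s t : X → L)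
    (w : X → Set.Ioc (0 : ℝ) 1) : Graph L where
  V := W
  E := {l : List X // ∃ h : l ≠ [], l.IsChain r ∧ s (l.head h) ∈ W ∧ t (l.getLast h) ∈ W}
  countable_E := inferInstance
  s l := s (l.1.head l.2.1)
  t l := t (l.1.getLast l.2.1)
  ω l := (l.1.map w).prod
  s_mem l := l.2.2.2.1
  t_mem l := l.2.2.2.2

theorem countable_sum (F G : Graph L) : Countable (F.E ⊕ G.E) := by
  have := F.countable_E
  have := G.countable_E
  infer_instance

theorem exec_same_pathGraph [DecidableEq L] (F G : Graph L) : (F.exec G).Same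
    (pathGraph (F.countable_sum G) (F.V ∆ G.V) (F.Step G) (F.src G) (F.tgt G) (F.wt G)) := by
  refine ⟨rfl, ⟨fun π => ⟨π.1.edges, π.1.ne, π.1.chain, π.2⟩,
    fun l => ⟨⟨l.1, l.2.1, l.2.2.1⟩, l.2.2.2⟩, fun _ => rfl, fun _ => rfl⟩,
    fun _ => ⟨rfl, rfl, rfl⟩⟩

/-- Path graphs are functorial in bijections of letters that are compatible with a map of
locations. -/
theorem pathGraph_deloc_same [DecidableEq L'] {X X' : Type} {hX : Countable X} {hX' : Countable X'}
    {W : Finset L} {W' : Finset L'} {r : X → X → Prop} {r' : X' → X' → Prop} {s t : X → L}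
    {s' t' : X' → L'} {w : X → Set.Ioc (0 : ℝ) 1} {w' : X' → Set.Ioc (0 : ℝ) 1} (f : L → L')
    (σ : X ≃ X') (hr : ∀ x y, r' (σ x) (σ y) ↔ r x y) (hs : ∀ x, s' (σ x) = f (s x))
    (ht : ∀ x, t' (σ x) = f (t x)) (hw : ∀ x, w' (σ x) = w x) (hW : W.image f = W')
    (hsW : ∀ x, f (s x) ∈ W' → s x ∈ W) (htW : ∀ x, f (t x) ∈ W' → t x ∈ W) :
    ((pathGraph hX W r s t w).deloc f).Same (pathGraph hX' W' r' s' t' w') := by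
  refine ⟨hW, (Equiv.listEquivOfEquiv σ).subtypeEquiv ?_, ?_⟩
  · intro l
    have e : Equiv.listEquivOfEquiv σ l = l.map σ := rfl
    rw [e]
    by_cases h : l = []
    · subst h; simp
    · simp only [ne_eq, h, not_false_eq_true, List.map_eq_nil_iff, exists_true_left,
        List.head_map, List.getLast_map, hs, ht, List.isChain_map, hr]
      have h1 : ∀ x, x ∈ W → f x ∈ W' := fun x hx => hW ▸ Finset.mem_image_of_mem f hx
      exact ⟨fun h => ⟨h.1, h1 _ h.2.1, h1 _ h.2.2⟩, fun h => ⟨h.1, hsW _ h.2.1, htW _ h.2.2⟩⟩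
  · rintro ⟨l, hl⟩
    have hl0 := hl.1
    refine ⟨?_, ?_, ?_⟩
    · refine Eq.trans ?_ (hs (l.head hl0))
      exact congrArg s' (List.head_map (w := by simpa using hl0))
    · refine Eq.trans ?_ (ht (l.getLast hl0))
      exact congrArg t' (List.getLast_map (h := by simpa using hl0))
    · change ((l.map σ).map w').prod = (l.map w).prod
      rw [List.map_map]
      congr 1
      exact List.map_congr_left fun x _ => hw x

theorem deloc_id_same [DecidableEq L] (F : Graph L) : (F.deloc id).Same F :=
  ⟨by simp [deloc], Equiv.refl _, fun _ => ⟨rfl, rfl, rfl⟩⟩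

variable (F G H : Graph L)

/-- Edges of the plugging of three graphs. -/
abbrev E3 : Type := (F.E ⊕ G.E) ⊕ H.E

/-- The graph from which an edge of the plugging comes. -/
def col3 : E3 F G H → Fin 3 := Sum.elim (Sum.elim (fun _ => 0) fun _ => 1) fun _ => 2

/-- The source of an edge of the plugging. -/
def src3 : E3 F G H → L := Sum.elim (F.src G) H.s

/-- The target of an edge of the plugging. -/
def tgt3 : E3 F G H → L := Sum.elim (F.tgt G) H.t

/-- The weight of an edge of the plugging. -/
def wt3 : E3 F G H → Set.Ioc (0 : ℝ) 1 := Sum.elim (F.wt G) H.ω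

/-- Composable edges that come from different graphs. -/
def Step3 (x y : E3 F G H) : Prop :=
  src3 F G H y = tgt3 F G H x ∧ col3 F G H x ≠ col3 F G H y

theorem countable_E3 : Countable (E3 F G H) := by
  have := F.countable_sum G
  have := H.countable_E
  infer_instance

/-- The simultaneous execution of three graphs. -/
def exec3 [DecidableEq L] : Graph L :=
  pathGraph (countable_E3 F G H) (F.V ∆ G.V ∆ H.V) (Step3 F G H) (src3 F G H) (tgt3 F G H)
    (wt3 F G H)

/-- The sum of `m` over the `1`-circuits of the plugging of three graphs. -/
def meas3 (m : Set.Ioc (0 : ℝ) 1 → ℝ≥0∞) : ℝ≥0∞ :=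
  ∑' c : OneCircuit (Step3 F G H), m (c.weight (wt3 F G H))

/-- Cyclic permutation of the three colours. -/
def rot3 : E3 F G H ≃ E3 G H F where
  toFun := Sum.elim (Sum.elim Sum.inr fun e => Sum.inl (Sum.inl e)) fun e => Sum.inl (Sum.inr e)
  invFun := Sum.elim (Sum.elim (fun e => Sum.inl (Sum.inr e)) Sum.inr) fun e => Sum.inl (Sum.inl e)
  left_inv := by rintro ((e | e) | e) <;> rfl
  right_inv := by rintro ((e | e) | e) <;> rfl

theorem step3_rot3 (x y : E3 F G H) :
    Step3 G H F (rot3 F G H x) (rot3 F G H y) ↔ Step3 F G H x y := by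
  rcases x with (x | x) | x <;> rcases y with (y | y) | y <;>
    simp [Step3, rot3, src3, tgt3, src, tgt, col3]

theorem wt3_rot3 (x : E3 F G H) : wt3 G H F (rot3 F G H x) = wt3 F G H x := by
  rcases x with (x | x) | x <;> rfl

theorem exec3_same_rot [DecidableEq L] : (exec3 F G H).Same (exec3 G H F) := by
  have hV : F.V ∆ G.V ∆ H.V = G.V ∆ H.V ∆ F.V := by
    rw [symmDiff_assoc, symmDiff_comm]
  refine (deloc_id_same _).symm.trans (pathGraph_deloc_same id (rot3 F G H) (step3_rot3 F G H) ?_ ?_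
    (wt3_rot3 F G H) (by rw [Finset.image_id, hV]) ?_ ?_)
  · rintro ((x | x) | x) <;> rfl
  · rintro ((x | x) | x) <;> rfl
  · intro x hx; rw [hV]; exact hx
  · intro x hx; rw [hV]; exact hx

theorem meas3_rot (m : Set.Ioc (0 : ℝ) 1 → ℝ≥0∞) : meas3 F G H m = meas3 G H F m := by
  have h := tsum_circuit_comp (r := Step3 G H F) (P := fun _ => False) (rot3 F G H)
    (rot3 F G H).injective (by simp) m (wt3 G H F)
  have e1 : (fun y y' => Step3 G H F (rot3 F G H y) (rot3 F G H y')) = Step3 F G H := by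
    funext x y; exact propext (step3_rot3 F G H x y)
  have e2 : (fun y => wt3 G H F (rot3 F G H y)) = wt3 F G H := funext (wt3_rot3 F G H)
  rw [e1, e2] at h
  have hn : ∀ c : OneCircuit (Step3 G H F), ¬ c.Meets fun _ => False := by
    intro c
    induction c using Quotient.inductionOn with
    | h l => rintro ⟨_, _, h⟩; exact h
  unfold meas3
  rw [h, ← (Equiv.subtypeUnivEquiv hn).tsum_eq]
  rfl

theorem step3_inl (x y : F.E ⊕ G.E) : Step3 F G H (.inl x) (.inl y) ↔ F.Step G x y := by
  rcases x with x | x <;> rcases y with y | y <;> simp [Step3, Step, src3, tgt3, src, tgt, col3]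

theorem step3_inl_inr (x : F.E ⊕ G.E) (h : H.E) :
    Step3 F G H (.inl x) (.inr h) ↔ H.s h = F.tgt G x := by
  rcases x with x | x <;> simp [Step3, src3, tgt3, src, tgt, col3]

theorem step3_inr_inl (x : F.E ⊕ G.E) (h : H.E) :
    Step3 F G H (.inr h) (.inl x) ↔ F.src G x = H.t h := by
  rcases x with x | x <;> simp [Step3, src3, tgt3, src, tgt, col3]

theorem not_step3_inr_inr (h h' : H.E) : ¬ Step3 F G H (.inr h) (.inr h') := by
  simp [Step3, col3]

theorem src_mem (x : F.E ⊕ G.E) : F.src G x ∈ F.V ∨ F.src G x ∈ G.V := by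
  rcases x with x | x
  · exact Or.inl (F.s_mem x)
  · exact Or.inr (G.s_mem x)

theorem tgt_mem (x : F.E ⊕ G.E) : F.tgt G x ∈ F.V ∨ F.tgt G x ∈ G.V := by
  rcases x with x | x
  · exact Or.inl (F.t_mem x)
  · exact Or.inr (G.t_mem x)

theorem isChain_map_inl (l : List (F.E ⊕ G.E)) :
    (l.map (Sum.inl : _ → E3 F G H)).IsChain (Step3 F G H) ↔ l.IsChain (F.Step G) := by
  rw [List.isChain_map]
  simp only [step3_inl]

section DecEq

variable [DecidableEq L] {F G H}
variable (hV : ∀ v, v ∈ F.V → v ∈ G.V → v ∉ H.V)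

include hV in
theorem mem_symmDiff_of_mem {v : L} (h : v ∈ F.V ∨ v ∈ G.V) (hH : v ∈ H.V) : v ∈ F.V ∆ G.V := by
  have := hV v
  rw [Finset.mem_symmDiff]
  tauto

/-- **Trefoil property** of the measurement. -/
theorem meas_exec_add (m : Set.Ioc (0 : ℝ) 1 → ℝ≥0∞)
    (hV : ∀ v, v ∈ F.V → v ∈ G.V → v ∉ H.V) :
    meas m (F.exec G) H + meas m F G = meas3 F G H m := by
  -- a circuit that uses `H` is a cyclic word of pairs (maximal path in `F` and `G`, edge of `H`)
  let T := {q : (F.exec G).E × H.E // H.s q.2 = (F.exec G).t q.1}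
  let rT : T → T → Prop := fun q q' => (F.exec G).s q'.1.1 = H.t q.1.2
  let enc1 : T → List ((F.exec G).E ⊕ H.E) := fun q => [.inl q.1.1, .inr q.1.2]
  let enc2 : T → List (E3 F G H) := fun q => q.1.1.1.edges.map .inl ++ [.inr q.1.2]
  have hE1 : IsCode enc1 (fun x => x.isRight = true) := by
    refine ⟨fun q => ⟨[.inl q.1.1], .inr q.1.2, rfl, rfl, by simp⟩, ?_⟩
    rintro ⟨⟨p, h⟩, _⟩ ⟨⟨p', h'⟩, _⟩ e
    simp only [enc1, List.cons.injEq, Sum.inl.injEq, Sum.inr.injEq] at e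
    obtain ⟨rfl, rfl, -⟩ := e
    rfl
  have hE2 : IsCode enc2 (fun x => x.isRight = true) := by
    refine ⟨fun q => ⟨_, _, rfl, rfl, by simp⟩, ?_⟩
    rintro ⟨⟨⟨p, _⟩, h⟩, _⟩ ⟨⟨⟨p', _⟩, h'⟩, _⟩ e
    have e1 := List.append_inj' e rfl
    have e2 := AltPath.edges_injective (Sum.inl_injective.list_map e1.1)
    have e3 := e1.2
    simp only [List.cons.injEq, Sum.inr.injEq] at e3
    obtain ⟨rfl, -⟩ := e3
    simp only at e2
    subst e2
    rfl
  have hhead : ∀ q : T, (enc2 q).head? = some (.inl (q.1.1.1.edges.head q.1.1.1.ne)) := by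
    intro q
    simp [enc2, List.head?_append, List.head?_eq_some_head q.1.1.1.ne]
  have key1 := hE1.tsum_circuit_eq (r := (F.exec G).Step H) (rT := rT)
    (by
      rintro ⟨⟨p, h⟩, hq⟩
      simpa [enc1, Step, src, tgt] using hq)
    (by
      rintro ⟨⟨p, h⟩, hq⟩ ⟨⟨p', h'⟩, hq'⟩
      simp [enc1, Step, src, tgt, rT])
    (by
      rintro (x₀ | x₀) w (x | x) hx₀ hx hw hc <;> simp at hx₀ hx
      rcases w with _ | ⟨p | p, w⟩
      · simp [Step] at hc
      · rcases w with _ | ⟨p' | p', w⟩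
        · exact ⟨⟨(p, x), by simpa [Step, src, tgt] using hc.tail⟩, rfl⟩
        · simp [Step] at hc
        · exact absurd rfl (hw (.inr p') (by simp))
      · exact absurd rfl (hw (.inr p) (by simp)))
    m ((F.exec G).wt H)
  have key2 := hE2.tsum_circuit_eq (r := Step3 F G H) (rT := rT)
    (by
      rintro ⟨⟨⟨p, hp⟩, h⟩, hq⟩
      simp only [enc2]
      rw [List.isChain_append]
      refine ⟨(isChain_map_inl F G H _).2 p.chain, by simp, ?_⟩
      rw [List.getLast?_map, List.getLast?_eq_getLast_of_ne_nil p.ne]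
      simp only [Option.map_some, Option.mem_some_iff, List.head?_cons]
      rintro _ rfl _ rfl
      rw [step3_inl_inr]
      exact hq)
    (by
      intro q q'
      rw [hhead]
      simp [enc2, step3_inr_inl, rT]
      rfl)
    (by
      rintro x₀ w x hx₀ hx hw hc
      rcases x₀ with _ | h₀
      · simp at hx₀
      rcases x with _ | h
      · simp at hx
      obtain ⟨w, rfl⟩ : w ∈ Set.range (List.map Sum.inl) := by
        rw [Set.range_list_map]
        rintro (y | y) hy
        · exact ⟨y, rfl⟩
        · exact absurd rfl (hw _ hy)
      have hne : w ≠ [] := by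
        rintro rfl
        simp [not_step3_inr_inr] at hc
      have hc' := hc.tail
      simp only [List.tail_cons] at hc'
      rw [List.isChain_append] at hc'
      have hs : F.src G (w.head hne) = H.t h₀ := by
        rw [← step3_inr_inl]
        obtain ⟨y, w, rfl⟩ := List.exists_cons_of_ne_nil hne
        simp only [List.map_cons, List.cons_append, List.isChain_cons_cons] at hc
        exact hc.1
      have ht : H.s h = F.tgt G (w.getLast hne) := by
        rw [← step3_inl_inr]
        exact hc'.2.2 _ (by simp [List.getLast?_eq_getLast_of_ne_nil hne]) _ (by simp)
      refine ⟨⟨(⟨⟨w, hne, (isChain_map_inl F G H _).1 hc'.1⟩, ?_, ?_⟩, h), ht⟩, rfl⟩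
      · exact mem_symmDiff_of_mem hV (F.src_mem G _) (show F.src G (w.head hne) ∈ H.V by
          rw [hs]; exact H.t_mem h₀)
      · exact mem_symmDiff_of_mem hV (F.tgt_mem G _) (show F.tgt G (w.getLast hne) ∈ H.V by
          rw [← ht]; exact H.s_mem h))
    m (wt3 F G H)
  have hw : (fun q : T => ((enc1 q).map ((F.exec G).wt H)).prod) =
      fun q => ((enc2 q).map (wt3 F G H)).prod := by
    funext q
    simp only [enc1, enc2, List.map_append, List.prod_append, List.map_map]
    simp [wt, wt3]
    rfl
  rw [hw, key2] at key1
  have key3 := tsum_circuit_comp (r := Step3 F G H) (P := fun x => x.isRight = true) Sum.inl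
    Sum.inl_injective (by rintro (x | x) <;> simp) m (wt3 F G H)
  have e1 : (fun y y' => Step3 F G H (.inl y) (.inl y')) = F.Step G := by
    funext x y; exact propext (step3_inl F G H x y)
  rw [e1] at key3
  have hall : ∀ c : OneCircuit ((F.exec G).Step H), c.Meets (fun x => x.isRight = true) := by
    intro c
    induction c using Quotient.inductionOn with
    | h l =>
      obtain ⟨x, hx⟩ := List.exists_mem_of_ne_nil l.1 l.2.1.1
      obtain ⟨⟨y, hy, hxy⟩, -⟩ := l.2.exists_next_prev hx
      rcases x with x | x
      · rcases y with y | y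
        · simp [Step] at hxy
        · exact ⟨_, hy, rfl⟩
      · exact ⟨_, hx, rfl⟩
  have m1 : meas m (F.exec G) H = ∑' c : {c : OneCircuit ((F.exec G).Step H) //
      c.Meets (fun x => x.isRight = true)}, m (c.1.weight ((F.exec G).wt H)) := by
    rw [← (Equiv.subtypeUnivEquiv hall).symm.tsum_eq]
    rfl
  have m2 : meas m F G = ∑' c : OneCircuit (F.Step G), m (c.weight (F.wt G)) := rfl
  rw [m1, ← key1, m2]
  have e2 : (fun y => wt3 F G H (.inl y)) = F.wt G := rfl
  rw [e2] at key3
  rw [key3]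
  let f : OneCircuit (Step3 F G H) → ℝ≥0∞ := fun c => m (c.weight (wt3 F G H))
  let S : Set (OneCircuit (Step3 F G H)) := {c | c.Meets fun x => x.isRight = true}
  have hf : Summable (f ∘ ((↑) : S → _)) := ENNReal.summable
  have hf' : Summable (f ∘ ((↑) : ↑Sᶜ → _)) := ENNReal.summable
  exact hf.tsum_add_tsum_compl hf'

/-- The word in the edges of `F`, `G`, `H` underlying an edge of the plugging of `F ∷ G` and `H`. -/
def unfold3 : (F.exec G).E ⊕ H.E → List (E3 F G H) :=
  Sum.elim (fun π => π.1.edges.map .inl) fun h => [.inr h]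

theorem unfold3_inl (π : (F.exec G).E) :
    unfold3 (.inl π : (F.exec G).E ⊕ H.E) = π.1.edges.map .inl := rfl

theorem unfold3_inr (h : H.E) : unfold3 (.inr h : (F.exec G).E ⊕ H.E) = [.inr h] := rfl

theorem unfold3_ne_nil (x : (F.exec G).E ⊕ H.E) : unfold3 x ≠ [] := by
  rcases x with p | h
  · simpa [unfold3] using p.1.ne
  · simp [unfold3]

theorem src3_head_unfold3 (x : (F.exec G).E ⊕ H.E) :
    src3 F G H ((unfold3 x).head (unfold3_ne_nil x)) = (F.exec G).src H x := by
  rcases x with p | h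
  · simp [unfold3, src3, List.head_map]
    rfl
  · rfl

theorem tgt3_getLast_unfold3 (x : (F.exec G).E ⊕ H.E) :
    tgt3 F G H ((unfold3 x).getLast (unfold3_ne_nil x)) = (F.exec G).tgt H x := by
  rcases x with p | h
  · simp [unfold3, tgt3, List.getLast_map]
    rfl
  · rfl

theorem step3_of_step (x y : (F.exec G).E ⊕ H.E) (hxy : (F.exec G).Step H x y) :
    Step3 F G H ((unfold3 x).getLast (unfold3_ne_nil x)) ((unfold3 y).head (unfold3_ne_nil y)) := by
  refine ⟨by rw [src3_head_unfold3, tgt3_getLast_unfold3]; exact hxy.1, ?_⟩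
  rcases x with x | x <;> rcases y with y | y
  · exact absurd hxy.2 (by simp)
  · simp only [unfold3, Sum.elim_inl, List.getLast_map]
    rcases x.1.edges.getLast x.1.ne with z | z <;> simp [col3]
  · simp only [unfold3, Sum.elim_inl, List.head_map]
    rcases y.1.edges.head y.1.ne with z | z <;> simp [col3]
  · exact absurd hxy.2 (by simp)

theorem step_of_step3 (x y : (F.exec G).E ⊕ H.E) (hc : x.isLeft ≠ y.isLeft)
    (hxy : Step3 F G H ((unfold3 x).getLast (unfold3_ne_nil x))
      ((unfold3 y).head (unfold3_ne_nil y))) : (F.exec G).Step H x y := by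
  refine ⟨?_, hc⟩
  rw [← src3_head_unfold3, ← tgt3_getLast_unfold3]
  exact hxy.1

theorem isChain_flatMap_unfold3 {l : List ((F.exec G).E ⊕ H.E)}
    (hl : l.IsChain ((F.exec G).Step H)) :
    (l.flatMap unfold3).IsChain (Step3 F G H) := by
  rw [List.flatMap_def, List.isChain_flatten (by simp [unfold3_ne_nil]), List.isChain_map]
  constructor
  · simp only [List.mem_map, forall_exists_index, and_imp, forall_apply_eq_imp_iff₂]
    rintro (p | h) -
    · exact (isChain_map_inl F G H _).2 p.1.chain
    · simp [unfold3]
  · refine hl.imp fun x y hxy => ?_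
    rw [List.getLast?_eq_getLast_of_ne_nil (unfold3_ne_nil x),
      List.head?_eq_some_head (unfold3_ne_nil y)]
    rintro _ ⟨⟩ _ ⟨⟩
    exact step3_of_step x y hxy

theorem unfold3_injective {x y : (F.exec G).E ⊕ H.E} (h : unfold3 x = unfold3 y) : x = y := by
  have hd : ∀ (p : (F.exec G).E) (e : H.E),
      unfold3 (.inl p : (F.exec G).E ⊕ H.E) ≠ unfold3 (.inr e) := by
    intro p e h
    rw [unfold3_inl, unfold3_inr] at h
    rcases hx : p.1.edges with _ | ⟨a, l⟩ <;> simp [hx] at h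
  rcases x with x | x <;> rcases y with y | y
  · rw [unfold3_inl, unfold3_inl] at h
    exact congrArg _ (Subtype.ext (AltPath.edges_injective (Sum.inl_injective.list_map h)))
  · exact absurd h (hd _ _)
  · exact absurd h.symm (hd _ _)
  · simpa [unfold3_inr] using h

theorem flatMap_unfold3_injective {l l' : List ((F.exec G).E ⊕ H.E)}
    (hl : l.IsChain ((F.exec G).Step H)) (hl' : l'.IsChain ((F.exec G).Step H))
    (h : l.flatMap unfold3 = l'.flatMap unfold3) : l = l' := by
  -- a maximal prefix of edges of `F` and `G` comes from one path
  have htake : ∀ (p : (F.exec G).E) (t : List ((F.exec G).E ⊕ H.E)),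
      (Sum.inl p :: t).IsChain ((F.exec G).Step H) →
      ((Sum.inl p :: t).flatMap unfold3).takeWhile Sum.isLeft = p.1.edges.map .inl := by
    intro p t ht
    rw [List.flatMap_cons]
    change (p.1.edges.map Sum.inl ++ _).takeWhile _ = _
    rw [List.takeWhile_append_of_pos (by simp)]
    rcases t with _ | ⟨q | q, t⟩
    · simp
    · simp [Step] at ht
    · simp [unfold3]
  have hinr : ∀ (p : (F.exec G).E) (h : H.E) (t t' : List ((F.exec G).E ⊕ H.E)),
      (Sum.inl p :: t).flatMap unfold3 ≠ (Sum.inr h :: t').flatMap unfold3 := by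
    intro p h t t' e
    rw [List.flatMap_cons, List.flatMap_cons] at e
    have := congrArg (fun l => l.head?.map Sum.isLeft) e
    simp [unfold3, List.head?_append, List.head?_eq_some_head p.1.ne] at this
  induction l generalizing l' with
  | nil =>
    rcases l' with _ | ⟨y, l'⟩
    · rfl
    · simp [unfold3_ne_nil] at h
  | cons x l ih =>
    rcases l' with _ | ⟨y, l'⟩
    · simp [unfold3_ne_nil] at h
    have hxy : x = y := by
      rcases x with p | x <;> rcases y with q | y
      · refine unfold3_injective ?_
        change p.1.edges.map Sum.inl = q.1.edges.map Sum.inl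
        rw [← htake p l hl, ← htake q l' hl', h]
      · exact absurd h (hinr _ _ _ _)
      · exact absurd h.symm (hinr _ _ _ _)
      · simp only [unfold3, List.flatMap_cons, Sum.elim_inr, List.singleton_append,
          List.cons.injEq, Sum.inr.injEq] at h
        rw [h.1]
    subst hxy
    rw [List.flatMap_cons, List.flatMap_cons] at h
    exact congrArg _ (ih hl.tail hl'.tail (List.append_cancel_left h))

theorem cons_isChain_of_unfold3 {x : (F.exec G).E ⊕ H.E} {l : List ((F.exec G).E ⊕ H.E)}
    (hl : l.IsChain ((F.exec G).Step H)) (hc : ∀ y ∈ l.head?, x.isLeft ≠ y.isLeft)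
    (h : (unfold3 x ++ l.flatMap unfold3).IsChain (Step3 F G H)) :
    (x :: l).IsChain ((F.exec G).Step H) := by
  rcases l with _ | ⟨y, l⟩
  · simp
  · refine List.isChain_cons_cons.2 ⟨?_, hl⟩
    refine step_of_step3 x y (hc y (by simp)) ?_
    rw [List.isChain_append] at h
    refine h.2.2 _ (List.getLast?_eq_getLast_of_ne_nil _) _ ?_
    rw [List.flatMap_cons, List.head?_append, List.head?_eq_some_head (unfold3_ne_nil y)]
    simp

/-- Every path in the plugging of three graphs, with ends where they have to be, is a path in the
plugging of `F ∷ G` and `H`; the part that is being read is kept in `w`. -/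
theorem exists_flatMap_unfold3 (hV : ∀ v, v ∈ F.V → v ∈ G.V → v ∉ H.V)
    (L : List (E3 F G H)) (w : List (F.E ⊕ G.E))
    (hc : (w.map Sum.inl ++ L).IsChain (Step3 F G H))
    (hs : ∀ x : F.E ⊕ G.E, Sum.inl x ∈ (w.map Sum.inl ++ L).head? → F.src G x ∈ F.V ∆ G.V)
    (ht : ∀ x : F.E ⊕ G.E, Sum.inl x ∈ (w.map Sum.inl ++ L).getLast? → F.tgt G x ∈ F.V ∆ G.V) :
    ∃ l : List ((F.exec G).E ⊕ H.E), l.IsChain ((F.exec G).Step H) ∧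
      l.flatMap unfold3 = w.map Sum.inl ++ L := by
  induction L generalizing w with
  | nil =>
    by_cases hw : w = []
    · exact ⟨[], by simp, by simp [hw]⟩
    · rw [List.append_nil] at hc hs ht
      obtain ⟨p, hp⟩ : ∃ p : (F.exec G).E,
          unfold3 (.inl p : (F.exec G).E ⊕ H.E) = w.map Sum.inl :=
        ⟨⟨⟨w, hw, (isChain_map_inl F G H _).1 hc⟩,
          hs _ (by simp [List.head?_eq_some_head hw]),
          ht _ (by simp [List.getLast?_eq_getLast_of_ne_nil hw])⟩, rfl⟩
      exact ⟨[.inl p], by simp, by simp [hp]⟩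
  | cons x L ih =>
    rcases x with e | h
    · obtain ⟨l, h1, h2⟩ := ih (w ++ [e]) (by simpa using hc) (by simpa using hs)
        (by simpa using ht)
      exact ⟨l, h1, by simpa using h2⟩
    · have hc2 := hc
      rw [List.isChain_append] at hc2
      obtain ⟨l, h1, h2⟩ := ih [] hc2.2.1.tail (by
        intro x hx
        rcases L with _ | ⟨y, L⟩
        · simp at hx
        · simp only [List.map_nil, List.nil_append, List.head?_cons, Option.mem_some_iff] at hx
          subst hx
          have := (List.isChain_cons_cons.1 hc2.2.1).1
          rw [step3_inr_inl] at this
          exact mem_symmDiff_of_mem hV (F.src_mem G _) (by rw [this]; exact H.t_mem h)) (by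
        intro x hx
        refine ht x ?_
        simp only [List.map_nil, List.nil_append, Option.mem_def] at hx
        rw [List.getLast?_append, List.getLast?_cons, hx]
        simp)
      simp only [List.map_nil, List.nil_append] at h2
      have h3 : (Sum.inr h :: l).IsChain ((F.exec G).Step H) := by
        refine cons_isChain_of_unfold3 h1 ?_ (by simpa [unfold3_inr, h2] using hc2.2.1)
        rintro (y | y) hy
        · simp
        · exfalso
          rcases l with _ | ⟨z, l⟩
          · simp at hy
          · simp only [List.head?_cons, Option.mem_some_iff] at hy
            subst hy
            rw [← h2] at hc2
            exact not_step3_inr_inr F G H h y (List.isChain_cons_cons.1 hc2.2.1).1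
      by_cases hw : w = []
      · exact ⟨_, h3, by simp [unfold3_inr, h2, hw]⟩
      · have htw : F.tgt G (w.getLast hw) ∈ F.V ∆ G.V := by
          have := hc2.2.2 (.inl (w.getLast hw))
            (by simp [List.getLast?_eq_getLast_of_ne_nil hw]) (.inr h) (by simp)
          rw [step3_inl_inr] at this
          exact mem_symmDiff_of_mem hV (F.tgt_mem G _) (by rw [← this]; exact H.s_mem h)
        obtain ⟨p, hp⟩ : ∃ p : (F.exec G).E,
            unfold3 (.inl p : (F.exec G).E ⊕ H.E) = w.map Sum.inl :=
          ⟨⟨⟨w, hw, (isChain_map_inl F G H _).1 hc2.1⟩,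
            hs _ (by simp [List.head?_append, List.head?_eq_some_head hw]), htw⟩, rfl⟩
        refine ⟨.inl p :: .inr h :: l, cons_isChain_of_unfold3 h3 (by simp) ?_, ?_⟩
        · simpa [unfold3_inr, h2, hp] using hc
        · simp [unfold3_inr, h2, hp]

/-- `(F ∷ G) ∷ H` is the simultaneous execution of the three graphs, as long as they have no vertex
in common. -/
theorem exec_exec_same (hV : ∀ v, v ∈ F.V → v ∈ G.V → v ∉ H.V) :
    ((F.exec G).exec H).Same (exec3 F G H) := by
  refine (exec_same_pathGraph _ _).trans ?_
  have hhead : ∀ l : List ((F.exec G).E ⊕ H.E), ∀ (h : l ≠ []) (h' : l.flatMap unfold3 ≠ []),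
      src3 F G H ((l.flatMap unfold3).head h') = (F.exec G).src H (l.head h) := by
    intro l h h'
    rcases l with _ | ⟨x, l⟩
    · exact absurd rfl h
    · simp only [List.flatMap_cons, List.head_append_of_ne_nil (unfold3_ne_nil x),
        src3_head_unfold3, List.head_cons]
  have hlast : ∀ l : List ((F.exec G).E ⊕ H.E), ∀ (h : l ≠ []) (h' : l.flatMap unfold3 ≠ []),
      tgt3 F G H ((l.flatMap unfold3).getLast h') = (F.exec G).tgt H (l.getLast h) := by
    intro l h h'
    rcases List.eq_nil_or_concat' l with rfl | ⟨l, x, rfl⟩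
    · exact absurd rfl h
    · simp only [List.flatMap_append, List.flatMap_singleton,
        List.getLast_append_of_ne_nil _ (unfold3_ne_nil x), tgt3_getLast_unfold3,
        List.getLast_append_singleton]
  have hne : ∀ l : List ((F.exec G).E ⊕ H.E), l ≠ [] → l.flatMap unfold3 ≠ [] := by
    rintro (_ | ⟨x, l⟩) h
    · exact absurd rfl h
    · simp [unfold3_ne_nil]
  let g : (pathGraph ((F.exec G).countable_sum H) (F.V ∆ G.V ∆ H.V) ((F.exec G).Step H)
      ((F.exec G).src H) ((F.exec G).tgt H) ((F.exec G).wt H)).E → (exec3 F G H).E := fun l =>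
    ⟨l.1.flatMap unfold3, hne _ l.2.1, isChain_flatMap_unfold3 l.2.2.1,
      by rw [hhead _ l.2.1]; exact l.2.2.2.1, by rw [hlast _ l.2.1]; exact l.2.2.2.2⟩
  have hg : Function.Bijective g := by
    constructor
    · intro l l' h
      exact Subtype.ext (flatMap_unfold3_injective l.2.2.1 l'.2.2.1 (congrArg Subtype.val h))
    · rintro ⟨L, hL, hc, hs, ht⟩
      have hmem : ∀ v, v ∈ F.V ∆ G.V ∆ H.V → (v ∈ F.V ∨ v ∈ G.V) → v ∈ F.V ∆ G.V := by
        intro v h h'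
        have := hV v
        simp only [Finset.mem_symmDiff] at h ⊢
        tauto
      obtain ⟨l, h1, h2⟩ := exists_flatMap_unfold3 hV L [] hc (by
        intro x hx
        simp only [List.map_nil, List.nil_append, List.head?_eq_some_head hL,
          Option.mem_some_iff] at hx
        rw [hx] at hs
        exact hmem _ hs (F.src_mem G x)) (by
        intro x hx
        simp only [List.map_nil, List.nil_append, List.getLast?_eq_getLast_of_ne_nil hL,
          Option.mem_some_iff] at hx
        rw [hx] at ht
        exact hmem _ ht (F.tgt_mem G x))
      simp only [List.map_nil, List.nil_append] at h2
      subst h2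
      have hl : l ≠ [] := by rintro rfl; exact hL rfl
      exact ⟨⟨l, hl, h1, by rw [hhead _ hl] at hs; exact hs, by rw [hlast _ hl] at ht; exact ht⟩,
        rfl⟩
  refine ⟨rfl, Equiv.ofBijective g hg, fun l => ⟨hhead _ _ _, hlast _ _ _, ?_⟩⟩
  change ((l.1.flatMap unfold3).map (wt3 F G H)).prod = (l.1.map ((F.exec G).wt H)).prod
  rw [List.map_flatMap]
  induction l.1 with
  | nil => rfl
  | cons x l ih =>
    rw [List.flatMap_cons, List.prod_append, ih, List.map_cons, List.prod_cons]
    congr 1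
    rcases x with p | h
    · simp only [unfold3, Sum.elim_inl, List.map_map]
      rfl
    · simp [unfold3, wt3, wt]

end DecEq

end Graph


/-! ### Execution of graphs: symmetry, associativity, relocation -/

namespace Graph

variable {L L' L'' : Type}

section

variable [DecidableEq L'] [DecidableEq L'']

theorem deloc_eq_of_eqOn {f g : L → L'} {F : Graph L} (h : ∀ v ∈ F.V, f v = g v) :
    (F.deloc f).Same (F.deloc g) :=
  ⟨Finset.image_congr h, Equiv.refl _, fun x =>
    ⟨(h _ (F.s_mem x)).symm, (h _ (F.t_mem x)).symm, rfl⟩⟩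

theorem deloc_deloc_same (f : L → L') (g : L' → L'') (F : Graph L) :
    ((F.deloc f).deloc g).Same (F.deloc (g ∘ f)) :=
  ⟨Finset.image_image, Equiv.refl _, fun _ => ⟨rfl, rfl, rfl⟩⟩

end

theorem meas_eq_zero (m : Set.Ioc (0 : ℝ) 1 → ℝ≥0∞) {F G : Graph L}
    (h : ∀ l, ¬ IsOneCycle (F.Step G) l) : meas m F G = 0 := by
  have : IsEmpty (Circuit F G) := ⟨fun c => by
    induction c using Quotient.inductionOn with
    | h l => exact h l.1 l.2⟩
  exact tsum_empty

theorem not_step_of_disjoint {F G : Graph L} (h : Disjoint F.V G.V) (x y : F.E ⊕ G.E) :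
    ¬ F.Step G x y := by
  rw [Finset.disjoint_left] at h
  rintro ⟨h1, h2⟩
  rcases x with x | x <;> rcases y with y | y
  · exact h2 rfl
  · exact h (F.t_mem x) ((show G.s y = F.t x from h1) ▸ G.s_mem y)
  · exact h (F.s_mem y) ((show F.s y = G.t x from h1) ▸ G.t_mem x)
  · exact h2 rfl

theorem meas_eq_zero_of_disjoint (m : Set.Ioc (0 : ℝ) 1 → ℝ≥0∞) {F G : Graph L}
    (h : Disjoint F.V G.V) : meas m F G = 0 := by
  refine meas_eq_zero m fun l hl => ?_
  obtain ⟨x, hx⟩ := List.exists_mem_of_ne_nil l hl.1.1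
  obtain ⟨⟨y, -, hxy⟩, -⟩ := hl.exists_next_prev hx
  exact not_step_of_disjoint h x y hxy

variable [DecidableEq L] [DecidableEq L']

theorem exec_comm_same (F G : Graph L) : (F.exec G).Same (G.exec F) := by
  have hV : F.V ∆ G.V = G.V ∆ F.V := symmDiff_comm _ _
  refine (exec_same_pathGraph F G).trans (Same.trans ?_ (exec_same_pathGraph G F).symm)
  refine (deloc_id_same _).symm.trans (pathGraph_deloc_same id (Equiv.sumComm _ _) ?_ ?_ ?_ ?_
    (by rw [Finset.image_id, hV]) ?_ ?_)
  · rintro (x | x) (y | y) <;> simp [Step, src, tgt]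
  · rintro (x | x) <;> rfl
  · rintro (x | x) <;> rfl
  · rintro (x | x) <;> rfl
  · intro x hx; rw [hV]; exact hx
  · intro x hx; rw [hV]; exact hx

/-- Associativity of execution, from the cyclic symmetry of the simultaneous execution. -/
theorem exec_assoc_same {F G H : Graph L} (hV : ∀ v, v ∈ F.V → v ∈ G.V → v ∉ H.V) :
    ((F.exec G).exec H).Same (F.exec (G.exec H)) :=
  (exec_exec_same hV).trans <| (exec3_same_rot F G H).trans <|
    (exec_exec_same fun v h1 h2 h3 => hV v h3 h1 h2).symm.trans (exec_comm_same _ _)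

theorem step_deloc {F G : Graph L} {f : L → L'} (hf : Set.InjOn f (F.V ∪ G.V : Finset L))
    (x y : F.E ⊕ G.E) : (F.deloc f).Step (G.deloc f) x y ↔ F.Step G x y := by
  have hs : (F.deloc f).src (G.deloc f) y = f (F.src G y) := by rcases y with y | y <;> rfl
  have ht : (F.deloc f).tgt (G.deloc f) x = f (F.tgt G x) := by rcases x with x | x <;> rfl
  refine and_congr ?_ Iff.rfl
  refine (Eq.congr hs ht).trans (hf.eq_iff ?_ ?_)
  · simpa using F.src_mem G y
  · simpa using F.tgt_mem G x

theorem exec_deloc_same {F G : Graph L} {f : L → L'} (hf : Set.InjOn f (F.V ∪ G.V : Finset L)) :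
    ((F.exec G).deloc f).Same ((F.deloc f).exec (G.deloc f)) := by
  have hmem : ∀ v, v ∈ F.V ∨ v ∈ G.V → (f v ∈ F.V.image f ∆ G.V.image f ↔ v ∈ F.V ∆ G.V) := by
    intro v hv
    have h1 : ∀ S : Finset L, S ⊆ F.V ∪ G.V → (f v ∈ S.image f ↔ v ∈ S) := by
      intro S hS
      refine ⟨fun h => ?_, Finset.mem_image_of_mem f⟩
      obtain ⟨w, hw, e⟩ := Finset.mem_image.1 h
      have : w = v := hf (Finset.mem_coe.2 (hS hw)) (by simpa using hv) e
      exact this ▸ hw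
    rw [Finset.mem_symmDiff, Finset.mem_symmDiff, h1 _ Finset.subset_union_left,
      h1 _ Finset.subset_union_right]
  refine ((exec_same_pathGraph F G).deloc f).trans (Same.trans ?_ (exec_same_pathGraph _ _).symm)
  refine pathGraph_deloc_same f (Equiv.refl _) (step_deloc hf) ?_ ?_ ?_ ?_ ?_ ?_
  · rintro (x | x) <;> rfl
  · rintro (x | x) <;> rfl
  · rintro (x | x) <;> rfl
  · ext w
    constructor
    · intro h
      obtain ⟨v, hv, rfl⟩ := Finset.mem_image.1 h
      exact (hmem v (by rw [Finset.mem_symmDiff] at hv; tauto)).2 hv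
    · intro h
      have : ∃ v, (v ∈ F.V ∨ v ∈ G.V) ∧ f v = w := by
        change w ∈ F.V.image f ∆ G.V.image f at h
        simp only [Finset.mem_symmDiff, Finset.mem_image] at h
        rcases h with ⟨⟨v, hv, e⟩, -⟩ | ⟨⟨v, hv, e⟩, -⟩
        · exact ⟨v, Or.inl hv, e⟩
        · exact ⟨v, Or.inr hv, e⟩
      obtain ⟨v, hv, rfl⟩ := this
      exact Finset.mem_image_of_mem f ((hmem v hv).1 h)
  · exact fun x hx => (hmem _ (F.src_mem G x)).1 hx
  · exact fun x hx => (hmem _ (F.tgt_mem G x)).1 hx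

theorem meas_deloc (m : Set.Ioc (0 : ℝ) 1 → ℝ≥0∞) {F G : Graph L} {f : L → L'}
    (hf : Set.InjOn f (F.V ∪ G.V : Finset L)) :
    meas m (F.deloc f) (G.deloc f) = meas m F G := by
  refine (meas_congr (F' := F.deloc f) (G' := G.deloc f) m (Equiv.refl (F.E ⊕ G.E))
    (step_deloc hf) ?_).symm
  rintro (x | x) <;> rfl

/-! ### Execution of graphs of disjoint carriers -/

/-- The union of two graphs. -/
def union (F G : Graph L) : Graph L where
  V := F.V ∪ G.V
  E := F.E ⊕ G.E
  countable_E := F.countable_sum G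
  s := F.src G
  t := F.tgt G
  ω := F.wt G
  s_mem e := Finset.mem_union.2 (F.src_mem G e)
  t_mem e := Finset.mem_union.2 (F.tgt_mem G e)

/-- When the vertices are disjoint, all alternating paths have length one. -/
theorem exec_same_union {F G : Graph L} (h : Disjoint F.V G.V) :
    (F.union G).Same (F.exec G) := by
  have hV : F.V ∆ G.V = F.V ∪ G.V := h.symmDiff_eq_sup
  let g : F.E ⊕ G.E → (F.exec G).E := fun e => ⟨⟨[e], by simp, by simp⟩,
    by rw [hV]; exact Finset.mem_union.2 (F.src_mem G e),
    by rw [hV]; exact Finset.mem_union.2 (F.tgt_mem G e)⟩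
  have hg : Function.Bijective g := by
    constructor
    · intro x y e
      have : [x] = [y] := congrArg (fun π : (F.exec G).E => π.1.edges) e
      simpa using this
    · rintro ⟨⟨l, hl, hc⟩, -⟩
      rcases l with _ | ⟨x, _ | ⟨y, l⟩⟩
      · exact absurd rfl hl
      · exact ⟨x, rfl⟩
      · exact absurd (List.isChain_cons_cons.1 hc).1 (not_step_of_disjoint h x y)
  exact ⟨hV.symm, Equiv.ofBijective g hg, fun e => ⟨rfl, rfl, List.prod_singleton⟩⟩

/-! ### Relocating by execution -/

/-- The graph with an edge of weight `1` from `a v` to `b v` and one from `b v` to `a v`, for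
every `v ∈ V`. -/
def link {K : Type} (V : Finset K) (a b : K → L) : Graph L where
  V := V.image a ∪ V.image b
  E := V ⊕ V
  countable_E := inferInstance
  s := Sum.elim (fun v => a v) (fun v => b v)
  t := Sum.elim (fun v => b v) (fun v => a v)
  ω _ := 1
  s_mem := by
    rintro (⟨v, hv⟩ | ⟨v, hv⟩)
    · exact Finset.mem_union_left _ (Finset.mem_image_of_mem _ hv)
    · exact Finset.mem_union_right _ (Finset.mem_image_of_mem _ hv)
  t_mem := by
    rintro (⟨v, hv⟩ | ⟨v, hv⟩)
    · exact Finset.mem_union_right _ (Finset.mem_image_of_mem _ hv)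
    · exact Finset.mem_union_left _ (Finset.mem_image_of_mem _ hv)

section Link

variable {K K' : Type}

theorem link_same_of_eqOn {V : Finset K} {a b a' b' : K → L} (ha : ∀ v ∈ V, a v = a' v)
    (hb : ∀ v ∈ V, b v = b' v) : (link V a b).Same (link V a' b') := by
  refine ⟨?_, Equiv.refl _, ?_⟩
  · change _ ∪ _ = _ ∪ _
    rw [Finset.image_congr (Set.EqOn.mono (by rfl) ha), Finset.image_congr hb]
  · rintro (⟨v, hv⟩ | ⟨v, hv⟩)
    · exact ⟨(ha v hv).symm, (hb v hv).symm, rfl⟩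
    · exact ⟨(hb v hv).symm, (ha v hv).symm, rfl⟩

theorem link_swap_same (V : Finset K) (a b : K → L) : (link V a b).Same (link V b a) := by
  refine ⟨Finset.union_comm _ _, Equiv.sumComm _ _, ?_⟩
  rintro (v | v) <;> exact ⟨rfl, rfl, rfl⟩

theorem link_deloc_same (V : Finset K) (a b : K → L) (f : L → L') :
    ((link V a b).deloc f).Same (link V (f ∘ a) (f ∘ b)) := by
  refine ⟨?_, Equiv.refl _, ?_⟩
  · change Finset.image f (_ ∪ _) = _ ∪ _
    rw [Finset.image_union, Finset.image_image, Finset.image_image]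
  · rintro (v | v) <;> exact ⟨rfl, rfl, rfl⟩

theorem link_image_same [DecidableEq K'] {V : Finset K} {θ : K → K'} (hθ : Set.InjOn θ V)
    (a b : K' → L) : (link V (a ∘ θ) (b ∘ θ)).Same (link (V.image θ) a b) := by
  let g : V → V.image θ := fun v => ⟨θ v, Finset.mem_image_of_mem θ v.2⟩
  have hg : Function.Bijective g := by
    constructor
    · intro v w e
      exact Subtype.ext (hθ v.2 w.2 (congrArg Subtype.val e))
    · rintro ⟨w, hw⟩
      obtain ⟨v, hv, rfl⟩ := Finset.mem_image.1 hw
      exact ⟨⟨v, hv⟩, rfl⟩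
  refine ⟨?_, Equiv.sumCongr (Equiv.ofBijective g hg) (Equiv.ofBijective g hg), ?_⟩
  · change _ ∪ _ = _ ∪ _
    rw [Finset.image_image, Finset.image_image]
  · rintro (v | v) <;> exact ⟨rfl, rfl, rfl⟩

theorem link_union_same [DecidableEq K'] {V W : Finset K} {i j : K → K'} (hi : Set.InjOn i V)
    (hj : Set.InjOn j W) (hij : ∀ v w, i v ≠ j w) (a b : K' → L) :
    ((link V (a ∘ i) (b ∘ i)).union (link W (a ∘ j) (b ∘ j))).Same
      (link (V.image i ∪ W.image j) a b) := by
  let g : V ⊕ W → ↥(V.image i ∪ W.image j) := Sum.elim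
    (fun v => ⟨i v, Finset.mem_union_left _ (Finset.mem_image_of_mem i v.2)⟩)
    (fun w => ⟨j w, Finset.mem_union_right _ (Finset.mem_image_of_mem j w.2)⟩)
  have hg : Function.Bijective g := by
    constructor
    · rintro (v | v) (w | w) e <;> have e' := congrArg Subtype.val e
      · exact congrArg _ (Subtype.ext (hi v.2 w.2 e'))
      · exact absurd e' (hij _ _)
      · exact absurd e'.symm (hij _ _)
      · exact congrArg _ (Subtype.ext (hj v.2 w.2 e'))
    · rintro ⟨x, hx⟩
      rcases Finset.mem_union.1 hx with h | h <;> obtain ⟨v, hv, rfl⟩ := Finset.mem_image.1 h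
      · exact ⟨.inl ⟨v, hv⟩, rfl⟩
      · exact ⟨.inr ⟨v, hv⟩, rfl⟩
  refine ⟨?_, (Equiv.sumSumSumComm V V W W).trans
    (Equiv.sumCongr (Equiv.ofBijective g hg) (Equiv.ofBijective g hg)), ?_⟩
  · change (V.image (a ∘ i) ∪ V.image (b ∘ i)) ∪ (W.image (a ∘ j) ∪ W.image (b ∘ j)) =
      (V.image i ∪ W.image j).image a ∪ (V.image i ∪ W.image j).image b
    rw [Finset.image_union, Finset.image_union, Finset.image_image, Finset.image_image,
      Finset.image_image, Finset.image_image, Finset.union_union_union_comm]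
  · rintro ((v | v) | (v | v)) <;> exact ⟨rfl, rfl, rfl⟩

variable {F : Graph L} {V : Finset K} {b c : K → L}

theorem meas_link (m : Set.Ioc (0 : ℝ) 1 → ℝ≥0∞) (hc : ∀ v ∈ V, c v ∉ F.V) :
    meas m F (link V b c) = 0 := by
  refine meas_eq_zero m fun l hl => ?_
  have key : ∀ z : V ⊕ V, Sum.inr z ∉ l := by
    intro z hz
    obtain ⟨⟨y, -, h1, h2⟩, ⟨x, -, h3, h4⟩⟩ := hl.exists_next_prev hz
    rcases z with ⟨v, hv⟩ | ⟨v, hv⟩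
    · rcases y with e | y
      · exact hc v hv ((show F.s e = c v from h1) ▸ F.s_mem e)
      · exact h2 rfl
    · rcases x with e | x
      · exact hc v hv ((show c v = F.t e from h3) ▸ F.t_mem e)
      · exact h4 rfl
  obtain ⟨x, hx⟩ := List.exists_mem_of_ne_nil l hl.1.1
  rcases x with e | z
  · obtain ⟨⟨y, hy, -, h⟩, -⟩ := hl.exists_next_prev hx
    rcases y with e' | z
    · exact h rfl
    · exact key z hy
  · exact key z hx

/-- The part of a path through `link V b c` that precedes the edge `e`. -/
def LinkPre (F : Graph L) (V : Finset K) (b c : K → L) (e : F.E)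
    (p : List (F.E ⊕ (link V b c).E)) : Prop :=
  (p = [] ∧ F.s e ∉ V.image b) ∨
    ∃ v : V, b v = F.s e ∧ p = [.inr (.inr v : V ⊕ V)]

/-- The part of a path through `link V b c` that follows the edge `e`. -/
def LinkPost (F : Graph L) (V : Finset K) (b c : K → L) (e : F.E)
    (p : List (F.E ⊕ (link V b c).E)) : Prop :=
  (p = [] ∧ F.t e ∉ V.image b) ∨
    ∃ v : V, b v = F.t e ∧ p = [.inr (.inl v : V ⊕ V)]

theorem LinkPre.exists_eq (F : Graph L) (V : Finset K) (b c : K → L) (e : F.E) :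
    ∃ p, LinkPre F V b c e p := by
  by_cases h : F.s e ∈ V.image b
  · obtain ⟨v, hv, hb⟩ := Finset.mem_image.1 h
    exact ⟨_, Or.inr ⟨⟨v, hv⟩, hb, rfl⟩⟩
  · exact ⟨_, Or.inl ⟨rfl, h⟩⟩

theorem LinkPost.exists_eq (F : Graph L) (V : Finset K) (b c : K → L) (e : F.E) :
    ∃ p, LinkPost F V b c e p := by
  by_cases h : F.t e ∈ V.image b
  · obtain ⟨v, hv, hb⟩ := Finset.mem_image.1 h
    exact ⟨_, Or.inr ⟨⟨v, hv⟩, hb, rfl⟩⟩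
  · exact ⟨_, Or.inl ⟨rfl, h⟩⟩

theorem LinkPre.unique (hb : Set.InjOn b V) {e : F.E} {p p' : List (F.E ⊕ (link V b c).E)}
    (h : LinkPre F V b c e p) (h' : LinkPre F V b c e p') : p = p' := by
  rcases h with ⟨rfl, h⟩ | ⟨v, h, rfl⟩ <;> rcases h' with ⟨rfl, h'⟩ | ⟨v', h', rfl⟩
  · rfl
  · exact absurd (h' ▸ Finset.mem_image_of_mem b v'.2) h
  · exact absurd (h ▸ Finset.mem_image_of_mem b v.2) h'
  · rw [Subtype.ext (hb v.2 v'.2 (h.trans h'.symm))]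

theorem LinkPost.unique (hb : Set.InjOn b V) {e : F.E} {p p' : List (F.E ⊕ (link V b c).E)}
    (h : LinkPost F V b c e p) (h' : LinkPost F V b c e p') : p = p' := by
  rcases h with ⟨rfl, h⟩ | ⟨v, h, rfl⟩ <;> rcases h' with ⟨rfl, h'⟩ | ⟨v', h', rfl⟩
  · rfl
  · exact absurd (h' ▸ Finset.mem_image_of_mem b v'.2) h
  · exact absurd (h ▸ Finset.mem_image_of_mem b v.2) h'
  · rw [Subtype.ext (hb v.2 v'.2 (h.trans h'.symm))]

variable (hbF : ∀ v ∈ V, b v ∈ F.V) (hc : ∀ v ∈ V, c v ∉ F.V)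

include hbF hc in
theorem mem_symmDiff_link (x : L) : x ∈ F.V ∆ (V.image b ∪ V.image c) ↔
    (x ∈ F.V ∧ x ∉ V.image b) ∨ x ∈ V.image c := by
  have h1 : x ∈ V.image b → x ∈ F.V := by
    intro h
    obtain ⟨v, hv, rfl⟩ := Finset.mem_image.1 h
    exact hbF v hv
  have h2 : x ∈ V.image c → x ∉ F.V := by
    intro h
    obtain ⟨v, hv, rfl⟩ := Finset.mem_image.1 h
    exact hc v hv
  rw [Finset.mem_symmDiff, Finset.mem_union]
  tauto

include hbF hc in
theorem linkPost_of_path {e : F.E} {q : List (F.E ⊕ (link V b c).E)}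
    (h : (.inl e :: q).IsChain (F.Step (link V b c)))
    (ht : F.tgt (link V b c) ((.inl e :: q).getLast (by simp)) ∈ F.V ∆ (V.image b ∪ V.image c)) :
    LinkPost F V b c e q := by
  rw [mem_symmDiff_link hbF hc] at ht
  rcases q with _ | ⟨x, q⟩
  · rcases ht with ht | ht
    · exact Or.inl ⟨rfl, ht.2⟩
    · obtain ⟨v, hv, h⟩ := Finset.mem_image.1 ht
      exact absurd (h ▸ F.t_mem e) (hc v hv)
  · rw [List.isChain_cons_cons] at h
    obtain ⟨⟨h1, h2⟩, h3⟩ := h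
    rcases x with x | (v | v)
    · exact absurd rfl h2
    · refine Or.inr ⟨v, h1, ?_⟩
      rcases q with _ | ⟨y, q⟩
      · rfl
      · exfalso
        obtain ⟨h4, h5⟩ := (List.isChain_cons_cons.1 h3).1
        rcases y with y | y
        · exact hc v v.2 ((show F.s y = c v from h4) ▸ F.s_mem y)
        · exact h5 rfl
    · exact absurd ((show c v = F.t e from h1) ▸ F.t_mem e) (hc v v.2)

include hbF hc in
/-- A path whose ends survive the execution of `F` and `link V b c` is an edge of `F`, extended on
each side by a link whenever it can be. -/
theorem exists_linkPre_linkPost {l : List (F.E ⊕ (link V b c).E)} (hl : l ≠ [])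
    (h : l.IsChain (F.Step (link V b c)))
    (hs : F.src (link V b c) (l.head hl) ∈ F.V ∆ (V.image b ∪ V.image c))
    (ht : F.tgt (link V b c) (l.getLast hl) ∈ F.V ∆ (V.image b ∪ V.image c)) :
    ∃ e p q, LinkPre F V b c e p ∧ LinkPost F V b c e q ∧ l = p ++ .inl e :: q := by
  rcases l with _ | ⟨x, l⟩
  · exact absurd rfl hl
  have hb' : ∀ v ∈ V, b v ∉ F.V ∆ (V.image b ∪ V.image c) := by
    intro v hv h
    rw [mem_symmDiff_link hbF hc] at h
    rcases h with h | h
    · exact h.2 (Finset.mem_image_of_mem b hv)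
    · obtain ⟨w, hw, e⟩ := Finset.mem_image.1 h
      exact hc w hw (e ▸ hbF v hv)
  rcases x with e | (v | v)
  · refine ⟨e, [], l, Or.inl ⟨rfl, fun h' => ?_⟩, linkPost_of_path hbF hc h ht, rfl⟩
    obtain ⟨v, hv, h2⟩ := Finset.mem_image.1 h'
    exact hb' v hv (h2 ▸ hs)
  · exact absurd hs (hb' v v.2)
  · rcases l with _ | ⟨y, l⟩
    · exact absurd ht (hb' v v.2)
    · obtain ⟨⟨h1, h2⟩, h3⟩ := List.isChain_cons_cons.1 h
      rcases y with e | y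
      · refine ⟨e, _, l, Or.inr ⟨v, h1.symm, rfl⟩, linkPost_of_path hbF hc h3 ?_, rfl⟩
        simpa using ht
      · exact absurd rfl h2

/-- Execution against `link V b c` moves the vertices `b v` to `c v`. -/
theorem exec_link_same {ρ : L → L} (hbF : ∀ v ∈ V, b v ∈ F.V) (hc : ∀ v ∈ V, c v ∉ F.V)
    (hb : Set.InjOn b V) (hρ : ∀ v ∈ V, ρ (b v) = c v) (hρ' : ∀ x ∈ F.V, x ∉ V.image b → ρ x = x) :
    (F.deloc ρ).Same (F.exec (link V b c)) := by
  have hVV : F.V.image ρ = F.V ∆ (V.image b ∪ V.image c) := by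
    ext x
    rw [mem_symmDiff_link hbF hc, Finset.mem_image]
    constructor
    · rintro ⟨y, hy, rfl⟩
      by_cases h : y ∈ V.image b
      · obtain ⟨v, hv, rfl⟩ := Finset.mem_image.1 h
        rw [hρ v hv]
        exact Or.inr (Finset.mem_image_of_mem c hv)
      · rw [hρ' y hy h]
        exact Or.inl ⟨hy, h⟩
    · rintro (⟨h, h'⟩ | h)
      · exact ⟨x, h, hρ' x h h'⟩
      · obtain ⟨v, hv, rfl⟩ := Finset.mem_image.1 h
        exact ⟨b v, hbF v hv, hρ v hv⟩
  have hex : ∀ e : F.E, ∃ π : (F.exec (link V b c)).E, ((F.exec (link V b c)).s π = ρ (F.s e) ∧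
      (F.exec (link V b c)).t π = ρ (F.t e) ∧ (F.exec (link V b c)).ω π = F.ω e) ∧
      ∃ p q, LinkPre F V b c e p ∧ LinkPost F V b c e q ∧ π.1.edges = p ++ .inl e :: q := by
    intro e
    obtain ⟨p, hp⟩ := LinkPre.exists_eq F V b c e
    obtain ⟨q, hq⟩ := LinkPost.exists_eq F V b c e
    have hne : p ++ .inl e :: q ≠ [] := by simp
    have hchain : (p ++ .inl e :: q).IsChain (F.Step (link V b c)) := by
      rcases hp with ⟨rfl, hp⟩ | ⟨v, hp, rfl⟩ <;> rcases hq with ⟨rfl, hq⟩ | ⟨w, hq, rfl⟩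
      · simp
      · exact List.isChain_cons_cons.2 ⟨⟨hq, Bool.noConfusion⟩, by simp⟩
      · exact List.isChain_cons_cons.2 ⟨⟨hp.symm, Bool.noConfusion⟩, by simp⟩
      · exact List.isChain_cons_cons.2 ⟨⟨hp.symm, Bool.noConfusion⟩,
          List.isChain_cons_cons.2 ⟨⟨hq, Bool.noConfusion⟩, by simp⟩⟩
    have hs : F.src (link V b c) ((p ++ .inl e :: q).head hne) = ρ (F.s e) := by
      rcases hp with ⟨rfl, hp⟩ | ⟨v, hp, rfl⟩
      · exact (hρ' _ (F.s_mem e) hp).symm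
      · rw [← hp, hρ v v.2]
        rfl
    have ht : F.tgt (link V b c) ((p ++ .inl e :: q).getLast hne) = ρ (F.t e) := by
      rw [List.getLast_append_of_ne_nil _ (by simp)]
      rcases hq with ⟨rfl, hq⟩ | ⟨v, hq, rfl⟩
      · exact (hρ' _ (F.t_mem e) hq).symm
      · rw [← hq, hρ v v.2]
        rfl
    have hw : ((p ++ .inl e :: q).map (F.wt (link V b c))).prod = F.ω e := by
      have h1 : (p.map (F.wt (link V b c))).prod = 1 := by
        rcases hp with ⟨rfl, hp⟩ | ⟨v, hp, rfl⟩
        · rfl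
        · simp [wt, link]
      have h2 : (q.map (F.wt (link V b c))).prod = 1 := by
        rcases hq with ⟨rfl, hp⟩ | ⟨v, hp, rfl⟩
        · rfl
        · simp [wt, link]
      rw [List.map_append, List.prod_append, List.map_cons, List.prod_cons, h1, h2, one_mul,
        mul_one]
      rfl
    have hmem : ∀ x ∈ F.V, ρ x ∈ F.V ∆ (V.image b ∪ V.image c) := fun x hx =>
      hVV ▸ Finset.mem_image_of_mem ρ hx
    exact ⟨⟨⟨_, hne, hchain⟩, by rw [AltPath.source, hs]; exact hmem _ (F.s_mem e),
      by rw [AltPath.target, ht]; exact hmem _ (F.t_mem e)⟩, ⟨hs, ht, hw⟩, p, q, hp, hq, rfl⟩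
  choose g hg hg' using hex
  have hpn : ∀ {e p}, LinkPre F V b c e p → ∀ y ∈ p, ¬ y.isLeft = true := by
    rintro e p (⟨rfl, -⟩ | ⟨v, -, rfl⟩) y hy
    · simp at hy
    · rw [List.mem_singleton.1 hy]
      exact Bool.noConfusion
  have hgb : Function.Bijective g := by
    constructor
    · intro e e' he
      obtain ⟨p, q, hp, hq, h⟩ := hg' e
      obtain ⟨p', q', hp', hq', h'⟩ := hg' e'
      rw [he, h'] at h
      have := (eq_of_append_marked (P := fun y => y.isLeft = true) (hpn hp') (hpn hp) rfl rfl h).2.1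
      exact (Sum.inl_injective this).symm
    · intro π
      obtain ⟨e, p, q, hp, hq, h⟩ := exists_linkPre_linkPost hbF hc π.1.ne π.1.chain π.2.1 π.2.2
      obtain ⟨p', q', hp', hq', h'⟩ := hg' e
      refine ⟨e, Subtype.ext (AltPath.edges_injective ?_)⟩
      rw [h', h, hp.unique hb hp', hq.unique hb hq']
  exact ⟨hVV, Equiv.ofBijective g hgb, fun e => hg e⟩

end Link

end Graph


/-! ### The calculus of projects -/

theorem scale_top (r : ℝ) : scale r ⊤ = ⊤ := rfl

theorem scale_coe (r x : ℝ) : scale r (x : WithTop ℝ) = ((r * x : ℝ) : WithTop ℝ) := rfl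

theorem scale_zero (r : ℝ) : scale r 0 = 0 := by
  change scale r ((0 : ℝ) : WithTop ℝ) = _
  rw [scale_coe, mul_zero, WithTop.coe_zero]

theorem scale_one (x : WithTop ℝ) : scale 1 x = x := by
  induction x with
  | top => rfl
  | coe x => rw [scale_coe, one_mul]

theorem scale_scale (r s : ℝ) (x : WithTop ℝ) : scale r (scale s x) = scale (r * s) x := by
  induction x with
  | top => rfl
  | coe x => rw [scale_coe, scale_coe, scale_coe, mul_assoc]

theorem scale_add (r : ℝ) (x y : WithTop ℝ) : scale r (x + y) = scale r x + scale r y := by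
  induction x with
  | top => simp [scale_top]
  | coe x =>
    induction y with
    | top => simp [scale_top]
    | coe y => rw [← WithTop.coe_add, scale_coe, scale_coe, scale_coe, mul_add, WithTop.coe_add]

theorem scale_sum {ι : Type*} (s : Finset ι) (r : ℝ) (f : ι → WithTop ℝ) :
    scale r (∑ i ∈ s, f i) = ∑ i ∈ s, scale r (f i) := by
  classical
  induction s using Finset.induction_on with
  | empty => exact scale_zero r
  | insert a s ha ih => rw [Finset.sum_insert ha, Finset.sum_insert ha, scale_add, ih]

/-- The index set has to be nonempty because of `0 * ∞ = ∞`. -/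
theorem sum_scale {ι : Type*} [Fintype ι] [Nonempty ι] (r : ι → ℝ) (x : WithTop ℝ) :
    scale (∑ i, r i) x = ∑ i, scale (r i) x := by
  induction x with
  | top =>
    obtain ⟨i⟩ := ‹Nonempty ι›
    simp only [scale_top]
    rw [eq_comm, WithTop.sum_eq_top]
    exact ⟨i, Finset.mem_univ i, rfl⟩
  | coe x =>
    simp only [scale_coe]
    rw [← WithTop.coe_sum, Finset.sum_mul]

theorem ext_zero : ext 0 = 0 := by simp [ext]

theorem ext_add (x y : ℝ≥0∞) : ext (x + y) = ext x + ext y := by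
  unfold ext
  by_cases hx : x = ⊤
  · simp [hx]
  by_cases hy : y = ⊤
  · simp [hy]
  simp only [hx, hy, ENNReal.add_eq_top, or_self, if_false]
  rw [ENNReal.toReal_add hx hy, WithTop.coe_add]

namespace SlicedGraph

variable {L L' L'' : Type}

theorem deloc_same_of_eqOn [DecidableEq L'] {f g : L → L'} {F : SlicedGraph L}
    (h : ∀ v ∈ F.V, f v = g v) : (F.deloc f).Same (F.deloc g) :=
  ⟨Finset.image_congr h, Equiv.refl _, fun i =>
    ⟨rfl, Graph.deloc_eq_of_eqOn fun v hv => h v (F.slice_V i ▸ hv)⟩⟩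

theorem deloc_deloc_same [DecidableEq L'] [DecidableEq L''] (f : L → L') (g : L' → L'')
    (F : SlicedGraph L) : ((F.deloc f).deloc g).Same (F.deloc (g ∘ f)) :=
  ⟨Finset.image_image, Equiv.refl _, fun i => ⟨rfl, Graph.deloc_deloc_same f g (F.slice i)⟩⟩

/-- The measurement of the plugging of three sliced graphs. -/
def meas3 (m : Set.Ioc (0 : ℝ) 1 → ℝ≥0∞) (F G H : SlicedGraph L) : WithTop ℝ :=
  ∑ p : (F.I × G.I) × H.I, scale (F.α p.1.1 * G.α p.1.2 * H.α p.2)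
    (ext (Graph.meas3 (F.slice p.1.1) (G.slice p.1.2) (H.slice p.2) m))

theorem meas3_rot (m : Set.Ioc (0 : ℝ) 1 → ℝ≥0∞) (F G H : SlicedGraph L) :
    meas3 m F G H = meas3 m G H F := by
  unfold meas3
  rw [← ((Equiv.prodAssoc F.I G.I H.I).trans (Equiv.prodComm _ _)).sum_comp]
  refine Finset.sum_congr rfl ?_
  rintro ⟨⟨i, j⟩, k⟩ _
  simp only [Equiv.trans_apply, Equiv.prodAssoc_apply, Equiv.prodComm_apply, Prod.swap_prod_mk]
  rw [Graph.meas3_rot, mul_assoc, mul_comm]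

variable [DecidableEq L]

theorem exec_comm_same (F G : SlicedGraph L) : (F.exec G).Same (G.exec F) :=
  ⟨symmDiff_comm _ _, Equiv.prodComm _ _, fun _ => ⟨mul_comm _ _, Graph.exec_comm_same _ _⟩⟩

theorem exec_assoc_same {F G H : SlicedGraph L} (hV : ∀ v, v ∈ F.V → v ∈ G.V → v ∉ H.V) :
    ((F.exec G).exec H).Same (F.exec (G.exec H)) :=
  ⟨symmDiff_assoc _ _ _, Equiv.prodAssoc _ _ _, fun _ => ⟨(mul_assoc _ _ _).symm,
    Graph.exec_assoc_same (by simpa only [slice_V] using hV)⟩⟩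

theorem exec_deloc_same [DecidableEq L'] {F G : SlicedGraph L} {f : L → L'}
    (hf : Set.InjOn f (F.V ∪ G.V : Finset L)) :
    ((F.exec G).deloc f).Same ((F.deloc f).exec (G.deloc f)) := by
  have h : ∀ i j, (((F.slice i).exec (G.slice j)).deloc f).Same
      (((F.slice i).deloc f).exec ((G.slice j).deloc f)) := fun i j =>
    Graph.exec_deloc_same (by rw [F.slice_V, G.slice_V]; exact hf)
  obtain ⟨i⟩ := F.nonempty_I
  obtain ⟨j⟩ := G.nonempty_I
  refine ⟨?_, Equiv.refl _, fun p => ⟨rfl, h p.1 p.2⟩⟩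
  have := (h i j).1
  simp only [Graph.deloc, Graph.exec, F.slice_V, G.slice_V] at this
  exact this

theorem meas_deloc [DecidableEq L'] (m : Set.Ioc (0 : ℝ) 1 → ℝ≥0∞) {F G : SlicedGraph L}
    {f : L → L'} (hf : Set.InjOn f (F.V ∪ G.V : Finset L)) :
    meas m (F.deloc f) (G.deloc f) = meas m F G := by
  refine Finset.sum_congr rfl fun (p : F.I × G.I) _ => ?_
  have : Graph.meas m ((F.slice p.1).deloc f) ((G.slice p.2).deloc f) =
      Graph.meas m (F.slice p.1) (G.slice p.2) :=
    Graph.meas_deloc m (by rw [F.slice_V p.1, G.slice_V p.2]; exact hf)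
  change scale _ (ext (Graph.meas m ((F.slice p.1).deloc f) ((G.slice p.2).deloc f))) = _
  rw [this]
  rfl

theorem unit_exec (F G : SlicedGraph L) : (F.exec G).unit = F.unit * G.unit := by
  unfold unit
  rw [Finset.sum_mul_sum]
  exact Fintype.sum_prod_type _

theorem meas_exec_add (m : Set.Ioc (0 : ℝ) 1 → ℝ≥0∞) {F G H : SlicedGraph L}
    (hV : ∀ v, v ∈ F.V → v ∈ G.V → v ∉ H.V) :
    meas m (F.exec G) H + scale H.unit (meas m F G) = meas3 m F G H := by
  have h : scale H.unit (meas m F G) = ∑ p : (F.I × G.I) × H.I,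
      scale (F.α p.1.1 * G.α p.1.2 * H.α p.2)
        (ext (Graph.meas m (F.slice p.1.1) (G.slice p.1.2))) := by
    unfold meas unit
    rw [scale_sum]
    refine Eq.trans ?_ (Fintype.sum_prod_type _).symm
    refine Finset.sum_congr rfl fun p _ => ?_
    rw [sum_scale]
    refine Finset.sum_congr rfl fun k _ => ?_
    rw [scale_scale, mul_comm]
  rw [h]
  have h' : meas m (F.exec G) H = ∑ p : (F.I × G.I) × H.I,
      scale (F.α p.1.1 * G.α p.1.2 * H.α p.2)
        (ext (Graph.meas m ((F.slice p.1.1).exec (G.slice p.1.2)) (H.slice p.2))) := rfl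
  rw [h']
  unfold meas3
  rw [← Finset.sum_add_distrib]
  refine Finset.sum_congr rfl fun p _ => ?_
  rw [← scale_add, ← ext_add, Graph.meas_exec_add m (by simpa only [slice_V] using hV)]

end SlicedGraph

namespace Project

variable {L L' L'' : Type} {m : Set.Ioc (0 : ℝ) 1 → ℝ≥0∞}

/-- The project of wager `0` whose only slice is `Graph.link V a b`. -/
def link [DecidableEq L] {K : Type} (V : Finset K) (a b : K → L) : Project L :=
  Quotient.mk (PreProject.setoid L) ⟨0, SlicedGraph.single (Graph.link V a b)⟩

theorem carrier_deloc [DecidableEq L'] (f : L → L') (a : Project L) :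
    (deloc f a).carrier = a.carrier.image f := by
  induction a using Quotient.inductionOn with
  | h a => rfl

theorem deloc_congr [DecidableEq L'] {f g : L → L'} {a : Project L}
    (h : ∀ v ∈ a.carrier, f v = g v) : deloc f a = deloc g a := by
  induction a using Quotient.inductionOn with
  | h a => exact Quotient.sound ⟨rfl, SlicedGraph.deloc_same_of_eqOn h⟩

theorem deloc_deloc [DecidableEq L'] [DecidableEq L''] (f : L → L') (g : L' → L'')
    (a : Project L) : deloc g (deloc f a) = deloc (g ∘ f) a := by
  induction a using Quotient.inductionOn with
  | h a => exact Quotient.sound ⟨rfl, SlicedGraph.deloc_deloc_same f g a.graph⟩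

theorem mk_single_eq {F G : Graph L} (h : F.Same G) :
    (Quotient.mk (PreProject.setoid L) ⟨0, SlicedGraph.single F⟩ : Project L) =
      Quotient.mk (PreProject.setoid L) ⟨0, SlicedGraph.single G⟩ :=
  Quotient.sound ⟨rfl, h.1, Equiv.refl _, fun _ => ⟨rfl, h⟩⟩

variable [DecidableEq L] [DecidableEq L']

theorem deloc_id (a : Project L) : deloc id a = a := by
  induction a using Quotient.inductionOn with
  | h a =>
    exact Quotient.sound ⟨rfl, by simp [PreProject.deloc, SlicedGraph.deloc], Equiv.refl _,
      fun i => ⟨rfl, Graph.deloc_id_same _⟩⟩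

theorem deloc_eq_self {f : L → L} {a : Project L} (h : ∀ v ∈ a.carrier, f v = v) :
    deloc f a = a :=
  (deloc_congr (g := id) h).trans (deloc_id a)

theorem carrier_cut (a b : Project L) : (cut m a b).carrier = a.carrier ∆ b.carrier := by
  induction a, b using Quotient.inductionOn₂ with
  | h a b => rfl

theorem carrier_cut_of_disjoint {a b : Project L} (h : Disjoint a.carrier b.carrier) :
    (cut m a b).carrier = a.carrier ∪ b.carrier := by
  rw [carrier_cut]
  exact h.symmDiff_eq_sup

theorem cut_comm (a b : Project L) : cut m a b = cut m b a := by
  induction a, b using Quotient.inductionOn₂ with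
  | h a b => exact Quotient.sound ⟨PreProject.sca_comm m a b, SlicedGraph.exec_comm_same _ _⟩

theorem sca_deloc {a b : Project L} {f : L → L'}
    (hf : Set.InjOn f (a.carrier ∪ b.carrier : Finset L)) :
    sca m (deloc f a) (deloc f b) = sca m a b := by
  induction a, b using Quotient.inductionOn₂ with
  | h a b =>
    change PreProject.sca m (a.deloc f) (b.deloc f) = PreProject.sca m a b
    unfold PreProject.sca
    exact congrArg _ (SlicedGraph.meas_deloc m hf)

theorem cut_deloc {a b : Project L} {f : L → L'}
    (hf : Set.InjOn f (a.carrier ∪ b.carrier : Finset L)) :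
    deloc f (cut m a b) = cut m (deloc f a) (deloc f b) := by
  have hs := sca_deloc (m := m) hf
  induction a, b using Quotient.inductionOn₂ with
  | h a b => exact Quotient.sound ⟨hs.symm, SlicedGraph.exec_deloc_same hf⟩

/-- Cyclic form of the adjunction `⟪f ∷ g, h⟫ = ⟪f, g ∷ h⟫`. -/
theorem sca_cut_rot {f g h : Project L}
    (hV : ∀ v, v ∈ f.carrier → v ∈ g.carrier → v ∉ h.carrier) :
    sca m (cut m f g) h = sca m (cut m g h) f := by
  have key : ∀ f g h : PreProject L, (∀ v, v ∈ f.graph.V → v ∈ g.graph.V → v ∉ h.graph.V) →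
      PreProject.sca m (PreProject.cut m f g) h =
        scale (g.graph.unit * h.graph.unit) f.wager + scale (f.graph.unit * h.graph.unit) g.wager +
          scale (f.graph.unit * g.graph.unit) h.wager +
          SlicedGraph.meas3 m f.graph g.graph h.graph := by
    intro f g h hV
    rw [← SlicedGraph.meas_exec_add m hV]
    change scale h.graph.unit (PreProject.sca m f g) +
      scale (f.graph.exec g.graph).unit h.wager + _ = _
    unfold PreProject.sca
    rw [scale_add, scale_add, scale_scale, scale_scale, SlicedGraph.unit_exec,
      mul_comm h.graph.unit, mul_comm h.graph.unit]
    simp only [PreProject.cut]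
    abel
  induction f using Quotient.inductionOn
  induction g, h using Quotient.inductionOn₂
  rename_i f g h
  change PreProject.sca m (PreProject.cut m f g) h = PreProject.sca m (PreProject.cut m g h) f
  rw [key f g h hV, key g h f fun v h1 h2 h3 => hV v h3 h1 h2, SlicedGraph.meas3_rot,
    mul_comm h.graph.unit, mul_comm g.graph.unit f.graph.unit]
  abel

/-- The adjunction between execution and orthogonality. -/
theorem sca_cut {f g h : Project L} (hV : ∀ v, v ∈ f.carrier → v ∈ g.carrier → v ∉ h.carrier) :
    sca m (cut m f g) h = sca m f (cut m g h) := by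
  rw [sca_cut_rot hV, sca_comm]

theorem cut_assoc {f g h : Project L} (hV : ∀ v, v ∈ f.carrier → v ∈ g.carrier → v ∉ h.carrier) :
    cut m (cut m f g) h = cut m f (cut m g h) := by
  have hs := sca_cut (m := m) hV
  induction f using Quotient.inductionOn
  induction g, h using Quotient.inductionOn₂
  exact Quotient.sound ⟨hs, SlicedGraph.exec_assoc_same hV⟩

section Link

variable {K K' : Type}

theorem carrier_link (V : Finset K) (a b : K → L) :
    (link V a b).carrier = V.image a ∪ V.image b := rfl

theorem link_congr {V : Finset K} {a b a' b' : K → L} (ha : ∀ v ∈ V, a v = a' v)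
    (hb : ∀ v ∈ V, b v = b' v) : link V a b = link V a' b' :=
  mk_single_eq (Graph.link_same_of_eqOn ha hb)

theorem link_swap (V : Finset K) (a b : K → L) : link V a b = link V b a :=
  mk_single_eq (Graph.link_swap_same V a b)

theorem link_image [DecidableEq K'] {V : Finset K} {θ : K → K'} (hθ : Set.InjOn θ V)
    (a b : K' → L) : link (V.image θ) a b = link V (a ∘ θ) (b ∘ θ) :=
  (mk_single_eq (Graph.link_image_same hθ a b)).symm

theorem deloc_link (V : Finset K) (a b : K → L) (f : L → L') :
    deloc f (link V a b) = link V (f ∘ a) (f ∘ b) := by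
  have h := Graph.link_deloc_same V a b f
  exact Quotient.sound ⟨rfl, h.1, Equiv.refl _, fun _ => ⟨rfl, h⟩⟩

theorem fax_eq_link (V : Finset ℕ) : fax V = link V (ψ 0) (ψ 1) :=
  mk_single_eq ⟨rfl, Equiv.refl _, by rintro (v | v) <;> exact ⟨rfl, rfl, rfl⟩⟩

theorem zero_eq_link (a b : ℕ → L) : zero ∅ = link (∅ : Finset ℕ) a b :=
  mk_single_eq ⟨rfl, ⟨fun e => e.elim, fun e => e.elim (fun e => (Finset.notMem_empty _ e.2).elim)
    (fun e => (Finset.notMem_empty _ e.2).elim), fun e => e.elim, by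
      rintro (e | e) <;> exact (Finset.notMem_empty _ e.2).elim⟩, fun e => e.elim⟩

/-- Executing against links from `b v` to `c v` moves the vertices `b v` to `c v`. -/
theorem cut_link {f : Project L} {V : Finset K} {b c : K → L} {ρ : L → L}
    (hb : ∀ v ∈ V, b v ∈ f.carrier) (hc : ∀ v ∈ V, c v ∉ f.carrier)
    (hbi : Set.InjOn b V) (hρ : ∀ v ∈ V, ρ (b v) = c v)
    (hρ' : ∀ x ∈ f.carrier, x ∉ V.image b → ρ x = x) :
    cut m f (link V b c) = deloc ρ f := by
  induction f using Quotient.inductionOn with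
  | h f =>
    have h : ∀ i, ((f.graph.slice i).deloc ρ).Same ((f.graph.slice i).exec (Graph.link V b c)) :=
      fun i => Graph.exec_link_same (by rw [f.graph.slice_V]; exact hb)
        (by rw [f.graph.slice_V]; exact hc) hbi hρ (by rw [f.graph.slice_V]; exact hρ')
    refine (Quotient.sound (s := PreProject.setoid L) ⟨?_, ?_, (Equiv.prodPUnit _).symm, ?_⟩).symm
    · change f.wager = PreProject.sca m f ⟨0, SlicedGraph.single (Graph.link V b c)⟩
      have h1 : (SlicedGraph.single (Graph.link V b c)).unit = 1 := by
        change ∑ _ : Unit, (1 : ℝ) = 1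
        simp
      have h2 : f.graph.meas m (SlicedGraph.single (Graph.link V b c)) = 0 := by
        refine Finset.sum_eq_zero fun p _ => ?_
        have : Graph.meas m (f.graph.slice p.1) (Graph.link V b c) = 0 :=
          Graph.meas_link m (by rw [f.graph.slice_V]; exact hc)
        change scale _ (ext (Graph.meas m (f.graph.slice p.1) (Graph.link V b c))) = 0
        rw [this, ext_zero, scale_zero]
      unfold PreProject.sca
      rw [h1, h2, scale_zero, scale_one, add_zero, add_zero]
    · obtain ⟨i⟩ := f.graph.nonempty_I
      have := (h i).1
      simp only [Graph.deloc, Graph.exec, f.graph.slice_V] at this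
      exact this
    · exact fun i => ⟨mul_one _, h i⟩

theorem cut_zero (f : Project L) : cut m f (zero ∅) = f := by
  by_cases hL : Nonempty L
  · obtain ⟨x⟩ := hL
    rw [zero_eq_link (fun _ => x) fun _ => x, cut_link (ρ := id) (by simp) (by simp) (by simp)
      (by simp) (by simp), deloc_id]
  · have : IsEmpty L := not_nonempty_iff.1 hL
    have h : (zero (∅ : Finset L)) = link (∅ : Finset L) id id :=
      mk_single_eq ⟨rfl, ⟨fun e => e.elim, fun e => (isEmptyElim (Graph.s _ e)), fun e => e.elim,
        fun e => (isEmptyElim (Graph.s _ e))⟩, fun e => e.elim⟩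
    rw [h, cut_link (ρ := id) (by simp) (by simp) (by simp) (by simp) (by simp), deloc_id]

/-- Links with disjoint ends are put together; the families are indexed by disjoint parts of one
set of indices. -/
theorem cut_link_link [DecidableEq K'] {V W : Finset K} {i j : K → K'} (hi : Set.InjOn i V)
    (hj : Set.InjOn j W) (hij : ∀ v w, i v ≠ j w) (a b : K' → L)
    (hd : Disjoint (link V (a ∘ i) (b ∘ i)).carrier (link W (a ∘ j) (b ∘ j)).carrier) :
    cut m (link V (a ∘ i) (b ∘ i)) (link W (a ∘ j) (b ∘ j)) =
      link (V.image i ∪ W.image j) a b := by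
  have h := (Graph.exec_same_union hd).symm.trans (Graph.link_union_same hi hj hij a b)
  refine Quotient.sound ⟨?_, h.1, Equiv.prodPUnit _, fun p => ⟨(mul_one _).symm, h⟩⟩
  change PreProject.sca m _ _ = 0
  unfold PreProject.sca
  rw [scale_zero, scale_zero, add_zero, zero_add]
  refine Finset.sum_eq_zero fun p _ => ?_
  have : Graph.meas m (Graph.link V (a ∘ i) (b ∘ i)) (Graph.link W (a ∘ j) (b ∘ j)) = 0 :=
    Graph.meas_eq_zero_of_disjoint m hd
  change scale _ (ext (Graph.meas m (Graph.link V (a ∘ i) (b ∘ i))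
    (Graph.link W (a ∘ j) (b ∘ j)))) = 0
  rw [this, ext_zero, scale_zero]

end Link

end Project


/-! ### Polars and linear implication -/

section Polar

variable {L L' : Type} {m : Set.Ioc (0 : ℝ) 1 → ℝ≥0∞}

theorem subset_polar_polar {V : Finset L} {S : Set (Project L)} (hS : ∀ a ∈ S, a.carrier = V) :
    S ⊆ polar m V (polar m V S) :=
  fun a ha => ⟨hS a ha, fun _ hc => (hc.2 a ha).symm⟩

variable [DecidableEq L] [DecidableEq L']

open Project

theorem exists_deloc_eq [Nonempty L] {f : L → L'} {V : Finset L} (hf : Set.InjOn f V)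
    {a : Project L'} (ha : a.carrier = V.image f) : ∃ b, b.carrier = V ∧ deloc f b = a := by
  have hinv : ∀ v ∈ V, Function.invFunOn f V (f v) = v := fun v hv => hf.leftInvOn_invFunOn hv
  refine ⟨deloc (Function.invFunOn f V) a, ?_, ?_⟩
  · rw [carrier_deloc, ha, Finset.image_image]
    exact (Finset.image_congr hinv).trans Finset.image_id
  · rw [deloc_deloc]
    refine deloc_eq_self fun w hw => ?_
    rw [ha] at hw
    obtain ⟨v, hv, rfl⟩ := Finset.mem_image.1 hw
    exact congrArg f (hinv v hv)

theorem deloc_injOn [Nonempty L] {f : L → L'} {V : Finset L} (hf : Set.InjOn f V)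
    {a b : Project L} (ha : a.carrier = V) (hb : b.carrier = V) (h : deloc f a = deloc f b) :
    a = b := by
  have key : ∀ c : Project L, c.carrier = V → deloc (Function.invFunOn f V) (deloc f c) = c := by
    intro c hc
    rw [deloc_deloc]
    exact deloc_eq_self fun v hv => hf.leftInvOn_invFunOn (hc ▸ hv)
  rw [← key a ha, h, key b hb]

theorem polar_deloc [Nonempty L] {f : L → L'} {V : Finset L} (hf : Set.InjOn f V)
    {S : Set (Project L)} (hS : ∀ a ∈ S, a.carrier = V) :
    polar m (V.image f) (deloc f '' S) = deloc f '' polar m V S := by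
  have key : ∀ a ∈ S, ∀ b : Project L, b.carrier = V →
      (Orth m (deloc f a) (deloc f b) ↔ Orth m a b) := by
    intro a ha b hb
    unfold Orth
    rw [carrier_deloc, carrier_deloc, hS a ha, hb, sca_deloc (by rw [hS a ha, hb]; simpa using hf)]
    simp
  ext b
  constructor
  · rintro ⟨hb, h⟩
    obtain ⟨b, hbV, rfl⟩ := exists_deloc_eq hf hb
    exact ⟨b, ⟨hbV, fun a ha => (key a ha b hbV).1 (h _ ⟨a, ha, rfl⟩)⟩, rfl⟩
  · rintro ⟨b, ⟨hbV, h⟩, rfl⟩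
    refine ⟨by rw [carrier_deloc, hbV], ?_⟩
    rintro _ ⟨a, ha, rfl⟩
    exact (key a ha b hbV).2 (h a ha)

theorem carrier_cut_union_left {V W : Finset L} (hVW : Disjoint V W) {f a : Project L}
    (hf : f.carrier = V ∪ W) (ha : a.carrier = V) : (cut m f a).carrier = W := by
  rw [carrier_cut, hf, ha]
  rw [Finset.disjoint_left] at hVW
  ext v
  have := @hVW v
  simp only [Finset.mem_symmDiff, Finset.mem_union]
  tauto

/-- Adjunction: `S ⊸ T^⊥ = (S ⊗ T)^⊥`. -/
theorem lolli_polar {V W : Finset L} (hVW : Disjoint V W) {S T : Set (Project L)}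
    (hS : ∀ a ∈ S, a.carrier = V) (hT : ∀ b ∈ T, b.carrier = W) :
    lolli m V S W (polar m W T) = polar m (V ∪ W) (Set.image2 (cut m) S T) := by
  have key : ∀ f : Project L, f.carrier = V ∪ W → ∀ a ∈ S, ∀ b ∈ T,
      (Orth m b (cut m f a) ↔ Orth m (cut m a b) f) := by
    intro f hf a ha b hb
    unfold Orth
    have h1 : ∀ v, v ∈ f.carrier → v ∈ a.carrier → v ∉ b.carrier := by
      intro v _ h2 h3
      rw [hS a ha] at h2
      rw [hT b hb] at h3
      exact Finset.disjoint_left.1 hVW h2 h3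
    rw [carrier_cut_union_left hVW hf (hS a ha), hT b hb, sca_comm, sca_cut_rot h1,
      carrier_cut_of_disjoint (by rw [hS a ha, hT b hb]; exact hVW), hS a ha, hT b hb, hf]
    simp
  ext f
  constructor
  · rintro ⟨hf, h⟩
    refine ⟨hf, ?_⟩
    rintro _ ⟨a, ha, b, hb, rfl⟩
    exact (key f hf a ha b hb).1 ((h a ha).2 b hb)
  · rintro ⟨hf, h⟩
    exact ⟨hf, fun a ha => ⟨carrier_cut_union_left hVW hf (hS a ha), fun b hb =>
      (key f hf a ha b hb).2 (h _ ⟨a, ha, b, hb, rfl⟩)⟩⟩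

variable {V W U : Finset L} {S T R : Set (Project L)}

theorem lolli_biorth (hVW : Disjoint V W) (hS : ∀ a ∈ S, a.carrier = V)
    (hT : polar m W (polar m W T) = T) :
    polar m (V ∪ W) (polar m (V ∪ W) (lolli m V S W T)) = lolli m V S W T := by
  rw [← hT, lolli_polar hVW hS (fun b hb => hb.1), polar_polar_polar]
  rintro _ ⟨a, ha, b, hb, rfl⟩
  rw [carrier_cut_of_disjoint (by rw [hS a ha, hb.1]; exact hVW), hS a ha, hb.1]

/-- A linear map is determined by what it does on generators of its source. -/
theorem lolli_polar_polar (hVW : Disjoint V W) (hS : ∀ a ∈ S, a.carrier = V)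
    (hT : polar m W (polar m W T) = T) :
    lolli m V (polar m V (polar m V S)) W T = lolli m V S W T := by
  apply Set.Subset.antisymm
  · exact fun f hf => ⟨hf.1, fun a ha => hf.2 a (subset_polar_polar hS ha)⟩
  · rintro f ⟨hf, h⟩
    refine ⟨hf, fun a ha => ?_⟩
    have h1 : ∀ x y : Project L, x.carrier = V → y.carrier = W →
        ∀ v, v ∈ f.carrier → v ∈ x.carrier → v ∉ y.carrier := by
      intro x y hx hy v _ h2 h3
      rw [hx] at h2
      rw [hy] at h3
      exact Finset.disjoint_left.1 hVW h2 h3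
    rw [← hT]
    refine ⟨carrier_cut_union_left hVW hf ha.1, fun b hb => ?_⟩
    -- `f ∷ b` is orthogonal to the generators, hence to `a`
    have hfb : cut m f b ∈ polar m V S := by
      refine ⟨carrier_cut_union_left hVW.symm (by rw [hf, Finset.union_comm]) hb.1, fun x hx => ?_⟩
      have h2 := hb.2 _ (h x hx)
      refine ⟨?_, ?_⟩
      · rw [carrier_cut_union_left hVW.symm (by rw [hf, Finset.union_comm]) hb.1, hS x hx]
      · have h3 := h2.2
        rw [sca_cut (h1 x b (hS x hx) hb.1), cut_comm, ← sca_cut (fun v h4 h5 h6 =>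
          h1 x b (hS x hx) hb.1 v h4 h6 h5), sca_comm] at h3
        exact h3
    have h2 := ha.2 _ hfb
    refine ⟨by rw [hb.1, carrier_cut_union_left hVW hf ha.1], ?_⟩
    have h3 := h2.2
    rw [sca_cut (fun v h4 h5 h6 => h1 a b ha.1 hb.1 v h4 h6 h5), cut_comm,
      ← sca_cut (h1 a b ha.1 hb.1), sca_comm] at h3
    exact h3

theorem lolli_deloc [Nonempty L] (hVW : Disjoint V W) {f : L → L'}
    (hf : Set.InjOn f (V ∪ W : Finset L)) (hS : ∀ a ∈ S, a.carrier = V)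
    (hT : ∀ b ∈ T, b.carrier = W) :
    lolli m (V.image f) (deloc f '' S) (W.image f) (deloc f '' T) = deloc f '' lolli m V S W T := by
  have hc : ∀ g : Project L, g.carrier = V ∪ W → ∀ a ∈ S,
      cut m (deloc f g) (deloc f a) = deloc f (cut m g a) := by
    intro g hg a ha
    rw [cut_deloc]
    rw [hg, hS a ha]
    refine hf.mono ?_
    intro v
    simp only [Finset.coe_union, Set.mem_union, Finset.mem_coe]
    tauto
  ext g
  constructor
  · rintro ⟨hg, h⟩
    rw [← Finset.image_union] at hg
    obtain ⟨g, hg', rfl⟩ := exists_deloc_eq hf hg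
    refine ⟨g, ⟨hg', fun a ha => ?_⟩, rfl⟩
    obtain ⟨b, hb, e⟩ := h _ ⟨a, ha, rfl⟩
    rw [hc g hg' a ha] at e
    have : b = cut m g a := deloc_injOn (V := W)
      (hf.mono (by simp)) (hT b hb) (carrier_cut_union_left hVW hg' (hS a ha)) e
    exact this ▸ hb
  · rintro ⟨g, ⟨hg, h⟩, rfl⟩
    refine ⟨by rw [carrier_deloc, hg, Finset.image_union], ?_⟩
    rintro _ ⟨a, ha, rfl⟩
    rw [hc g hg a ha]
    exact ⟨_, h a ha, rfl⟩

theorem cut_mem_lolli (hVW : Disjoint V W) (hVU : Disjoint V U) (hWU : Disjoint W U)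
    (hS : ∀ a ∈ S, a.carrier = V) {f g : Project L} (hf : f ∈ lolli m V S W T)
    (hg : g ∈ lolli m W T U R) : cut m f g ∈ lolli m V S U R := by
  rw [Finset.disjoint_left] at hVW hVU hWU
  refine ⟨?_, fun a ha => ?_⟩
  · rw [carrier_cut, hf.1, hg.1]
    ext v
    have h1 := @hVW v
    have h2 := @hVU v
    have h3 := @hWU v
    simp only [Finset.mem_symmDiff, Finset.mem_union]
    tauto
  · have : cut m (cut m f g) a = cut m g (cut m f a) := by
      rw [cut_comm f g, cut_assoc]
      intro v
      have h1 := @hVW v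
      have h2 := @hVU v
      rw [hf.1, hg.1, hS a ha]
      simp only [Finset.mem_union]
      tauto
    rw [this]
    exact hg.2 _ (hf.2 a ha)

/-- Currying: both sides are the projects `f` such that `f ∷ a ∷ b` is in `R` for all `a ∈ S` and
`b ∈ T`. -/
theorem lolli_curry (hVW : Disjoint V W) (hVU : Disjoint V U) (hWU : Disjoint W U)
    (hS : ∀ a ∈ S, a.carrier = V) (hT : ∀ b ∈ T, b.carrier = W)
    (hR : polar m U (polar m U R) = R) :
    lolli m (V ∪ W) (polar m (V ∪ W) (polar m (V ∪ W) (Set.image2 (cut m) S T))) U R =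
      lolli m W T (V ∪ U) (lolli m V S U R) := by
  rw [lolli_polar_polar (Finset.disjoint_union_left.2 ⟨hVU, hWU⟩) ?_ hR]
  · have hc : ∀ f : Project L, ∀ a ∈ S, ∀ b ∈ T,
        cut m (cut m f b) a = cut m f (cut m a b) := by
      intro f a ha b hb
      rw [cut_assoc, cut_comm b a]
      intro v _ h2 h3
      rw [hT b hb] at h2
      rw [hS a ha] at h3
      exact Finset.disjoint_left.1 hVW h3 h2
    ext f
    constructor
    · rintro ⟨hf, h⟩
      refine ⟨by rw [hf]; ext; simp only [Finset.mem_union]; tauto,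
        fun b hb => ⟨?_, fun a ha => ?_⟩⟩
      · exact carrier_cut_union_left (V := W) (Finset.disjoint_union_right.2 ⟨hVW.symm, hWU⟩)
          (by rw [hf]; ext; simp only [Finset.mem_union]; tauto) (hT b hb)
      · rw [hc f a ha b hb]
        exact h _ ⟨a, ha, b, hb, rfl⟩
    · rintro ⟨hf, h⟩
      refine ⟨by rw [hf]; ext; simp only [Finset.mem_union]; tauto, ?_⟩
      rintro _ ⟨a, ha, b, hb, rfl⟩
      rw [← hc f a ha b hb]
      exact (h b hb).2 a ha
  · rintro _ ⟨a, ha, b, hb, rfl⟩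
    rw [carrier_cut_of_disjoint (by rw [hS a ha, hT b hb]; exact hVW), hS a ha, hT b hb]

theorem cut_cut_cut_comm {a b c d : Project L}
    (h : Disjoint (a.carrier ∪ c.carrier) (b.carrier ∪ d.carrier)) :
    cut m (cut m a b) (cut m c d) = cut m (cut m a c) (cut m b d) := by
  rw [Finset.disjoint_left] at h
  simp only [Finset.mem_union] at h
  rw [cut_assoc, ← cut_assoc (f := b), cut_comm b c, cut_assoc (f := c), ← cut_assoc (f := a)]
  all_goals
    intro v
    have := @h v
    try simp only [carrier_cut, Finset.mem_symmDiff]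
    tauto

end Polar

/-! ### The category of conducts -/

/-- The map on `ℕ × {0, 1}` (extended to `ℕ × ℕ`) that is `a` on level `0` and `b` on level `1`. -/
def place {L : Type} (a b : ℕ → L) (p : ℕ × ℕ) : L := if p.2 = 0 then a p.1 else b p.1

/-- The sets of vertices on the levels `i` and `j`. -/
abbrev levels (V W : Finset ℕ) (i j : ℕ) : Finset (ℕ × ℕ) := V.image (ψ i) ∪ W.image (ψ j)

theorem ψ_injective (i : ℕ) : Function.Injective (ψ i) := fun _ _ h => congrArg Prod.fst h

theorem disjoint_ψ (V W : Finset ℕ) {i j : ℕ} (h : i ≠ j) :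
    Disjoint (V.image (ψ i)) (W.image (ψ j)) := by
  rw [Finset.disjoint_left]
  intro p hp hp'
  obtain ⟨x, -, rfl⟩ := Finset.mem_image.1 hp
  obtain ⟨y, -, e⟩ := Finset.mem_image.1 hp'
  exact h (congrArg Prod.snd e).symm

theorem snd_of_mem_levels {V W : Finset ℕ} {i j : ℕ} {p : ℕ × ℕ} (h : p ∈ levels V W i j) :
    p.2 = i ∨ p.2 = j := by
  rcases Finset.mem_union.1 h with h | h <;> obtain ⟨x, -, rfl⟩ := Finset.mem_image.1 h
  · exact Or.inl rfl
  · exact Or.inr rfl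

theorem levels_symmDiff {V W U : Finset ℕ} {i j k : ℕ} (hij : i ≠ j) (hik : i ≠ k) (hjk : j ≠ k) :
    levels V W i j ∆ levels W U j k = levels V U i k := by
  have h1 := Finset.disjoint_left.1 (disjoint_ψ V W hij)
  have h2 := Finset.disjoint_left.1 (disjoint_ψ V U hik)
  have h3 := Finset.disjoint_left.1 (disjoint_ψ W U hjk)
  ext p
  have h1 := @h1 p
  have h2 := @h2 p
  have h3 := @h3 p
  simp only [Finset.mem_symmDiff, Finset.mem_union]
  tauto

theorem image_levels {V W : Finset ℕ} {i j i' j' : ℕ} {f : ℕ × ℕ → ℕ × ℕ}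
    (hi : ∀ x, f (ψ i x) = ψ i' x) (hj : ∀ x, f (ψ j x) = ψ j' x) :
    (levels V W i j).image f = levels V W i' j' := by
  rw [Finset.image_union, Finset.image_image, Finset.image_image]
  congr 1
  · exact Finset.image_congr fun x _ => hi x
  · exact Finset.image_congr fun x _ => hj x

theorem image_μ_levels (V W : Finset ℕ) : (levels V W 0 1).image μ = levels V W 1 2 :=
  image_levels (fun _ => rfl) fun _ => rfl

theorem ν_ψ_zero (x : ℕ) : ν (ψ 0 x) = ψ 0 x := by simp [ν, ψ]

theorem ν_ψ_two (x : ℕ) : ν (ψ 2 x) = ψ 1 x := by simp [ν, ψ]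

theorem μ_injective : Function.Injective μ := by
  rintro ⟨x, i⟩ ⟨y, j⟩ h
  simpa [μ] using h

/-- Maps that keep the first coordinate are injective where they are so on the second one. -/
theorem injOn_of_snd {S : Set (ℕ × ℕ)} {f : ℕ × ℕ → ℕ × ℕ} (h1 : ∀ p, (f p).1 = p.1)
    (h2 : ∀ p ∈ S, ∀ q ∈ S, (f p).2 = (f q).2 → p.2 = q.2) : Set.InjOn f S := by
  intro p hp q hq e
  refine Prod.ext ?_ (h2 p hp q hq (congrArg Prod.snd e))
  rw [← h1 p, ← h1 q, e]

theorem injOn_ν (V W : Finset ℕ) : Set.InjOn ν (levels V W 0 2) := by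
  refine injOn_of_snd (fun _ => rfl) fun p hp q hq e => ?_
  have e : p.2 / 2 = q.2 / 2 := e
  rcases snd_of_mem_levels hp with h | h <;> rcases snd_of_mem_levels hq with h' | h' <;> omega

open Project

variable {m : Set.Ioc (0 : ℝ) 1 → ℝ≥0∞}

/-- Composition is associative on projects of composable carriers: both composites are obtained
from `f ∷ g ∷ h`, where `f`, `g` and `h` lie on the levels `0, 1`, `1, 2` and `2, 3`. -/
theorem comp_assoc {f g h : Project (ℕ × ℕ)} {V W U Z : Finset ℕ}
    (hf : f.carrier = levels V W 0 1) (hg : g.carrier = levels W U 0 1)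
    (hh : h.carrier = levels U Z 0 1) : comp m (comp m f g) h = comp m f (comp m g h) := by
  -- `σ` sends the levels `0, 2, 3` to `0, 1, 2`, and `σ'` does so with the levels `0, 1, 3`
  let σ : ℕ × ℕ → ℕ × ℕ := fun p => (p.1, p.2 - 1)
  let σ' : ℕ × ℕ → ℕ × ℕ := fun p => (p.1, (p.2 + 1) / 2)
  have hG : (deloc μ g).carrier = levels W U 1 2 := by rw [carrier_deloc, hg, image_μ_levels]
  have hh' : (deloc μ h).carrier = levels U Z 1 2 := by rw [carrier_deloc, hh, image_μ_levels]
  have hH : (deloc μ (deloc μ h)).carrier = levels U Z 2 3 := by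
    rw [carrier_deloc, hh']
    exact image_levels (fun _ => rfl) fun _ => rfl
  have hFG : (cut m f (deloc μ g)).carrier = levels V U 0 2 := by
    rw [carrier_cut, hf, hG, levels_symmDiff (by decide) (by decide) (by decide)]
  have hGH : (cut m (deloc μ g) (deloc μ (deloc μ h))).carrier = levels W Z 1 3 := by
    rw [carrier_cut, hG, hH, levels_symmDiff (by decide) (by decide) (by decide)]
  have hgh : (cut m g (deloc μ h)).carrier = levels W Z 0 2 := by
    rw [carrier_cut, hg, hh', levels_symmDiff (by decide) (by decide) (by decide)]
  have e1 : deloc ν (cut m f (deloc μ g)) = deloc σ (cut m f (deloc μ g)) := by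
    refine deloc_congr fun p hp => ?_
    rw [hFG] at hp
    refine Prod.ext rfl ?_
    change p.2 / 2 = p.2 - 1
    rcases snd_of_mem_levels hp with h | h <;> rw [h]
  have e2 : deloc μ h = deloc σ (deloc μ (deloc μ h)) := by
    rw [deloc_deloc μ σ]
    exact (deloc_eq_self fun p _ => Prod.ext rfl rfl).symm
  have e3 : deloc μ (deloc ν (cut m g (deloc μ h))) =
      deloc σ' (cut m (deloc μ g) (deloc μ (deloc μ h))) := by
    rw [← cut_deloc μ_injective.injOn, deloc_deloc, deloc_deloc]
    refine deloc_congr fun p hp => ?_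
    rw [hgh] at hp
    refine Prod.ext rfl ?_
    change p.2 / 2 + 1 = (p.2 + 1 + 1) / 2
    rcases snd_of_mem_levels hp with h | h <;> rw [h]
  have e4 : f = deloc σ' f := by
    refine (deloc_eq_self fun p hp => ?_).symm
    rw [hf] at hp
    refine Prod.ext rfl ?_
    change (p.2 + 1) / 2 = p.2
    rcases snd_of_mem_levels hp with h | h <;> rw [h]
  have hassoc : cut m (cut m f (deloc μ g)) (deloc μ (deloc μ h)) =
      cut m f (cut m (deloc μ g) (deloc μ (deloc μ h))) := by
    refine cut_assoc ?_
    intro p h1 h2 h3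
    rw [hf] at h1
    rw [hH] at h3
    have := snd_of_mem_levels h1
    have := snd_of_mem_levels h3
    omega
  have hl : comp m (comp m f g) h =
      deloc ν (deloc σ (cut m (cut m f (deloc μ g)) (deloc μ (deloc μ h)))) := by
    have : Set.InjOn σ ((cut m f (deloc μ g)).carrier ∪ (deloc μ (deloc μ h)).carrier :
        Finset (ℕ × ℕ)) := by
      refine injOn_of_snd (fun _ => rfl) fun p hp q hq e => ?_
      have e : p.2 - 1 = q.2 - 1 := e
      rw [hFG, hH, Finset.mem_coe, Finset.mem_union] at hp hq
      rcases hp with hp | hp <;> rcases hq with hq | hq <;> have := snd_of_mem_levels hp <;>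
        have := snd_of_mem_levels hq <;> omega
    rw [cut_deloc this, ← e1, ← e2]
    rfl
  have hr : comp m f (comp m g h) =
      deloc ν (deloc σ' (cut m f (cut m (deloc μ g) (deloc μ (deloc μ h))))) := by
    have : Set.InjOn σ' (f.carrier ∪ (cut m (deloc μ g) (deloc μ (deloc μ h))).carrier :
        Finset (ℕ × ℕ)) := by
      refine injOn_of_snd (fun _ => rfl) fun p hp q hq e => ?_
      have e : (p.2 + 1) / 2 = (q.2 + 1) / 2 := e
      rw [hGH, hf, Finset.mem_coe, Finset.mem_union] at hp hq
      rcases hp with hp | hp <;> rcases hq with hq | hq <;> have := snd_of_mem_levels hp <;>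
        have := snd_of_mem_levels hq <;> omega
    rw [cut_deloc this, ← e3, ← e4]
    rfl
  rw [hl, hr, ← hassoc, deloc_deloc σ ν, deloc_deloc σ' ν]
  refine deloc_congr fun p hp => ?_
  rw [carrier_cut, hFG, hH, levels_symmDiff (by decide) (by decide) (by decide)] at hp
  refine Prod.ext rfl ?_
  change (p.2 - 1) / 2 = (p.2 + 1) / 2 / 2
  rcases snd_of_mem_levels hp with h | h <;> rw [h]

/-- Composing with a relocation of the target. -/
theorem comp_link {f : Project (ℕ × ℕ)} {V W : Finset ℕ} (hf : f.carrier = levels V W 0 1)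
    (θ : ℕ → ℕ) :
    comp m f (link W (ψ 0) (ψ 1 ∘ θ)) = deloc (place (ψ 0) (ψ 1 ∘ θ)) f := by
  unfold comp
  rw [deloc_link]
  have : cut m f (link W (μ ∘ ψ 0) (μ ∘ ψ 1 ∘ θ)) = deloc (place (ψ 0) (ψ 2 ∘ θ)) f := by
    refine cut_link ?_ ?_ ?_ ?_ ?_
    · intro v hv
      rw [hf]
      exact Finset.mem_union_right _ (Finset.mem_image_of_mem (ψ 1) hv)
    · intro v hv h
      rw [hf] at h
      have : (2 = 0) ∨ (2 = 1) := snd_of_mem_levels h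
      omega
    · exact (ψ_injective 1).injOn
    · exact fun v _ => rfl
    · intro p hp hp'
      rw [hf] at hp
      rcases Finset.mem_union.1 hp with h | h
      · obtain ⟨x, -, rfl⟩ := Finset.mem_image.1 h
        rfl
      · exact absurd h hp'
  rw [this, deloc_deloc]
  refine deloc_congr fun p hp => ?_
  rw [hf] at hp
  rcases Finset.mem_union.1 hp with h | h <;> obtain ⟨x, -, rfl⟩ := Finset.mem_image.1 h
  · exact ν_ψ_zero _
  · exact ν_ψ_two _

/-- Composing with a relocation of the source. -/
theorem link_comp {f : Project (ℕ × ℕ)} {U V W : Finset ℕ} {θ θ' : ℕ → ℕ}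
    (hV : V = U.image θ) (hf : f.carrier = levels V W 0 1) (hθ : ∀ x ∈ U, θ' (θ x) = x) :
    comp m (link U (ψ 0) (ψ 1 ∘ θ)) f = deloc (place (ψ 0 ∘ θ') (ψ 1)) f := by
  subst hV
  unfold comp
  have hf' : (deloc μ f).carrier = levels (U.image θ) W 1 2 := by
    rw [carrier_deloc, hf, image_μ_levels]
  have : cut m (link U (ψ 0) (ψ 1 ∘ θ)) (deloc μ f) =
      deloc (fun p => if p.2 = 1 then ψ 0 (θ' p.1) else p) (deloc μ f) := by
    rw [cut_comm, link_swap]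
    refine cut_link ?_ ?_ ?_ ?_ ?_
    · intro v hv
      rw [hf']
      exact Finset.mem_union_left _ (Finset.mem_image_of_mem (ψ 1) (Finset.mem_image_of_mem θ hv))
    · intro v hv h
      rw [hf'] at h
      have : (0 = 1) ∨ (0 = 2) := snd_of_mem_levels h
      omega
    · intro v hv w hw e
      rw [← hθ v hv, ← hθ w hw]
      exact congrArg θ' (congrArg Prod.fst e)
    · intro v hv
      change ψ 0 (θ' (θ v)) = ψ 0 v
      rw [hθ v hv]
    · intro p hp hp'
      rw [hf'] at hp
      rcases Finset.mem_union.1 hp with h | h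
      · rw [Finset.image_image] at h
        exact absurd h hp'
      · obtain ⟨x, -, rfl⟩ := Finset.mem_image.1 h
        rfl
  rw [this, deloc_deloc, deloc_deloc]
  refine deloc_congr fun p hp => ?_
  rw [hf] at hp
  rcases Finset.mem_union.1 hp with h | h <;> obtain ⟨x, -, rfl⟩ := Finset.mem_image.1 h
  · exact ν_ψ_zero _
  · exact ν_ψ_two _

theorem deloc_place_self {f : Project (ℕ × ℕ)} {V W : Finset ℕ} (hf : f.carrier = levels V W 0 1) :
    deloc (place (ψ 0) (ψ 1)) f = f := by
  refine deloc_eq_self fun p hp => ?_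
  rw [hf] at hp
  rcases Finset.mem_union.1 hp with h | h <;> obtain ⟨x, -, rfl⟩ := Finset.mem_image.1 h <;> rfl

namespace Conduct

/-- The projects of a conduct, relocated along `p`. -/
def at' {L : Type} [DecidableEq L] (A : Conduct m) (p : ℕ → L) : Set (Project L) :=
  deloc p '' A.projects

variable {L L' : Type} [DecidableEq L] [DecidableEq L']

theorem carrier_at {A : Conduct m} {p : ℕ → L} : ∀ a ∈ A.at' p, a.carrier = A.carrier.image p := by
  rintro _ ⟨a, ha, rfl⟩
  rw [carrier_deloc, A.carrier_eq a ha]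

theorem deloc_image_at (A : Conduct m) (p : ℕ → L) (f : L → L') :
    deloc f '' A.at' p = A.at' (f ∘ p) := by
  unfold at'
  rw [Set.image_image]
  exact Set.image_congr fun a _ => deloc_deloc p f a

theorem at_id (A : Conduct m) : A.at' id = A.projects := by
  unfold at'
  rw [show deloc (id : ℕ → ℕ) = id from funext deloc_id, Set.image_id]

theorem biorth_at (A : Conduct m) {p : ℕ → L} (hp : Set.InjOn p A.carrier) :
    polar m (A.carrier.image p) (polar m (A.carrier.image p) (A.at' p)) = A.at' p := by
  unfold at'
  rw [polar_deloc hp A.carrier_eq, polar_deloc hp fun _ h => h.1, A.biorth]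

end Conduct

open Conduct

theorem mor_eq (A B : Conduct m) : Mor A B = lolli m (A.carrier.image (ψ 0)) (A.at' (ψ 0))
    (B.carrier.image (ψ 1)) (B.at' (ψ 1)) := rfl

/-- Morphisms may be tested after any relocation. -/
theorem deloc_image_mor {L : Type} [DecidableEq L] (A B : Conduct m) {f : ℕ × ℕ → L}
    (hf : Set.InjOn f (levels A.carrier B.carrier 0 1)) :
    deloc f '' Mor A B = lolli m (A.carrier.image (f ∘ ψ 0)) (A.at' (f ∘ ψ 0))
      (B.carrier.image (f ∘ ψ 1)) (B.at' (f ∘ ψ 1)) := by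
  rw [mor_eq, ← lolli_deloc (disjoint_ψ _ _ (by decide)) hf carrier_at carrier_at, deloc_image_at,
    deloc_image_at, Finset.image_image, Finset.image_image]

/-- Relocations of conducts are morphisms. -/
theorem link_mem_mor {A B : Conduct m} {θ : ℕ → ℕ} (hB : B.carrier = A.carrier.image θ)
    (hproj : A.at' θ ⊆ B.projects) :
    link A.carrier (ψ 0) (ψ 1 ∘ θ) ∈ Mor A B := by
  refine ⟨by rw [carrier_link, hB, Finset.image_image], ?_⟩
  rintro _ ⟨a, ha, rfl⟩
  refine ⟨deloc θ a, hproj ⟨a, ha, rfl⟩, ?_⟩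
  have hc : (deloc (ψ 0) a).carrier = A.carrier.image (ψ 0) := by
    rw [carrier_deloc, A.carrier_eq a ha]
  rw [cut_comm, cut_link (ρ := fun p => ψ 1 (θ p.1)), deloc_deloc, deloc_deloc]
  · rfl
  · intro v hv
    rw [hc]
    exact Finset.mem_image_of_mem _ hv
  · intro v hv h
    rw [hc] at h
    obtain ⟨x, -, e⟩ := Finset.mem_image.1 h
    exact absurd (congrArg Prod.snd e) (by simp [ψ])
  · exact (ψ_injective 0).injOn
  · exact fun v _ => rfl
  · intro p hp hp'
    rw [hc] at hp
    exact absurd hp hp'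

theorem comp_mem_mor {A B C : Conduct m} {f g : Project (ℕ × ℕ)} (hf : f ∈ Mor A B)
    (hg : g ∈ Mor B C) : comp m f g ∈ Mor A C := by
  have hg' : deloc μ g ∈ lolli m (B.carrier.image (ψ 1)) (B.at' (ψ 1))
      (C.carrier.image (ψ 2)) (C.at' (ψ 2)) := by
    have := deloc_image_mor B C μ_injective.injOn
    exact this ▸ ⟨g, hg, rfl⟩
  have h := cut_mem_lolli (disjoint_ψ _ _ (by decide)) (disjoint_ψ _ _ (by decide))
    (disjoint_ψ _ _ (by decide)) carrier_at hf hg'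
  have h2 := lolli_deloc (m := m) (disjoint_ψ A.carrier C.carrier (i := 0) (j := 2) (by decide))
    (injOn_ν _ _) (carrier_at (A := A)) (carrier_at (A := C))
  have e0 : ν ∘ ψ 0 = ψ 0 := funext ν_ψ_zero
  have e2 : ν ∘ ψ 2 = ψ 1 := funext ν_ψ_two
  rw [deloc_image_at, deloc_image_at, Finset.image_image, Finset.image_image, e0, e2] at h2
  rw [mor_eq, h2]
  exact ⟨_, h, rfl⟩

theorem categoryLaws (m : Set.Ioc (0 : ℝ) 1 → ℝ≥0∞) : CategoryLaws m where
  fax_mem A := by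
    rw [fax_eq_link]
    exact link_mem_mor (θ := id) Finset.image_id.symm (by rw [at_id])
  comp_mem := comp_mem_mor
  fax_comp {A B f} hf := by
    rw [fax_eq_link]
    exact (link_comp (θ := id) (θ' := id) Finset.image_id.symm hf.1 fun _ _ => rfl).trans
      (deloc_place_self hf.1)
  comp_fax {A B f} hf := by
    rw [fax_eq_link]
    exact (comp_link hf.1 id).trans (deloc_place_self hf.1)
  assoc hf hg hh := comp_assoc hf.1 hg.1 hh.1


/-! ### Maps of locations -/

/-- The map `φ ∘ ψ i`: the even numbers are the image of `dbl 0`, the odd ones that of `dbl 1`. -/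
def dbl (i x : ℕ) : ℕ := 2 * x + i

/-- The common left inverse of `dbl 0` and `dbl 1`. -/
def half (n : ℕ) : ℕ := n / 2

/-- The map that is `a` on the even numbers and `b` on the odd ones. -/
def merge {L : Type} (a b : ℕ → L) (n : ℕ) : L := if n % 2 = 0 then a (n / 2) else b (n / 2)

/-- The map `θ` on every level. -/
def lift (θ : ℕ → ℕ) (p : ℕ × ℕ) : ℕ × ℕ := (θ p.1, p.2)

section Locations

variable {L : Type}

theorem merge_dbl_zero (a b : ℕ → L) (x : ℕ) : merge a b (dbl 0 x) = a x := by
  unfold merge dbl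
  rw [if_pos (by omega)]
  congr 1
  omega

theorem merge_dbl_one (a b : ℕ → L) (x : ℕ) : merge a b (dbl 1 x) = b x := by
  unfold merge dbl
  rw [if_neg (by omega)]
  congr 1
  omega

theorem dbl_injective (i : ℕ) : Function.Injective (dbl i) := by
  intro x y h
  unfold dbl at h
  omega

theorem dbl_zero_ne_one (x y : ℕ) : dbl 0 x ≠ dbl 1 y := by
  unfold dbl
  omega

theorem half_dbl {i : ℕ} (hi : i < 2) (x : ℕ) : half (dbl i x) = x := by
  unfold half dbl
  omega

theorem exists_dbl (n : ℕ) : (∃ x, n = dbl 0 x) ∨ ∃ x, n = dbl 1 x := by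
  unfold dbl
  rcases Nat.even_or_odd' n with ⟨x, h | h⟩
  · exact Or.inl ⟨x, h⟩
  · exact Or.inr ⟨x, h⟩

theorem merge_injective {a b : ℕ → L} (ha : Function.Injective a) (hb : Function.Injective b)
    (hab : ∀ x y, a x ≠ b y) : Function.Injective (merge a b) := by
  intro n k h
  rcases exists_dbl n with ⟨x, rfl⟩ | ⟨x, rfl⟩ <;> rcases exists_dbl k with ⟨y, rfl⟩ | ⟨y, rfl⟩ <;>
    simp only [merge_dbl_zero, merge_dbl_one] at h
  · rw [ha h]
  · exact (hab _ _ h).elim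
  · exact (hab _ _ h.symm).elim
  · rw [hb h]

theorem lift_injective {θ : ℕ → ℕ} (h : Function.Injective θ) : Function.Injective (lift θ) :=
  h.prodMap Function.injective_id

theorem τ_injective : Function.Injective τ := by
  have h : Function.Involutive τ := by
    rintro ⟨x, i⟩
    unfold τ
    split_ifs <;> dsimp only at * <;> ext <;> dsimp only at * <;> omega
  exact h.injective

variable [DecidableEq L] {m : Set.Ioc (0 : ℝ) 1 → ℝ≥0∞}

open Project

theorem disjoint_lift (f g : Project (ℕ × ℕ)) :
    Disjoint (deloc (lift (dbl 0)) f).carrier (deloc (lift (dbl 1)) g).carrier := by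
  rw [Finset.disjoint_left, carrier_deloc, carrier_deloc]
  intro p hp hp'
  obtain ⟨q, -, rfl⟩ := Finset.mem_image.1 hp
  obtain ⟨r, -, h⟩ := Finset.mem_image.1 hp'
  exact dbl_zero_ne_one _ _ (congrArg Prod.fst h).symm

end Locations

section Tensor

variable {L : Type} [DecidableEq L] {m : Set.Ioc (0 : ℝ) 1 → ℝ≥0∞}

open Project Conduct

/-! ### Tensor products of conducts and of morphisms -/

theorem image2_cut_comm (S T : Set (Project L)) :
    Set.image2 (cut m) S T = Set.image2 (cut m) T S :=
  Set.image2_comm cut_comm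

/-- The conduct generated by `S ⊗ T` only depends on the conducts generated by `S` and by `T`. -/
theorem polar_image2_polar_polar {V W : Finset L} (hVW : Disjoint V W) {S T : Set (Project L)}
    (hS : ∀ a ∈ S, a.carrier = V) (hT : ∀ b ∈ T, b.carrier = W) :
    polar m (V ∪ W) (Set.image2 (cut m) (polar m V (polar m V S)) T) =
      polar m (V ∪ W) (Set.image2 (cut m) S T) := by
  rw [← lolli_polar hVW (fun _ h => h.1) hT, ← lolli_polar hVW hS hT,
    lolli_polar_polar hVW hS (polar_polar_polar m W hT)]

theorem polar_image2_polar_polar_right {V W : Finset L} (hVW : Disjoint V W)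
    {S T : Set (Project L)} (hS : ∀ a ∈ S, a.carrier = V) (hT : ∀ b ∈ T, b.carrier = W) :
    polar m (V ∪ W) (Set.image2 (cut m) S (polar m W (polar m W T))) =
      polar m (V ∪ W) (Set.image2 (cut m) S T) := by
  rw [image2_cut_comm, image2_cut_comm S, Finset.union_comm,
    polar_image2_polar_polar hVW.symm hT hS]

theorem carrier_image2 {V W : Finset L} (hVW : Disjoint V W) {S T : Set (Project L)}
    (hS : ∀ a ∈ S, a.carrier = V) (hT : ∀ b ∈ T, b.carrier = W) :
    ∀ c ∈ Set.image2 (cut m) S T, c.carrier = V ∪ W := by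
  rintro _ ⟨a, ha, b, hb, rfl⟩
  rw [carrier_cut_of_disjoint (by rw [hS a ha, hT b hb]; exact hVW), hS a ha, hT b hb]

theorem image2_cut_assoc {V W : Finset L} (hVW : Disjoint V W) {S T R : Set (Project L)}
    (hS : ∀ a ∈ S, a.carrier = V) (hT : ∀ b ∈ T, b.carrier = W) :
    Set.image2 (cut m) (Set.image2 (cut m) S T) R =
      Set.image2 (cut m) S (Set.image2 (cut m) T R) := by
  have h : ∀ a ∈ S, ∀ b ∈ T, ∀ c, cut m (cut m a b) c = cut m a (cut m b c) := by
    intro a ha b hb c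
    refine cut_assoc fun v h1 h2 => ?_
    rw [hS a ha] at h1
    rw [hT b hb] at h2
    exact (Finset.disjoint_left.1 hVW h1 h2).elim
  ext x
  constructor
  · rintro ⟨_, ⟨a, ha, b, hb, rfl⟩, c, hc, rfl⟩
    exact ⟨a, ha, _, ⟨b, hb, c, hc, rfl⟩, (h a ha b hb c).symm⟩
  · rintro ⟨a, ha, _, ⟨b, hb, c, hc, rfl⟩, rfl⟩
    exact ⟨_, ⟨a, ha, b, hb, rfl⟩, c, hc, h a ha b hb c⟩

theorem tensorCarrier_eq (A B : Conduct m) :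
    tensorCarrier A B = A.carrier.image (dbl 0) ∪ B.carrier.image (dbl 1) := by
  unfold tensorCarrier
  rw [Finset.image_union, Finset.image_image, Finset.image_image]
  rfl

theorem image_tensorCarrier (A B : Conduct m) (p : ℕ → L) : (tensorCarrier A B).image p =
    A.carrier.image (p ∘ dbl 0) ∪ B.carrier.image (p ∘ dbl 1) := by
  rw [tensorCarrier_eq, Finset.image_union, Finset.image_image, Finset.image_image]

theorem disjoint_image_dbl {p : ℕ → L} (hp : Function.Injective p) (V W : Finset ℕ) :
    Disjoint (V.image (p ∘ dbl 0)) (W.image (p ∘ dbl 1)) := by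
  rw [Finset.disjoint_left]
  intro v hv hv'
  obtain ⟨x, -, rfl⟩ := Finset.mem_image.1 hv
  obtain ⟨y, -, e⟩ := Finset.mem_image.1 hv'
  exact dbl_zero_ne_one x y (hp e).symm

theorem disjoint_dbl (V W : Finset ℕ) : Disjoint (V.image (dbl 0)) (W.image (dbl 1)) :=
  disjoint_image_dbl Function.injective_id V W

/-- Relocations of `A ⊗ B` are generated by the tensor products of relocated projects. -/
theorem deloc_image_tensorProjects (A B : Conduct m) {p : ℕ → L} (hp : Function.Injective p) :
    deloc p '' tensorProjects A B =
      polar m (A.carrier.image (p ∘ dbl 0) ∪ B.carrier.image (p ∘ dbl 1))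
        (polar m (A.carrier.image (p ∘ dbl 0) ∪ B.carrier.image (p ∘ dbl 1))
          (Set.image2 (cut m) (A.at' (p ∘ dbl 0)) (B.at' (p ∘ dbl 1)))) := by
  have hφ : Set.InjOn φ (A.carrier.image (ψ 0) ∪ B.carrier.image (ψ 1) : Finset (ℕ × ℕ)) := by
    intro q hq r hr e
    have e : 2 * q.1 + q.2 = 2 * r.1 + r.2 := e
    have h := snd_of_mem_levels hq
    have h' := snd_of_mem_levels hr
    exact Prod.ext (by omega) (by omega)
  have hpφ := (hp.injOn (s := Set.univ)).comp hφ fun _ _ => Set.mem_univ _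
  have hS : ∀ c ∈ Set.image2 (fun a b => tensor m (deloc (ψ 0) a) (deloc (ψ 1) b))
      A.projects B.projects, c.carrier = A.carrier.image (ψ 0) ∪ B.carrier.image (ψ 1) := by
    rintro _ ⟨a, ha, b, hb, rfl⟩
    exact carrier_image2 (disjoint_ψ _ _ (by decide)) carrier_at carrier_at _
      ⟨_, ⟨a, ha, rfl⟩, _, ⟨b, hb, rfl⟩, rfl⟩
  have hZ : (A.carrier.image (ψ 0) ∪ B.carrier.image (ψ 1)).image (p ∘ φ) =
      A.carrier.image (p ∘ dbl 0) ∪ B.carrier.image (p ∘ dbl 1) := by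
    rw [Finset.image_union, Finset.image_image, Finset.image_image]
    rfl
  unfold tensorProjects
  rw [Set.image_image]
  simp only [deloc_deloc]
  rw [← polar_deloc hpφ fun _ h => h.1, ← polar_deloc hpφ hS, hZ]
  congr 2
  ext c
  constructor
  · rintro ⟨_, ⟨a, ha, b, hb, rfl⟩, rfl⟩
    refine ⟨_, ⟨a, ha, rfl⟩, _, ⟨b, hb, rfl⟩, ?_⟩
    unfold Project.tensor
    rw [cut_deloc, deloc_deloc, deloc_deloc]
    · rfl
    · rw [carrier_deloc, carrier_deloc, A.carrier_eq a ha, B.carrier_eq b hb]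
      exact hpφ
  · rintro ⟨_, ⟨a, ha, rfl⟩, _, ⟨b, hb, rfl⟩, rfl⟩
    refine ⟨_, ⟨a, ha, b, hb, rfl⟩, ?_⟩
    unfold Project.tensor
    rw [cut_deloc, deloc_deloc, deloc_deloc]
    · rfl
    · rw [carrier_deloc, carrier_deloc, A.carrier_eq a ha, B.carrier_eq b hb]
      exact hpφ

theorem tensorProjects_eq (A B : Conduct m) : tensorProjects A B =
    polar m (tensorCarrier A B) (polar m (tensorCarrier A B)
      (Set.image2 (cut m) (A.at' (dbl 0)) (B.at' (dbl 1)))) := by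
  have h := deloc_image_tensorProjects A B (p := id) Function.injective_id
  rw [show deloc (id : ℕ → ℕ) = id from funext deloc_id, Set.image_id] at h
  rw [h, tensorCarrier_eq]
  rfl

/-- The tensor product of two conducts. -/
def tensorConduct (A B : Conduct m) : Conduct m where
  carrier := tensorCarrier A B
  projects := tensorProjects A B
  carrier_eq a ha := by
    rw [tensorProjects_eq] at ha
    exact ha.1
  biorth := by
    rw [tensorProjects_eq, polar_polar_polar m _ fun _ h => h.1]

theorem at_tensorConduct (A B : Conduct m) {p : ℕ → L} (hp : Function.Injective p) :
    (tensorConduct A B).at' p =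
      polar m (A.carrier.image (p ∘ dbl 0) ∪ B.carrier.image (p ∘ dbl 1))
        (polar m (A.carrier.image (p ∘ dbl 0) ∪ B.carrier.image (p ∘ dbl 1))
          (Set.image2 (cut m) (A.at' (p ∘ dbl 0)) (B.at' (p ∘ dbl 1)))) :=
  deloc_image_tensorProjects A B hp

theorem at_tensor_tensor_left (A B C : Conduct m) {p : ℕ → L} (hp : Function.Injective p) :
    (tensorConduct (tensorConduct A B) C).at' p =
      polar m ((tensorCarrier (tensorConduct A B) C).image p)
        (polar m ((tensorCarrier (tensorConduct A B) C).image p)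
          (Set.image2 (cut m) (Set.image2 (cut m) (A.at' (p ∘ dbl 0 ∘ dbl 0))
            (B.at' (p ∘ dbl 0 ∘ dbl 1))) (C.at' (p ∘ dbl 1)))) := by
  have hp0 : Function.Injective (p ∘ dbl 0) := hp.comp (dbl_injective 0)
  rw [at_tensorConduct _ _ hp, at_tensorConduct _ _ hp0, image_tensorCarrier]
  congr 1
  have h := image_tensorCarrier A B (p ∘ dbl 0)
  change polar m ((tensorCarrier A B).image (p ∘ dbl 0) ∪ _) _ =
    polar m ((tensorCarrier A B).image (p ∘ dbl 0) ∪ _) _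
  have hd := disjoint_image_dbl hp (tensorCarrier A B) C.carrier
  rw [h] at hd ⊢
  exact polar_image2_polar_polar hd
    (carrier_image2 (disjoint_image_dbl hp0 _ _) carrier_at carrier_at) carrier_at

theorem at_tensor_tensor_right (A B C : Conduct m) {p : ℕ → L} (hp : Function.Injective p) :
    (tensorConduct A (tensorConduct B C)).at' p =
      polar m ((tensorCarrier A (tensorConduct B C)).image p)
        (polar m ((tensorCarrier A (tensorConduct B C)).image p)
          (Set.image2 (cut m) (A.at' (p ∘ dbl 0)) (Set.image2 (cut m) (B.at' (p ∘ dbl 1 ∘ dbl 0))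
            (C.at' (p ∘ dbl 1 ∘ dbl 1))))) := by
  have hp1 : Function.Injective (p ∘ dbl 1) := hp.comp (dbl_injective 1)
  rw [at_tensorConduct _ _ hp, at_tensorConduct _ _ hp1, image_tensorCarrier]
  congr 1
  have h := image_tensorCarrier B C (p ∘ dbl 1)
  change polar m (_ ∪ (tensorCarrier B C).image (p ∘ dbl 1)) _ =
    polar m (_ ∪ (tensorCarrier B C).image (p ∘ dbl 1)) _
  have hd := disjoint_image_dbl hp A.carrier (tensorCarrier B C)
  rw [h] at hd ⊢
  exact polar_image2_polar_polar_right hd carrier_at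
    (carrier_image2 (disjoint_image_dbl hp1 _ _) carrier_at carrier_at)

theorem at_one (p : ℕ → L) : (one m).at' p = polar m ∅ (polar m ∅ {zero ∅}) := by
  have h1 : Set.InjOn p (∅ : Finset ℕ) := by simp
  have h2 : ∀ a ∈ ({zero ∅} : Set (Project ℕ)), a.carrier = ∅ := by
    rintro _ rfl
    rfl
  change deloc p '' polar m ∅ (polar m ∅ {zero ∅}) = _
  rw [← polar_deloc h1 fun _ h => h.1, ← polar_deloc h1 h2, Set.image_singleton,
    zero_eq_link id id, deloc_link, ← zero_eq_link, Finset.image_empty]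

theorem at_bot (p : ℕ → L) : (bot m).at' p = polar m ∅ {zero ∅} := by
  have h1 : Set.InjOn p (∅ : Finset ℕ) := by simp
  have h2 : ∀ a ∈ (one m).projects, a.carrier = ∅ := (one m).carrier_eq
  change deloc p '' polar m ∅ (one m).projects = _
  have h3 : ∀ a ∈ ({zero ∅} : Set (Project L)), a.carrier = ∅ := by
    rintro _ rfl
    rfl
  rw [← polar_deloc h1 h2]
  change polar m (Finset.image p ∅) ((one m).at' p) = _
  rw [at_one, Finset.image_empty, polar_polar_polar m ∅ h3]

theorem image2_zero_left (S : Set (Project L)) : Set.image2 (cut m) {zero ∅} S = S := by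
  rw [Set.image2_singleton_left]
  refine (Set.image_congr fun a _ => ?_).trans (Set.image_id S)
  rw [cut_comm, cut_zero, id]

theorem tensorMor_eq {f g : Project (ℕ × ℕ)} {V W V' W' : Finset ℕ}
    (hf : f.carrier = levels V W 0 1) (hg : g.carrier = levels V' W' 0 1) :
    tensorMor m f g = cut m (deloc (lift (dbl 0)) f) (deloc (lift (dbl 1)) g) := by
  have key : ∀ i < 2, ∀ x, ∀ j < 2, τ (ψ j (φ (ψ i x))) = lift (dbl j) (ψ i x) := by
    intro i hi x j hj
    unfold τ lift ψ φ dbl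
    split_ifs <;> simp only [Prod.mk.injEq] at * <;> omega
  have key' : ∀ j < 2, ∀ (V W : Finset ℕ), ∀ p ∈ levels V W 0 1,
      (τ ∘ ψ j ∘ φ) p = lift (dbl j) p := by
    intro j hj V W p hp
    rcases Finset.mem_union.1 hp with h | h <;> obtain ⟨x, -, rfl⟩ := Finset.mem_image.1 h
    · exact key 0 (by decide) x j hj
    · exact key 1 (by decide) x j hj
  unfold tensorMor Project.tensor
  rw [cut_deloc τ_injective.injOn, deloc_deloc, deloc_deloc, deloc_deloc, deloc_deloc]
  congr 1
  · exact deloc_congr fun p hp => key' 0 (by decide) V W p (hf ▸ hp)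
  · exact deloc_congr fun p hp => key' 1 (by decide) V' W' p (hg ▸ hp)

theorem tensorMor_mem {A A' B B' : Conduct m} {f g : Project (ℕ × ℕ)} (hf : f ∈ Mor A A')
    (hg : g ∈ Mor B B') :
    tensorMor m f g ∈ Mor (tensorConduct A B) (tensorConduct A' B') := by
  have hinj : ∀ i, Function.Injective (lift (dbl i)) := fun i => lift_injective (dbl_injective i)
  have hf' : deloc (lift (dbl 0)) f ∈ deloc (lift (dbl 0)) '' Mor A A' := ⟨f, hf, rfl⟩
  have hg' : deloc (lift (dbl 1)) g ∈ deloc (lift (dbl 1)) '' Mor B B' := ⟨g, hg, rfl⟩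
  rw [deloc_image_mor _ _ (hinj _).injOn] at hf' hg'
  have hψ := disjoint_image_dbl (ψ_injective 0) A.carrier B.carrier
  have hd := disjoint_ψ (tensorCarrier A B) (tensorCarrier A' B') (i := 0) (j := 1) (by decide)
  have hT := (tensorConduct A' B').biorth_at (ψ_injective 1).injOn
  rw [tensorMor_eq hf.1 hg.1, mor_eq, at_tensorConduct _ _ (ψ_injective 0)]
  change _ ∈ lolli m ((tensorCarrier A B).image (ψ 0)) _ ((tensorCarrier A' B').image (ψ 1)) _
  change polar m ((tensorCarrier A' B').image (ψ 1)) _ = _ at hT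
  rw [image_tensorCarrier A B] at hd ⊢
  rw [lolli_polar_polar hd (carrier_image2 hψ carrier_at carrier_at) hT]
  refine ⟨?_, ?_⟩
  · rw [carrier_cut_of_disjoint (disjoint_lift f g), hf'.1, hg'.1, image_tensorCarrier]
    exact Finset.union_union_union_comm _ _ _ _
  · rintro _ ⟨x, hx, y, hy, rfl⟩
    rw [cut_cut_cut_comm]
    · rw [at_tensorConduct _ _ (ψ_injective 1)]
      exact subset_polar_polar
        (carrier_image2 (disjoint_image_dbl (ψ_injective 1) _ _) carrier_at carrier_at)
        ⟨_, hf'.2 x hx, _, hg'.2 y hy, rfl⟩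
    · refine (disjoint_lift f g).mono ?_ ?_
      · rw [hf'.1, carrier_at x hx]
        exact Finset.union_subset subset_rfl Finset.subset_union_left
      · rw [hg'.1, carrier_at y hy]
        exact Finset.union_subset subset_rfl Finset.subset_union_left

end Tensor

/-! ### Relocations as morphisms -/

variable {m : Set.Ioc (0 : ℝ) 1 → ℝ≥0∞}

open Project Conduct

/-- The category of conducts. This instance and those below are scoped, so that outside of this
namespace a structure on conducts that is bound in a statement is the one that is found. -/
scoped instance conductCategory : Category (Conduct m) := (categoryLaws m).category

section Relocation

variable {A B C D : Conduct m}

/-- The underlying project of a morphism of conducts. -/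
abbrev proj (f : A ⟶ B) : Project (ℕ × ℕ) := (categoryLaws m).proj f

/-- The morphism given by a project. -/
def homMk (f : Project (ℕ × ℕ)) (hf : f ∈ Mor A B) : A ⟶ B :=
  (⟨f, hf⟩ : {f : Project (ℕ × ℕ) // f ∈ Mor A B})

theorem proj_mem (f : A ⟶ B) : proj f ∈ Mor A B := Subtype.property f

theorem homMk_ext {f g : A ⟶ B} (h : proj f = proj g) : f = g := Subtype.ext h

theorem proj_comp (f : A ⟶ B) (g : B ⟶ C) : proj (f ≫ g) = comp m (proj f) (proj g) := rfl

theorem proj_id (A : Conduct m) : proj (𝟙 A) = fax A.carrier := rfl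

theorem carrier_proj (f : A ⟶ B) : (proj f).carrier = levels A.carrier B.carrier 0 1 :=
  (proj_mem f).1

/-- The morphism `f` is the relocation along `θ`: it links `(x, 0)` with `(θ x, 1)` for every `x`
in the carrier of its source. -/
structure IsRelocation (f : A ⟶ B) (θ : ℕ → ℕ) : Prop where
  proj_eq : proj f = link A.carrier (ψ 0) (ψ 1 ∘ θ)
  carrier_eq : B.carrier = A.carrier.image θ

namespace IsRelocation

theorem id (A : Conduct m) : IsRelocation (𝟙 A) id :=
  ⟨(proj_id A).trans (fax_eq_link _), Finset.image_id.symm⟩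

theorem comp {f : A ⟶ B} {g : B ⟶ C} {θ η : ℕ → ℕ} (hf : IsRelocation f θ)
    (hg : IsRelocation g η) : IsRelocation (f ≫ g) (η ∘ θ) := by
  refine ⟨?_, by rw [hg.carrier_eq, hf.carrier_eq, Finset.image_image]⟩
  rw [proj_comp, hg.proj_eq, comp_link (carrier_proj f), hf.proj_eq, deloc_link]
  rfl

theorem eq {f g : A ⟶ B} {θ η : ℕ → ℕ} (hf : IsRelocation f θ) (hg : IsRelocation g η)
    (h : ∀ x ∈ A.carrier, θ x = η x) : f = g := by
  refine homMk_ext ?_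
  rw [hf.proj_eq, hg.proj_eq]
  exact link_congr (fun _ _ => rfl) fun x hx => congrArg (ψ 1) (h x hx)

/-- Relocation along `θ` of a morphism gives a commutative square. -/
theorem naturality {f : A ⟶ B} {f' : C ⟶ D} {a : A ⟶ C} {b : B ⟶ D} {θ θ' : ℕ → ℕ}
    (ha : IsRelocation a θ) (hb : IsRelocation b θ) (hθ : ∀ x, θ' (θ x) = x)
    (hf : proj f' = deloc (lift θ) (proj f)) : f ≫ b = a ≫ f' := by
  refine homMk_ext ?_
  rw [proj_comp, proj_comp, hb.proj_eq, comp_link (carrier_proj f), ha.proj_eq,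
    link_comp ha.carrier_eq (carrier_proj f') fun x _ => hθ x, hf, deloc_deloc]
  refine deloc_congr fun p hp => ?_
  rw [carrier_proj] at hp
  rcases Finset.mem_union.1 hp with h | h <;> obtain ⟨x, -, rfl⟩ := Finset.mem_image.1 h
  · exact congrArg (ψ 0) (hθ x).symm
  · rfl

end IsRelocation

/-- The relocation along `θ`. -/
def relocate (θ : ℕ → ℕ) (hB : B.carrier = A.carrier.image θ) (h : A.at' θ ⊆ B.projects) : A ⟶ B :=
  homMk _ (link_mem_mor hB h)

theorem isRelocation_relocate (θ : ℕ → ℕ) (hB : B.carrier = A.carrier.image θ)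
    (h : A.at' θ ⊆ B.projects) : IsRelocation (relocate θ hB h) θ := ⟨rfl, hB⟩

/-- The isomorphism from `A` to its relocation along `θ`. -/
def relocationIso (θ θ' : ℕ → ℕ) (hB : B.carrier = A.carrier.image θ) (h : A.at' θ = B.projects)
    (hθ : ∀ x, θ' (θ x) = x) : A ≅ B where
  hom := relocate θ hB h.subset
  inv := relocate θ'
    (by rw [hB, Finset.image_image, show θ' ∘ θ = id from funext hθ, Finset.image_id])
    (by
      change deloc θ' '' B.projects ⊆ _
      rw [← h, deloc_image_at, show θ' ∘ θ = id from funext hθ, at_id])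
  hom_inv_id := ((isRelocation_relocate _ _ _).comp (isRelocation_relocate _ _ _)).eq
    (IsRelocation.id A) fun x _ => hθ x
  inv_hom_id := by
    refine ((isRelocation_relocate _ _ _).comp (isRelocation_relocate _ _ _)).eq
      (IsRelocation.id B) fun y hy => ?_
    rw [hB] at hy
    obtain ⟨x, -, rfl⟩ := Finset.mem_image.1 hy
    exact congrArg θ (hθ x)

variable {θ θ' : ℕ → ℕ}

theorem isRelocation_hom (hB : B.carrier = A.carrier.image θ) (h : A.at' θ = B.projects)
    (hθ : ∀ x, θ' (θ x) = x) : IsRelocation (relocationIso θ θ' hB h hθ).hom θ := ⟨rfl, hB⟩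

theorem isRelocation_inv (hB : B.carrier = A.carrier.image θ) (h : A.at' θ = B.projects)
    (hθ : ∀ x, θ' (θ x) = x) : IsRelocation (relocationIso θ θ' hB h hθ).inv θ' :=
  ⟨rfl, by rw [hB, Finset.image_image, show θ' ∘ θ = id from funext hθ, Finset.image_id]⟩

theorem IsRelocation.isIso {f : A ⟶ B} (hf : IsRelocation f θ) (hθ : ∀ x, θ' (θ x) = x)
    (h : A.at' θ = B.projects) : IsIso f := by
  rw [hf.eq (isRelocation_hom hf.carrier_eq h hθ) fun _ _ => rfl]
  infer_instance

end Relocation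

/-! ### The symmetric monoidal structure -/

section Monoidal

variable {A B C D A' B' C' D' : Conduct m}

/-- The tensor product of morphisms of conducts. -/
def tensorMap (f : A ⟶ A') (g : B ⟶ B') : tensorConduct A B ⟶ tensorConduct A' B' :=
  homMk (tensorMor m (proj f) (proj g)) (tensorMor_mem (proj_mem f) (proj_mem g))

theorem proj_tensorMap (f : A ⟶ A') (g : B ⟶ B') : proj (tensorMap f g) =
    cut m (deloc (lift (dbl 0)) (proj f)) (deloc (lift (dbl 1)) (proj g)) :=
  tensorMor_eq (carrier_proj f) (carrier_proj g)

/-- The tensor product of relocations is the relocation along the combined map. -/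
theorem IsRelocation.tensorMap {f : A ⟶ A'} {g : B ⟶ B'} {θ η : ℕ → ℕ} (hf : IsRelocation f θ)
    (hg : IsRelocation g η) :
    IsRelocation (tensorMap f g) (merge (dbl 0 ∘ θ) (dbl 1 ∘ η)) := by
  have h0 : merge (dbl 0 ∘ θ) (dbl 1 ∘ η) ∘ dbl 0 = dbl 0 ∘ θ := funext (merge_dbl_zero _ _)
  have h1 : merge (dbl 0 ∘ θ) (dbl 1 ∘ η) ∘ dbl 1 = dbl 1 ∘ η := funext (merge_dbl_one _ _)
  have hd := disjoint_lift (proj f) (proj g)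
  constructor
  · rw [hf.proj_eq, hg.proj_eq, deloc_link, deloc_link] at hd
    rw [proj_tensorMap, hf.proj_eq, hg.proj_eq, deloc_link, deloc_link]
    change _ = link (tensorCarrier A B) _ _
    rw [tensorCarrier_eq, ← cut_link_link (dbl_injective 0).injOn (dbl_injective 1).injOn
      dbl_zero_ne_one]
    · rw [Function.comp_assoc, Function.comp_assoc, h0, h1]
      rfl
    · rw [Function.comp_assoc, Function.comp_assoc, h0, h1]
      exact hd
  · change tensorCarrier A' B' = (tensorCarrier A B).image _
    rw [image_tensorCarrier, h0, h1, tensorCarrier_eq, hf.carrier_eq, hg.carrier_eq,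
      Finset.image_image, Finset.image_image]

theorem forall_tensorCarrier {P : ℕ → Prop} : (∀ n ∈ tensorCarrier A B, P n) ↔
    (∀ x ∈ A.carrier, P (dbl 0 x)) ∧ ∀ x ∈ B.carrier, P (dbl 1 x) := by
  rw [tensorCarrier_eq]
  simp only [Finset.mem_union, or_imp, forall_and, Finset.forall_mem_image]

theorem forall_of_dbl {P : ℕ → Prop} (h0 : ∀ x, P (dbl 0 x)) (h1 : ∀ x, P (dbl 1 x)) (n : ℕ) :
    P n := by
  rcases exists_dbl n with ⟨x, rfl⟩ | ⟨x, rfl⟩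
  · exact h0 x
  · exact h1 x

theorem tensorMap_id (A B : Conduct m) : tensorMap (𝟙 A) (𝟙 B) = 𝟙 (tensorConduct A B) :=
  ((IsRelocation.id A).tensorMap (IsRelocation.id B)).eq (IsRelocation.id _) fun x _ =>
    forall_of_dbl (P := fun x => merge (dbl 0 ∘ id) (dbl 1 ∘ id) x = x)
      (merge_dbl_zero _ _) (merge_dbl_one _ _) x

theorem deloc_lift_comp (f g : Project (ℕ × ℕ)) {θ : ℕ → ℕ} (hθ : Function.Injective θ) :
    deloc (lift θ) (comp m f g) = comp m (deloc (lift θ) f) (deloc (lift θ) g) := by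
  unfold comp
  rw [deloc_deloc, deloc_deloc, show μ ∘ lift θ = lift θ ∘ μ from rfl, ← deloc_deloc μ,
    ← cut_deloc (lift_injective hθ).injOn, deloc_deloc]
  rfl

theorem tensorMap_comp (f : A ⟶ B) (g : A' ⟶ B') (f' : B ⟶ C) (g' : B' ⟶ C') :
    tensorMap f g ≫ tensorMap f' g' = tensorMap (f ≫ f') (g ≫ g') := by
  refine homMk_ext ?_
  rw [proj_comp, proj_tensorMap, proj_tensorMap, proj_tensorMap, proj_comp, proj_comp,
    deloc_lift_comp _ _ (dbl_injective 0), deloc_lift_comp _ _ (dbl_injective 1)]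
  have hd : Disjoint ((deloc (lift (dbl 0)) (proj f)).carrier ∪
      (deloc μ (deloc (lift (dbl 0)) (proj f'))).carrier)
      ((deloc (lift (dbl 1)) (proj g)).carrier ∪
        (deloc μ (deloc (lift (dbl 1)) (proj g'))).carrier) := by
    have e : ∀ θ (f : Project (ℕ × ℕ)),
        deloc μ (deloc (lift θ) f) = deloc (lift θ) (deloc μ f) := by
      intro θ f
      rw [deloc_deloc, deloc_deloc]
      rfl
    rw [e, e]
    simp only [Finset.disjoint_union_left, Finset.disjoint_union_right, disjoint_lift, and_self]
  have hc : ∀ {A B C : Conduct m} (f : A ⟶ B) (g : B ⟶ C) (θ : ℕ → ℕ),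
      (cut m (deloc (lift θ) (proj f)) (deloc μ (deloc (lift θ) (proj g)))).carrier =
        levels (A.carrier.image θ) (C.carrier.image θ) 0 2 := by
    intro A B C f g θ
    have h : ∀ (V W : Finset ℕ),
        (levels V W 0 1).image (lift θ) = levels (V.image θ) (W.image θ) 0 1 := by
      intro V W
      rw [Finset.image_union, Finset.image_image, Finset.image_image, levels, Finset.image_image,
        Finset.image_image]
      rfl
    rw [carrier_cut, carrier_deloc, carrier_deloc, carrier_deloc, carrier_proj, carrier_proj, h, h,
      image_μ_levels, levels_symmDiff (by decide) (by decide) (by decide)]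
  unfold comp
  rw [cut_deloc μ_injective.injOn, cut_cut_cut_comm hd, cut_deloc]
  rw [hc, hc]
  refine (injOn_ν (A.carrier.image (dbl 0) ∪ A'.carrier.image (dbl 1))
    (C.carrier.image (dbl 0) ∪ C'.carrier.image (dbl 1))).mono ?_
  intro p
  simp only [Finset.image_union, Finset.coe_union, Set.mem_union]
  tauto

/-- The locations of `A`, `B` and `C` in `(A ⊗ B) ⊗ C`, sent to those in `A ⊗ (B ⊗ C)`. -/
def assocLoc : ℕ → ℕ := merge (merge (dbl 0) (dbl 1 ∘ dbl 0)) (dbl 1 ∘ dbl 1)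

/-- The inverse of `assocLoc`. -/
def assocLocInv : ℕ → ℕ := merge (dbl 0 ∘ dbl 0) (merge (dbl 0 ∘ dbl 1) (dbl 1))

/-- The exchange of the even and the odd locations. -/
def swapLoc : ℕ → ℕ := merge (dbl 1) (dbl 0)

theorem assocLocInv_assocLoc : ∀ x, assocLocInv (assocLoc x) = x := by
  unfold assocLoc assocLocInv
  refine forall_of_dbl (forall_of_dbl (fun x => ?_) fun x => ?_) fun x => ?_ <;>
    simp only [merge_dbl_zero, merge_dbl_one, Function.comp_apply]

theorem assocLoc_injective : Function.Injective assocLoc :=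
  Function.LeftInverse.injective assocLocInv_assocLoc

theorem swapLoc_swapLoc : ∀ x, swapLoc (swapLoc x) = x := by
  unfold swapLoc
  refine forall_of_dbl (fun x => ?_) fun x => ?_ <;> simp only [merge_dbl_zero, merge_dbl_one]

theorem swapLoc_injective : Function.Injective swapLoc :=
  Function.LeftInverse.injective swapLoc_swapLoc

theorem carrier_assoc (A B C : Conduct m) : tensorCarrier A (tensorConduct B C) =
    (tensorCarrier (tensorConduct A B) C).image assocLoc := by
  have h00 : assocLoc ∘ dbl 0 = merge (dbl 0) (dbl 1 ∘ dbl 0) := funext (merge_dbl_zero _ _)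
  have h01 : assocLoc ∘ dbl 1 = dbl 1 ∘ dbl 1 := funext (merge_dbl_one _ _)
  have h1 : merge (dbl 0) (dbl 1 ∘ dbl 0) ∘ dbl 0 = dbl 0 := funext (merge_dbl_zero _ _)
  have h2 : merge (dbl 0) (dbl 1 ∘ dbl 0) ∘ dbl 1 = dbl 1 ∘ dbl 0 := funext (merge_dbl_one _ _)
  rw [image_tensorCarrier, h00, h01]
  change _ = (tensorCarrier A B).image _ ∪ _
  rw [image_tensorCarrier, h1, h2, Finset.union_assoc, tensorCarrier_eq]
  change _ ∪ (tensorCarrier B C).image (dbl 1) = _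
  rw [image_tensorCarrier]

theorem at_assoc (A B C : Conduct m) :
    (tensorConduct (tensorConduct A B) C).at' assocLoc =
      (tensorConduct A (tensorConduct B C)).projects := by
  have h1 : assocLoc ∘ dbl 0 ∘ dbl 0 = dbl 0 := by
    funext x
    simp only [assocLoc, merge_dbl_zero, Function.comp_apply]
  have h2 : assocLoc ∘ dbl 0 ∘ dbl 1 = dbl 1 ∘ dbl 0 := by
    funext x
    simp only [assocLoc, merge_dbl_zero, merge_dbl_one, Function.comp_apply]
  have h3 : assocLoc ∘ dbl 1 = dbl 1 ∘ dbl 1 := funext (merge_dbl_one _ _)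
  rw [at_tensor_tensor_left _ _ _ assocLoc_injective, ← at_id,
    at_tensor_tensor_right _ _ _ Function.injective_id, ← carrier_assoc, h1, h2, h3,
    Finset.image_id, image2_cut_assoc (V := A.carrier.image (dbl 0))
      (W := B.carrier.image (dbl 1 ∘ dbl 0)) ?_ carrier_at carrier_at]
  · rfl
  · rw [Finset.disjoint_left]
    intro v hv hv'
    obtain ⟨x, -, rfl⟩ := Finset.mem_image.1 hv
    obtain ⟨y, -, e⟩ := Finset.mem_image.1 hv'
    exact dbl_zero_ne_one _ _ e.symm

theorem carrier_swap (A B : Conduct m) :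
    tensorCarrier B A = (tensorCarrier A B).image swapLoc := by
  rw [image_tensorCarrier, show swapLoc ∘ dbl 0 = dbl 1 from funext (merge_dbl_zero _ _),
    show swapLoc ∘ dbl 1 = dbl 0 from funext (merge_dbl_one _ _), Finset.union_comm,
    tensorCarrier_eq]

theorem at_swap (A B : Conduct m) :
    (tensorConduct A B).at' swapLoc = (tensorConduct B A).projects := by
  rw [at_tensorConduct _ _ swapLoc_injective, ← image_tensorCarrier, ← carrier_swap,
    show swapLoc ∘ dbl 0 = dbl 1 from funext (merge_dbl_zero _ _),
    show swapLoc ∘ dbl 1 = dbl 0 from funext (merge_dbl_one _ _), image2_cut_comm]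
  exact (tensorProjects_eq B A).symm

theorem at_one_tensor (A : Conduct m) : A.at' (dbl 1) = (tensorConduct (one m) A).projects := by
  have h := polar_image2_polar_polar (m := m) (V := ∅) (W := A.carrier.image (dbl 1))
    (S := {zero ∅}) (T := A.at' (dbl 1)) (Finset.disjoint_empty_left _)
    (by rintro _ rfl; rfl) carrier_at
  rw [← at_one (dbl 0), image2_zero_left, Finset.empty_union] at h
  change _ = tensorProjects _ _
  rw [tensorProjects_eq, tensorCarrier_eq]
  change _ = polar m (∅ ∪ _) (polar m (∅ ∪ _) _)
  rw [Finset.empty_union, h, biorth_at _ (dbl_injective 1).injOn]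

theorem at_tensor_one (A : Conduct m) : A.at' (dbl 0) = (tensorConduct A (one m)).projects := by
  rw [← at_swap]
  change _ = deloc swapLoc '' (tensorConduct (one m) A).projects
  rw [← at_one_tensor, deloc_image_at]
  exact congrArg _ (funext (merge_dbl_one _ _)).symm

theorem carrier_one_tensor (A : Conduct m) : tensorCarrier (one m) A = A.carrier.image (dbl 1) := by
  rw [tensorCarrier_eq]
  exact Finset.empty_union _

theorem carrier_tensor_one (A : Conduct m) : tensorCarrier A (one m) = A.carrier.image (dbl 0) := by
  rw [tensorCarrier_eq]
  exact Finset.union_empty _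

/-- The associativity isomorphism. -/
def associatorIso (A B C : Conduct m) :
    tensorConduct (tensorConduct A B) C ≅ tensorConduct A (tensorConduct B C) :=
  relocationIso assocLoc assocLocInv (carrier_assoc A B C) (at_assoc A B C) assocLocInv_assocLoc

/-- The symmetry isomorphism. -/
def braidingIso (A B : Conduct m) : tensorConduct A B ≅ tensorConduct B A :=
  relocationIso swapLoc swapLoc (carrier_swap A B) (at_swap A B) swapLoc_swapLoc

/-- The left unit isomorphism. -/
def leftUnitorIso (A : Conduct m) : tensorConduct (one m) A ≅ A :=
  (relocationIso (dbl 1) half (carrier_one_tensor A) (at_one_tensor A)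
    (half_dbl (by decide))).symm

/-- The right unit isomorphism. -/
def rightUnitorIso (A : Conduct m) : tensorConduct A (one m) ≅ A :=
  (relocationIso (dbl 0) half (carrier_tensor_one A) (at_tensor_one A)
    (half_dbl (by decide))).symm

theorem isRelocation_associator (A B C : Conduct m) :
    IsRelocation (associatorIso A B C).hom assocLoc :=
    isRelocation_hom (carrier_assoc A B C) (at_assoc A B C) assocLocInv_assocLoc

theorem isRelocation_associator_inv (A B C : Conduct m) :
    IsRelocation (associatorIso A B C).inv assocLocInv :=
    isRelocation_inv (carrier_assoc A B C) (at_assoc A B C) assocLocInv_assocLoc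

theorem isRelocation_braiding (A B : Conduct m) :
    IsRelocation (braidingIso A B).hom swapLoc :=
    isRelocation_hom (carrier_swap A B) (at_swap A B) swapLoc_swapLoc

theorem isRelocation_leftUnitor (A : Conduct m) :
    IsRelocation (leftUnitorIso A).hom half :=
    isRelocation_inv (carrier_one_tensor A) (at_one_tensor A) (half_dbl Nat.one_lt_two)

theorem isRelocation_leftUnitor_inv (A : Conduct m) :
    IsRelocation (leftUnitorIso A).inv (dbl 1) :=
    isRelocation_hom (carrier_one_tensor A) (at_one_tensor A) (half_dbl Nat.one_lt_two)

theorem isRelocation_rightUnitor (A : Conduct m) :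
    IsRelocation (rightUnitorIso A).hom half :=
    isRelocation_inv (carrier_tensor_one A) (at_tensor_one A) (half_dbl Nat.zero_lt_two)

theorem isRelocation_rightUnitor_inv (A : Conduct m) :
    IsRelocation (rightUnitorIso A).inv (dbl 0) :=
    isRelocation_hom (carrier_tensor_one A) (at_tensor_one A) (half_dbl Nat.zero_lt_two)

theorem lift_comp (θ η : ℕ → ℕ) : lift θ ∘ lift η = lift (θ ∘ η) := rfl

theorem associator_naturality (f : A ⟶ A') (g : B ⟶ B') (h : C ⟶ C') :
    tensorMap (tensorMap f g) h ≫ (associatorIso A' B' C').hom =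
      (associatorIso A B C).hom ≫ tensorMap f (tensorMap g h) := by
  refine (isRelocation_associator _ _ _).naturality (isRelocation_associator _ _ _)
    assocLocInv_assocLoc ?_
  have h1 : assocLoc ∘ dbl 0 ∘ dbl 0 = dbl 0 := by
    funext x
    simp only [assocLoc, merge_dbl_zero, Function.comp_apply]
  have h2 : assocLoc ∘ dbl 0 ∘ dbl 1 = dbl 1 ∘ dbl 0 := by
    funext x
    simp only [assocLoc, merge_dbl_zero, merge_dbl_one, Function.comp_apply]
  have h3 : assocLoc ∘ dbl 1 = dbl 1 ∘ dbl 1 := funext (merge_dbl_one _ _)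
  have hinj : ∀ i, Function.Injective (lift (dbl i)) := fun i => lift_injective (dbl_injective i)
  rw [proj_tensorMap, proj_tensorMap, proj_tensorMap, proj_tensorMap,
    cut_deloc (hinj 0).injOn, cut_deloc (hinj 1).injOn,
    cut_deloc (lift_injective assocLoc_injective).injOn,
    cut_deloc (lift_injective assocLoc_injective).injOn]
  simp only [deloc_deloc, lift_comp, h1, h2, h3]
  rw [cut_assoc]
  intro v h4 h5
  rw [← lift_comp, ← deloc_deloc] at h5
  exact (Finset.disjoint_left.1 (disjoint_lift _ _) h4 h5).elim

theorem braiding_naturality (f : A ⟶ A') (g : B ⟶ B') :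
    tensorMap f g ≫ (braidingIso A' B').hom = (braidingIso A B).hom ≫ tensorMap g f := by
  refine (isRelocation_braiding _ _).naturality (isRelocation_braiding _ _) swapLoc_swapLoc ?_
  have h1 : swapLoc ∘ dbl 0 = dbl 1 := funext (merge_dbl_zero _ _)
  have h2 : swapLoc ∘ dbl 1 = dbl 0 := funext (merge_dbl_one _ _)
  rw [proj_tensorMap, proj_tensorMap, cut_deloc (lift_injective swapLoc_injective).injOn,
    deloc_deloc, deloc_deloc, lift_comp, lift_comp, h1, h2, cut_comm]

theorem deloc_proj_id_one (p : ℕ × ℕ → ℕ × ℕ) : deloc p (proj (𝟙 (one m))) = zero ∅ := by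
  rw [proj_id, fax_eq_link, deloc_link]
  exact (zero_eq_link _ _).symm

theorem leftUnitor_naturality (f : A ⟶ B) :
    tensorMap (𝟙 (one m)) f ≫ (leftUnitorIso B).hom = (leftUnitorIso A).hom ≫ f := by
  have h : f ≫ (leftUnitorIso B).inv = (leftUnitorIso A).inv ≫ tensorMap (𝟙 (one m)) f := by
    refine (isRelocation_leftUnitor_inv _).naturality (isRelocation_leftUnitor_inv _)
      (half_dbl Nat.one_lt_two) ?_
    rw [proj_tensorMap, deloc_proj_id_one, cut_comm, cut_zero]
  rw [← Iso.inv_comp_eq, ← Category.assoc, ← h, Category.assoc, Iso.inv_hom_id, Category.comp_id]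

theorem rightUnitor_naturality (f : A ⟶ B) :
    tensorMap f (𝟙 (one m)) ≫ (rightUnitorIso B).hom = (rightUnitorIso A).hom ≫ f := by
  have h : f ≫ (rightUnitorIso B).inv = (rightUnitorIso A).inv ≫ tensorMap f (𝟙 (one m)) := by
    refine (isRelocation_rightUnitor_inv _).naturality (isRelocation_rightUnitor_inv _)
      (half_dbl Nat.zero_lt_two) ?_
    rw [proj_tensorMap, deloc_proj_id_one, cut_zero]
  rw [← Iso.inv_comp_eq, ← Category.assoc, ← h, Category.assoc, Iso.inv_hom_id, Category.comp_id]

scoped instance conductMonoidalStruct : MonoidalCategoryStruct (Conduct m) where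
  tensorObj := tensorConduct
  tensorHom := tensorMap
  whiskerLeft A _ _ f := tensorMap (𝟙 A) f
  whiskerRight f A := tensorMap f (𝟙 A)
  tensorUnit := one m
  associator := associatorIso
  leftUnitor := leftUnitorIso
  rightUnitor := rightUnitorIso

scoped instance conductMonoidal : MonoidalCategory (Conduct m) := .ofTensorHom
  (id_tensorHom_id := tensorMap_id)
  (id_tensorHom := fun _ _ _ _ => rfl)
  (tensorHom_id := fun _ _ => rfl)
  (tensorHom_comp_tensorHom := tensorMap_comp)
  (associator_naturality := associator_naturality)
  (leftUnitor_naturality := leftUnitor_naturality)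
  (rightUnitor_naturality := rightUnitor_naturality)
  (pentagon := fun A B C D => by
    refine (((isRelocation_associator A B C).tensorMap (.id D)).comp
      ((isRelocation_associator A (tensorConduct B C) D).comp
        ((IsRelocation.id A).tensorMap (isRelocation_associator B C D)))).eq
      ((isRelocation_associator (tensorConduct A B) C D).comp
        (isRelocation_associator A B (tensorConduct C D))) fun n hn => ?_
    clear hn
    revert n
    refine forall_of_dbl (forall_of_dbl (forall_of_dbl (fun x => ?_) fun x => ?_) fun x => ?_)
      fun x => ?_ <;>
    simp only [assocLoc, merge_dbl_zero, merge_dbl_one, Function.comp_apply, id])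
  (triangle := fun A B => by
    refine ((isRelocation_associator A (one m) B).comp
      ((IsRelocation.id A).tensorMap (isRelocation_leftUnitor B))).eq
      ((isRelocation_rightUnitor A).tensorMap (.id B)) ?_
    refine forall_tensorCarrier.2 ⟨forall_tensorCarrier.2 ⟨fun x _ => ?_, fun x hx => ?_⟩,
      fun x _ => ?_⟩
    · simp only [assocLoc, merge_dbl_zero, Function.comp_apply, id, half_dbl Nat.zero_lt_two]
    · exact (Finset.notMem_empty x hx).elim
    · simp only [assocLoc, merge_dbl_one, Function.comp_apply, id, half_dbl Nat.one_lt_two])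

scoped instance conductSymmetric : SymmetricCategory (Conduct m) where
  braiding := braidingIso
  braiding_naturality_right A _ _ f := braiding_naturality (𝟙 A) f
  braiding_naturality_left f A := braiding_naturality f (𝟙 A)
  hexagon_forward A B C := by
    refine ((isRelocation_associator A B C).comp ((isRelocation_braiding A (tensorConduct B C)).comp
      (isRelocation_associator B C A))).eq
      (((isRelocation_braiding A B).tensorMap (.id C)).comp ((isRelocation_associator B A C).comp
        ((IsRelocation.id B).tensorMap (isRelocation_braiding A C)))) fun n hn => ?_
    clear hn
    revert n
    refine forall_of_dbl (forall_of_dbl (fun x => ?_) fun x => ?_) fun x => ?_ <;>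
    simp only [assocLoc, swapLoc, merge_dbl_zero, merge_dbl_one, Function.comp_apply, id]
  hexagon_reverse A B C := by
    refine ((isRelocation_associator_inv A B C).comp
      ((isRelocation_braiding (tensorConduct A B) C).comp (isRelocation_associator_inv C A B))).eq
      (((IsRelocation.id A).tensorMap (isRelocation_braiding B C)).comp
        ((isRelocation_associator_inv A C B).comp
          ((isRelocation_braiding A C).tensorMap (.id B)))) fun n hn => ?_
    clear hn
    revert n
    refine forall_of_dbl (fun x => ?_) (forall_of_dbl (fun x => ?_) fun x => ?_) <;>
    simp only [assocLocInv, swapLoc, merge_dbl_zero, merge_dbl_one, Function.comp_apply, id]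
  symmetry A B := ((isRelocation_braiding A B).comp (isRelocation_braiding B A)).eq
    (.id _) fun x _ => swapLoc_swapLoc x

end Monoidal

/-! ### Internal homs -/

section Closed

variable {m : Set.Ioc (0 : ℝ) 1 → ℝ≥0∞}

open Project Conduct

/-- The internal hom: the conduct `A ⊸ B`, with `A` on the even and `B` on the odd locations. -/
def ihomConduct (A B : Conduct m) : Conduct m where
  carrier := tensorCarrier A B
  projects := lolli m (A.carrier.image (dbl 0)) (A.at' (dbl 0)) (B.carrier.image (dbl 1))
    (B.at' (dbl 1))
  carrier_eq f hf := by rw [hf.1, tensorCarrier_eq]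
  biorth := by
    rw [tensorCarrier_eq, lolli_biorth (disjoint_dbl _ _) carrier_at
      (biorth_at _ (dbl_injective 1).injOn)]

theorem at_ihomConduct {L : Type} [DecidableEq L] (A B : Conduct m) {p : ℕ → L}
    (hp : Function.Injective p) : (ihomConduct A B).at' p =
      lolli m (A.carrier.image (p ∘ dbl 0)) (A.at' (p ∘ dbl 0)) (B.carrier.image (p ∘ dbl 1))
        (B.at' (p ∘ dbl 1)) := by
  change deloc p '' lolli m _ _ _ _ = _
  rw [← lolli_deloc (disjoint_dbl _ _) hp.injOn carrier_at carrier_at,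
    deloc_image_at, deloc_image_at, Finset.image_image, Finset.image_image]

/-- The vertices of a project from `A ⊗ B` to `C`, sent to those of its transpose from `B` to
`A ⊸ C`. -/
def curryLoc : ℕ × ℕ → ℕ × ℕ := place (merge (ψ 1 ∘ dbl 0) (ψ 0)) (ψ 1 ∘ dbl 1)

/-- The inverse of `curryLoc`. -/
def uncurryLoc : ℕ × ℕ → ℕ × ℕ := place (ψ 0 ∘ dbl 1) (merge (ψ 0 ∘ dbl 0) (ψ 1))

theorem uncurryLoc_curryLoc {V W : Finset ℕ} {p : ℕ × ℕ} (hp : p ∈ levels V W 0 1) :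
    uncurryLoc (curryLoc p) = p := by
  rcases Finset.mem_union.1 hp with h | h <;> obtain ⟨x, -, rfl⟩ := Finset.mem_image.1 h
  · change uncurryLoc (merge (ψ 1 ∘ dbl 0) (ψ 0) x) = _
    rcases exists_dbl x with ⟨x, rfl⟩ | ⟨x, rfl⟩
    · rw [merge_dbl_zero]
      exact merge_dbl_zero _ _ x
    · rw [merge_dbl_one]
      rfl
  · exact merge_dbl_one _ _ x

/-- The relocation `curryLoc` turns `(A ⊗ B) ⊸ C` into `B ⊸ (A ⊸ C)`. -/
theorem deloc_image_mor_tensor (A B C : Conduct m) :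
    deloc curryLoc '' Mor (tensorConduct A B) C = Mor B (ihomConduct A C) := by
  have h0 : curryLoc ∘ ψ 0 = merge (ψ 1 ∘ dbl 0) (ψ 0) := rfl
  have h1 : curryLoc ∘ ψ 1 = ψ 1 ∘ dbl 1 := rfl
  have hinj : Function.Injective (merge (ψ 1 ∘ dbl 0) (ψ 0)) :=
    merge_injective ((ψ_injective 1).comp (dbl_injective 0)) (ψ_injective 0) fun x y h =>
      one_ne_zero (congrArg Prod.snd h)
  have h2 : merge (ψ 1 ∘ dbl 0) (ψ 0) ∘ dbl 0 = ψ 1 ∘ dbl 0 := funext (merge_dbl_zero _ _)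
  have h3 : merge (ψ 1 ∘ dbl 0) (ψ 0) ∘ dbl 1 = ψ 0 := funext (merge_dbl_one _ _)
  have hd := disjoint_image_dbl hinj A.carrier B.carrier
  have hd' : ∀ (V W : Finset ℕ) (f : ℕ → ℕ), Disjoint (V.image (ψ 0)) (W.image (ψ 1 ∘ f)) := by
    intro V W f
    rw [← Finset.image_image]
    exact disjoint_ψ _ _ (by decide)
  rw [deloc_image_mor, h0, h1, at_tensorConduct _ _ hinj, mor_eq,
    at_ihomConduct _ _ (ψ_injective 1)]
  · change lolli m ((tensorCarrier A B).image _) _ _ _ =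
      lolli m _ _ ((tensorCarrier A C).image _) _
    rw [image_tensorCarrier, image_tensorCarrier]
    rw [h2, h3] at hd ⊢
    exact lolli_curry hd (disjoint_image_dbl (ψ_injective 1) _ _) (hd' _ _ _) carrier_at carrier_at
      (biorth_at _ ((ψ_injective 1).comp (dbl_injective 1)).injOn)
  · exact Set.LeftInvOn.injOn (f₁' := uncurryLoc) fun p hp => uncurryLoc_curryLoc hp

theorem deloc_uncurryLoc {A B C : Conduct m} {f : Project (ℕ × ℕ)}
    (hf : f ∈ Mor (tensorConduct A B) C) : deloc uncurryLoc (deloc curryLoc f) = f := by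
  rw [deloc_deloc]
  exact deloc_eq_self fun p hp => uncurryLoc_curryLoc (hf.1 ▸ hp)

/-- Transposition is a relocation. -/
def curryEquiv (A B C : Conduct m) : (tensorConduct A B ⟶ C) ≃ (B ⟶ ihomConduct A C) where
  toFun f := homMk (deloc curryLoc (proj f))
    (deloc_image_mor_tensor A B C ▸ ⟨proj f, proj_mem f, rfl⟩)
  invFun g := homMk (deloc uncurryLoc (proj g)) (by
    have h := proj_mem g
    rw [← deloc_image_mor_tensor] at h
    obtain ⟨f, hf, e⟩ := h
    rw [← e, deloc_uncurryLoc hf]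
    exact hf)
  left_inv f := homMk_ext (deloc_uncurryLoc (proj_mem f))
  right_inv g := by
    refine homMk_ext ?_
    have h := proj_mem g
    rw [← deloc_image_mor_tensor] at h
    obtain ⟨f, hf, e⟩ := h
    change deloc curryLoc (deloc uncurryLoc (proj g)) = proj g
    rw [← e, deloc_uncurryLoc hf]

/-- In the execution of `A ⊗ f` and `g`, the fax on `A` only moves the vertices of `g`; the map
`Q` below moves the vertices of that execution to those of the execution of `f` and the transpose
of `g`. -/
theorem curryEquiv_naturality {A B B' C : Conduct m} (f : B' ⟶ B) (g : tensorConduct A B ⟶ C) :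
    curryEquiv A B' C (tensorMap (𝟙 A) f ≫ g) = f ≫ curryEquiv A B C g := by
  refine homMk_ext ?_
  change deloc curryLoc (proj (tensorMap (𝟙 A) f ≫ g)) = comp m (proj f) (deloc curryLoc (proj g))
  -- `ρ` is the effect of the fax on `A`, and `P` describes the vertices that occur
  let ρ : ℕ × ℕ → ℕ × ℕ := fun p => if p.2 = 1 ∧ p.1 % 2 = 0 then (p.1, 0) else p
  let Q : ℕ × ℕ → ℕ × ℕ := fun p => if p.2 = 0 then if p.1 % 2 = 0 then (p.1, 2) else (p.1 / 2, 0)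
    else if p.2 = 1 then (p.1 / 2, 1) else (2 * p.1 + 1, 2)
  let P : ℕ × ℕ → Prop := fun p => p.2 = 0 ∨ p.2 = 1 ∧ p.1 % 2 = 1 ∨ p.2 = 2
  have hg : ∀ p ∈ (proj g).carrier, p.2 = 0 ∨ p.2 = 1 := fun p hp =>
    snd_of_mem_levels (carrier_proj g ▸ hp)
  have hf : ∀ p ∈ (proj f).carrier, p.2 = 0 ∨ p.2 = 1 := fun p hp =>
    snd_of_mem_levels (carrier_proj f ▸ hp)
  have hP1 : ∀ p ∈ (deloc (lift (dbl 1)) (proj f)).carrier, P p := by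
    intro p hp
    rw [carrier_deloc] at hp
    obtain ⟨q, hq, rfl⟩ := Finset.mem_image.1 hp
    have := hf q hq
    change q.2 = 0 ∨ q.2 = 1 ∧ (2 * q.1 + 1) % 2 = 1 ∨ q.2 = 2
    omega
  have hP2 : ∀ p ∈ (deloc ρ (deloc μ (proj g))).carrier, P p := by
    intro p hp
    rw [deloc_deloc, carrier_deloc] at hp
    obtain ⟨q, hq, rfl⟩ := Finset.mem_image.1 hp
    have := hg q hq
    by_cases h : q.2 + 1 = 1 ∧ q.1 % 2 = 0
    · exact Or.inl (congrArg Prod.snd (if_pos h : ρ (μ q) = (q.1, 0)))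
    · rw [Function.comp_apply, show ρ (μ q) = μ q from if_neg h]
      change q.2 + 1 = 0 ∨ q.2 + 1 = 1 ∧ q.1 % 2 = 1 ∨ q.2 + 1 = 2
      omega
  have hQ : ∀ p q, P p → P q → Q p = Q q → p = q := by
    intro p q hp hq e
    simp only [P] at hp hq
    simp only [Q] at e
    split_ifs at e <;> simp only [Prod.mk.injEq] at e <;> exact Prod.ext (by omega) (by omega)
  have hν : ∀ p, P p → curryLoc (ν p) = ν (Q p) := by
    rintro ⟨x, i⟩ hp
    rcases hp with h | ⟨h, hx⟩ | h <;> dsimp only at h <;> subst h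
    · rcases exists_dbl x with ⟨x, rfl⟩ | ⟨x, rfl⟩
      · simp [curryLoc, place, merge, Q, ν, ψ, dbl]
      · have : (2 * x + 1) / 2 = x := by omega
        simp [curryLoc, place, merge, Q, ν, ψ, dbl, this]
    · dsimp only at hx
      simp [curryLoc, place, merge, Q, ν, ψ, hx]
    · simp [curryLoc, place, Q, ν, ψ, dbl]
  have hX : cut m (proj (tensorMap (𝟙 A) f)) (deloc μ (proj g)) =
      cut m (deloc (lift (dbl 1)) (proj f)) (deloc ρ (deloc μ (proj g))) := by
    have h1 : cut m (deloc μ (proj g)) (deloc (lift (dbl 0)) (proj (𝟙 A))) =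
        deloc ρ (deloc μ (proj g)) := by
      have hmem : ∀ v ∈ A.carrier, dbl 0 v ∈ tensorCarrier A B := by
        intro v hv
        rw [tensorCarrier_eq]
        exact Finset.mem_union_left _ (Finset.mem_image_of_mem _ hv)
      rw [proj_id, fax_eq_link, deloc_link, link_swap]
      refine cut_link ?_ ?_ ?_ ?_ ?_
      · intro v hv
        rw [carrier_deloc, carrier_proj]
        exact Finset.mem_image_of_mem μ (Finset.mem_union_left _
          (Finset.mem_image_of_mem (ψ 0) (hmem v hv)))
      · intro v hv h
        rw [carrier_deloc] at h
        obtain ⟨q, -, e⟩ := Finset.mem_image.1 h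
        exact Nat.succ_ne_zero _ (congrArg Prod.snd e)
      · exact ((lift_injective (dbl_injective 0)).comp (ψ_injective 1)).injOn
      · intro v hv
        exact if_pos ⟨rfl, by change (2 * v + 0) % 2 = 0; omega⟩
      · intro p hp hp'
        refine if_neg fun h => hp' ?_
        rw [carrier_deloc, carrier_proj, image_μ_levels] at hp
        rcases Finset.mem_union.1 hp with h' | h' <;> obtain ⟨x, hx, rfl⟩ := Finset.mem_image.1 h'
        · have hx : x ∈ tensorCarrier A B := hx
          rw [tensorCarrier_eq] at hx
          rcases Finset.mem_union.1 hx with h' | h' <;> obtain ⟨y, hy, rfl⟩ := Finset.mem_image.1 h'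
          · exact Finset.mem_image.2 ⟨y, hy, rfl⟩
          · have : (2 * y + 1) % 2 = 0 := h.2
            omega
        · exact absurd h.1 (by simp [ψ])
    rw [proj_tensorMap, cut_comm (deloc (lift (dbl 0)) _), cut_assoc, cut_comm _ (deloc μ _), h1]
    intro v h2 h3
    exact (Finset.disjoint_left.1 (disjoint_lift _ _) h3 h2).elim
  have hQf : deloc Q (deloc (lift (dbl 1)) (proj f)) = proj f := by
    rw [deloc_deloc]
    refine deloc_eq_self fun p hp => ?_
    obtain ⟨x, i⟩ := p
    have : (2 * x + 1) / 2 = x := by omega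
    rcases hf _ hp with h | h <;> dsimp only at h <;> subst h <;> simp [Q, lift, dbl, this]
  have hQg : deloc Q (deloc ρ (deloc μ (proj g))) = deloc μ (deloc curryLoc (proj g)) := by
    rw [deloc_deloc, deloc_deloc, deloc_deloc]
    refine deloc_congr fun p hp => ?_
    obtain ⟨x, i⟩ := p
    rcases hg _ hp with h | h <;> dsimp only at h <;> subst h
    · rcases exists_dbl x with ⟨x, rfl⟩ | ⟨x, rfl⟩
      · simp [Q, ρ, μ, curryLoc, place, merge, ψ, dbl]
      · have : (2 * x + 1) / 2 = x := by omega
        simp [Q, ρ, μ, curryLoc, place, merge, ψ, dbl, this]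
    · simp [Q, ρ, μ, curryLoc, place, ψ, dbl]
  have hc : ∀ p ∈ (cut m (deloc (lift (dbl 1)) (proj f)) (deloc ρ (deloc μ (proj g)))).carrier,
      P p := by
    intro p hp
    rw [carrier_cut] at hp
    rcases Finset.mem_union.1 (Finset.symmDiff_subset_union hp) with h | h
    · exact hP1 p h
    · exact hP2 p h
  rw [proj_comp]
  unfold comp
  rw [hX, ← hQg]
  nth_rewrite 2 [← hQf]
  rw [← cut_deloc]
  · exact (deloc_deloc _ _ _).trans
      ((deloc_congr (f := curryLoc ∘ ν) (g := ν ∘ Q) fun p hp => hν p (hc p hp)).trans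
        (deloc_deloc _ _ _).symm)
  · intro p hp q hq
    have h : ∀ p ∈ (deloc (lift (dbl 1)) (proj f)).carrier ∪
        (deloc ρ (deloc μ (proj g))).carrier, P p := by
      intro p hp
      rcases Finset.mem_union.1 hp with h | h
      · exact hP1 p h
      · exact hP2 p h
    exact hQ p q (h p hp) (h q hq)

scoped instance conductClosed : MonoidalClosed (Conduct m) where
  closed A := {
    rightAdj := Adjunction.rightAdjointOfEquiv (F := tensorLeft A) (fun B C => curryEquiv A B C)
      fun _ _ _ f g => curryEquiv_naturality f g
    adj := Adjunction.adjunctionOfEquivRight (F := tensorLeft A) (fun B C => curryEquiv A B C)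
      fun _ _ _ f g => curryEquiv_naturality f g }

theorem curry_eq {A B C : Conduct m} (f : A ⊗ B ⟶ C) :
    MonoidalClosed.curry f = curryEquiv A B C f := by
  change (Adjunction.adjunctionOfEquivRight (F := tensorLeft A) (fun B C => curryEquiv A B C)
    fun _ _ _ f g => curryEquiv_naturality f g).homEquiv _ _ f = _
  rw [Adjunction.adjunctionOfEquivRight, Adjunction.mkOfHomEquiv_homEquiv]

theorem ev_eq (A B : Conduct m) : (ihom.ev A).app B =
    (curryEquiv A (ihomConduct A B) B).symm (𝟙 (ihomConduct A B)) := rfl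

/-! ### The dualizing object -/

/-- Linear negation: `S ⊸ ⊥` is the orthogonal of `S`. -/
theorem lolli_bot {L : Type} [DecidableEq L] {V : Finset L} {S : Set (Project L)}
    (hS : ∀ a ∈ S, a.carrier = V) (p : ℕ → L) :
    lolli m V S ((bot m).carrier.image p) ((bot m).at' p) = polar m V S := by
  change lolli m V S ∅ _ = _
  rw [at_bot, lolli_polar (Finset.disjoint_empty_right _) hS (by rintro _ rfl; rfl),
    image2_cut_comm, image2_zero_left, Finset.union_empty]

/-- The double dual of `A` is a relocation of `A`, because `A` is equal to its bi-orthogonal. -/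
theorem at_ihom_ihom_bot (A : Conduct m) : A.at' (dbl 0 ∘ dbl 0) =
    (ihomConduct (ihomConduct A (bot m)) (bot m)).projects := by
  change _ = lolli m ((ihomConduct A (bot m)).carrier.image (dbl 0))
    ((ihomConduct A (bot m)).at' (dbl 0)) ((bot m).carrier.image (dbl 1)) ((bot m).at' (dbl 1))
  have hc : (ihomConduct A (bot m)).carrier.image (dbl 0) = A.carrier.image (dbl 0 ∘ dbl 0) :=
    (image_tensorCarrier A (bot m) (dbl 0)).trans (Finset.union_empty _)
  rw [lolli_bot carrier_at, hc, at_ihomConduct _ _ (dbl_injective 0), lolli_bot carrier_at,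
    biorth_at _ ((dbl_injective 0).comp (dbl_injective 0)).injOn]

/-- The canonical morphism from `A` to its double dual is a relocation. -/
theorem isDualizing_bot : IsDualizing (bot m) := by
  intro A
  have hc : ∀ A : Conduct m, tensorCarrier A (bot m) = A.carrier.image (dbl 0) := by
    intro A
    rw [tensorCarrier_eq]
    exact Finset.union_empty _
  have h : IsRelocation (A := A) (B := ihomConduct (ihomConduct A (bot m)) (bot m))
      (MonoidalClosed.curry ((β_ ((ihom A).obj (bot m)) A).hom ≫ (ihom.ev A).app (bot m)))
      (dbl 0 ∘ dbl 0) := by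
    constructor
    · rw [curry_eq, ev_eq]
      change deloc curryLoc (proj ((braidingIso (ihomConduct A (bot m)) A).hom ≫
        (curryEquiv A (ihomConduct A (bot m)) (bot m)).symm (𝟙 _))) = _
      rw [proj_comp, (isRelocation_braiding _ _).proj_eq, link_comp
        (isRelocation_braiding _ _).carrier_eq (carrier_proj _) fun x _ => swapLoc_swapLoc x]
      change deloc curryLoc (deloc _ (deloc uncurryLoc (fax (tensorCarrier A (bot m))))) = _
      rw [fax_eq_link, deloc_link, deloc_link, deloc_link, hc, link_image (dbl_injective 0).injOn,
        link_swap]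
      refine link_congr (fun x _ => ?_) fun x _ => ?_ <;>
        simp [curryLoc, uncurryLoc, swapLoc, place, merge, dbl, ψ] <;> omega
    · change tensorCarrier (ihomConduct A (bot m)) (bot m) = _
      rw [hc]
      change (tensorCarrier A (bot m)).image (dbl 0) = _
      rw [hc, Finset.image_image]
  exact h.isIso (θ' := half ∘ half) (fun x => by
    simp only [Function.comp_apply, half_dbl Nat.zero_lt_two]) (at_ihom_ihom_bot A)

end Closed
end IG
end

/-- For every parameter `m`, conducts with carrier in `ℕ` and their morphisms form a category
which, with the tensor product and the unit `1_∅`, is symmetric monoidal closed, and in which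
`⊥_∅` is dualizing. -/
theorem mainTheorem1 (m : Set.Ioc (0 : ℝ) 1 → ℝ≥0∞) :
    ∃ h : IG.CategoryLaws m,
      letI : Category (IG.Conduct m) := h.category
      ∃ (_ : MonoidalCategory (IG.Conduct m)) (_ : SymmetricCategory (IG.Conduct m))
        (_ : MonoidalClosed (IG.Conduct m)),
        (∀ A B : IG.Conduct m,
          (A ⊗ B).carrier = IG.tensorCarrier A B ∧ (A ⊗ B).projects = IG.tensorProjects A B) ∧
        (∀ {A A' B B' : IG.Conduct m} (f : A ⟶ A') (g : B ⟶ B'),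
          h.proj (f ⊗ₘ g) = IG.tensorMor m (h.proj f) (h.proj g)) ∧
        𝟙_ (IG.Conduct m) = IG.Conduct.one m ∧
        IsDualizing (IG.Conduct.bot m) := by
  exact ⟨IG.categoryLaws m, IG.conductMonoidal, IG.conductSymmetric, IG.conductClosed,
    fun _ _ => ⟨rfl, rfl⟩, fun _ _ => rfl, rfl, IG.isDualizing_bot⟩
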